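/- **Setting.** Let $(x_0,X,Y)$ with $x_0,Y\in\mathbb R$, $X\in\mathbb R^p$ follow the monotone index model $Y=F_0(z_0)+\varepsilon$, $z_0=x_0+X'\theta_0$, $\mathbb E(\varepsilon\mid x_0,X)=0$, with $F_0:\mathbb R\to\mathbb R$ increasing and $\theta_0\in\mathbb R^p$. In round $k\ge1$ a batch $W_k=\{(x_{0,i,k},X_{i,k},Y_{i,k})\}_{i=1}^B$, $B\ge 1$, is observed; all observations are i.i.d. copies of $(x_0,X,Y)$. Let $\psi_1,\psi_2,\dots$ be differentiable functions on $\mathbb R$, $\Psi_J=(\psi_1,\dots,\psi_J)'$, $\mathcal S_J=\mathrm{span}(\psi_1,\dots,\psi_J)$, $\Gamma_J=\mathbb E[\Psi_J(z_0)\Psi_J(z_0)']$, $\mathbb P_J(f)(z)=\Psi_J(z)'\Gamma_J^{-1}\mathbb E[\Psi_J(z_0)f(z_0)]$ and $\mathcal B_{J,0}=\Gamma_J^{-1}\mathbb E[\Psi_J(z_0)F_0(z_0)]$. Write $\|f\|_\infty=\sup_{z\in\mathbb R}|f(z)|$, and for a vector $a$ of length at most $J_k$ let $[a]_k$ be $a$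 extended by zeros to length $J_k$. **Algorithm.** Let $\eta_k=\eta_0k^{-\alpha_\eta}$ and $J_k=\lfloor J_0k^{\alpha_J}\rfloor$ for $k\ge1$, with constants $\eta_0,\alpha_\eta,\alpha_J>0$ and a positive integer $J_0$. Let $\hat{\mathcal B}_0\in\mathbb R^{J_0}$ be given (deterministic). Let $\check\theta_k$, $k\ge0$, be plug-in estimators of $\theta_0$, put $\check z_{i,k}=x_{0,i,k}+X_{i,k}'\check\theta_{k-1}$, and for $k\ge1$ $$\hat{\mathcal B}_k=[\hat{\mathcal B}_{k-1}]_k+\frac{\eta_k}{B}\sum_{i=1}^B\bigl(Y_{i,k}-\Psi_{J_k}(\check z_{i,k})'[\hat{\mathcal B}_{k-1}]_k\bigr)\Psi_{J_k}(\check z_{i,k}),\qquad \Delta\hat{\mathcal B}_k=\hat{\mathcal B}_k-\mathcal B_{J_k,0}.$$ **Theorem.** Suppose that: 1. $\displaystyle\limsup_{J\to\infty}\ \sup_{g\in\mathcal S_J:\,0<\|F_0-g\|_\infty<\infty}\|F_0-g\|_\infty^{-1}\|\mathbb P_J(F_0-g)\|_\infty<\infty$; there is $C$ such that for every $J\ge1$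 some $g_J^*\in\mathcal S_J$ satisfies $\|F_0-g_J^*\|_\infty\le CJ^{-s}$; and $\|\partial F_0-\partial\mathbb P_J(F_0)\|_\infty\le CJ^{-s_1}$ for all $J\geq 1$, for some $0<s_1\le s$; 2. $\|\psi_j\|_\infty\le C$ and $\|\partial\psi_j\|_\infty\le Cj^{\alpha_\psi}$ for all $j\ge1$, with $\alpha_\psi>0$; the eigenvalues of $\Gamma_J$ are bounded away from $0$ and from $\infty$ uniformly in $J\geq 1$; 3. $\check\theta_k$ is $\sigma(W_1,\dots,W_k)$-measurable for each $k\ge0$, and for some $\alpha_\theta>0$, almost surely $\|\check\theta_k-\theta_0\|=O(k^{-\alpha_\theta})$ up to a fixed power of $\log k$; 4. $1>\alpha_\eta>2\alpha_J$, $\ \alpha_\theta>\alpha_J(1+\alpha_\psi)$, $\ s>1$, $\ \alpha_\eta+(2s-1)\alpha_J>1$, $\ \alpha_\eta+2\alpha_\theta-\alpha_J(1+2\alpha_\psi)>1$, $\ 2\alpha_\eta>1+\alpha_J$; 5. $F_0$ is differentiable with bounded derivative, $\mathbb E\|X\|^2<\infty$, and $\mathbb E|\varepsilon|^\kappa<\infty$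 for some $\kappa>2+2/\alpha_\eta$; 6. $\max\{\tfrac12+\alpha_J,\ 1+2\alpha_J(1+\alpha_\psi)-2\alpha_\theta\}<\alpha_\eta<\min\{2\alpha_\theta-2\alpha_J\alpha_\psi,\ \alpha_J(2s+1)\}$. Then $$\|\Delta\hat{\mathcal B}_N\|=O\bigl(N^{-\frac{\alpha_\eta-\alpha_J}{2}}\log^{\frac12}(N)\bigr)\quad\text{almost surely, as }N\to\infty .$$ -/

import Mathlib

open MeasureTheory ProbabilityTheory Filter Asymptotics
open scoped ENNReal Matrix

noncomputable section

namespace OnlineSieve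

/-- One observation `(x₀, X, Y)`, with `X` a `p`-dimensional regressor. -/
abbrev Obs (p : ℕ) : Type := ℝ × EuclideanSpace ℝ (Fin p) × ℝ

/-- The single index `x₀ + X'θ` of an observation. -/
def index {p : ℕ} (θ : EuclideanSpace ℝ (Fin p)) (w : Obs p) : ℝ :=
  w.1 + inner ℝ w.2.1 θ

/-- The error term `ε = Y - F₀(x₀ + X'θ₀)` of an observation. -/
def noise {p : ℕ} (F₀ : ℝ → ℝ) (θ₀ : EuclideanSpace ℝ (Fin p)) (w : Obs p) : ℝ :=
  w.2.2 - F₀ (index θ₀ w)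

/-- The supremum norm over the real line, with value `∞` for unbounded functions. -/
def supNorm (f : ℝ → ℝ) : ℝ≥0∞ := ⨆ z : ℝ, ‖f z‖ₑ

/-- The sieve vector `Ψ_J(z) = (ψ_1(z), …, ψ_J(z))'`. The basis functions are `ψ j` for `j ≥ 1`;
`ψ 0` is never used. -/
def sieveVec (ψ : ℕ → ℝ → ℝ) (J : ℕ) (z : ℝ) : EuclideanSpace ℝ (Fin J) :=
  WithLp.toLp 2 fun j : Fin J => ψ ((j : ℕ) + 1) z

/-- The sieve space `S_J` spanned by `ψ_1, …, ψ_J`. -/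
def sieveSpace (ψ : ℕ → ℝ → ℝ) (J : ℕ) : Submodule ℝ (ℝ → ℝ) :=
  Submodule.span ℝ (Set.range fun j : Fin J => ψ ((j : ℕ) + 1))

/-- The Gram matrix `Γ_J = E[Ψ_J(z₀) Ψ_J(z₀)']`, `z₀ = x₀ + X'θ₀`, where `(x₀, X, Y)` has
law `ρ`. -/
def gram {p : ℕ} (ρ : Measure (Obs p)) (θ₀ : EuclideanSpace ℝ (Fin p)) (ψ : ℕ → ℝ → ℝ) (J : ℕ) :
    Matrix (Fin J) (Fin J) ℝ :=
  Matrix.of fun i j =>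
    ∫ w, sieveVec ψ J (index θ₀ w) i * sieveVec ψ J (index θ₀ w) j ∂ρ

/-- The coefficient vector `Γ_J⁻¹ E[Ψ_J(z₀) f(z₀)]` of the `L²`-projection of `f` on `S_J`; for
`f = F₀` this is the pseudo-true sieve coefficient. -/
def projCoef {p : ℕ} (ρ : Measure (Obs p)) (θ₀ : EuclideanSpace ℝ (Fin p)) (ψ : ℕ → ℝ → ℝ)
    (J : ℕ) (f : ℝ → ℝ) : EuclideanSpace ℝ (Fin J) :=
  WithLp.toLp 2 ((gram ρ θ₀ ψ J)⁻¹ *ᵥ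
    fun j => ∫ w, sieveVec ψ J (index θ₀ w) j * f (index θ₀ w) ∂ρ)

/-- The `L²`-projection `P_J(f)(z) = Ψ_J(z)' Γ_J⁻¹ E[Ψ_J(z₀) f(z₀)]`. -/
def proj {p : ℕ} (ρ : Measure (Obs p)) (θ₀ : EuclideanSpace ℝ (Fin p)) (ψ : ℕ → ℝ → ℝ)
    (J : ℕ) (f : ℝ → ℝ) (z : ℝ) : ℝ :=
  inner ℝ (sieveVec ψ J z) (projCoef ρ θ₀ ψ J f)

/-- Extend a vector by zeros to length `n`. -/
def pad {m : ℕ} (n : ℕ) (a : EuclideanSpace ℝ (Fin m)) : EuclideanSpace ℝ (Fin n) :=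
  WithLp.toLp 2 fun i : Fin n => if h : (i : ℕ) < m then a ⟨i, h⟩ else 0

/-- The sieve dimensions: `J_k = ⌊J₀ k^{α_J}⌋` for `k ≥ 1`, and the initial dimension is `J₀`
(which is also `J_1`). -/
def sieveDim (J₀ : ℕ) (αJ : ℝ) (k : ℕ) : ℕ :=
  if k = 0 then J₀ else ⌊(J₀ : ℝ) * (k : ℝ) ^ αJ⌋₊

/-- The learning rates `η_k = η₀ k^{-α_η}` (used for `k ≥ 1`). -/
def learnRate (η₀ αη : ℝ) (k : ℕ) : ℝ := η₀ * (k : ℝ) ^ (-αη)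

/-- The online sieve coefficient estimator along one data path. In round `k + 1` the previous
coefficient vector is extended by zeros to length `J (k + 1)` and then updated with the batch
`W (k + 1)`, the index being evaluated at the current plug-in value `θc k`. -/
def sieveIter {p B : ℕ} (ψ : ℕ → ℝ → ℝ) (J : ℕ → ℕ) (η : ℕ → ℝ)
    (b₀ : EuclideanSpace ℝ (Fin (J 0))) (W : ℕ → Fin B → Obs p)
    (θc : ℕ → EuclideanSpace ℝ (Fin p)) : (k : ℕ) → EuclideanSpace ℝ (Fin (J k))
  | 0 => b₀
  | k + 1 =>
    let a : EuclideanSpace ℝ (Fin (J (k + 1))) := pad (J (k + 1)) (sieveIter ψ J η b₀ W θc k)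
    let Ψ : Fin B → EuclideanSpace ℝ (Fin (J (k + 1))) :=
      fun i => sieveVec ψ (J (k + 1)) (index (θc k) (W (k + 1) i))
    a + (η (k + 1) / (B : ℝ)) • ∑ i : Fin B, ((W (k + 1) i).2.2 - inner ℝ (Ψ i) a) • Ψ i

/-- The monotone index model `Y = F₀(x₀ + X'θ₀) + ε`, `E(ε | x₀, X) = 0`, `F₀` increasing, for
the law `ρ` of `(x₀, X, Y)`. -/
structure IndexModel {p : ℕ} (ρ : Measure (Obs p)) (F₀ : ℝ → ℝ)
    (θ₀ : EuclideanSpace ℝ (Fin p)) : Prop where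
  mono : Monotone F₀
  integrable_noise : Integrable (noise F₀ θ₀) ρ
  condExp_noise : ρ[noise F₀ θ₀ | MeasurableSpace.comap
    (fun w : Obs p => (w.1, w.2.1)) inferInstance] =ᵐ[ρ] 0

/-- The observations `obs k i`, `k ≥ 1`, `i = 1, …, B` (observation `i` of round `k`), are i.i.d.
with law `ρ`. Nothing is required of `obs 0`, which is never used. -/
structure IsSample {Ω : Type*} [MeasurableSpace Ω] (μ : Measure Ω) {p B : ℕ}
    (ρ : Measure (Obs p)) (obs : ℕ → Fin B → Ω → Obs p) : Prop where
  meas : ∀ k, 1 ≤ k → ∀ i, Measurable (obs k i)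
  law : ∀ k, 1 ≤ k → ∀ i, μ.map (obs k i) = ρ
  indep : iIndepFun (fun q : ℕ × Fin B => obs (q.1 + 1) q.2) μ

/-- The σ-algebra `σ(W_1, …, W_k)` generated by the first `k` batches. -/
abbrev history {Ω : Type*} {p B : ℕ} (obs : ℕ → Fin B → Ω → Obs p) (k : ℕ) : MeasurableSpace Ω :=
  ⨆ j ∈ Finset.Icc 1 k, ⨆ i : Fin B, MeasurableSpace.comap (obs j i) inferInstance

/-- Approximation of `F₀` by the sieve: stability of the `L²`-projection in the supremum norm,
uniform approximation at rate `J^{-s}`, and approximation of the derivative at rate `J^{-s₁}`. -/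
structure SieveApprox {p : ℕ} (ρ : Measure (Obs p)) (θ₀ : EuclideanSpace ℝ (Fin p))
    (ψ : ℕ → ℝ → ℝ) (F₀ : ℝ → ℝ) (s s₁ : ℝ) : Prop where
  stable : limsup (fun J : ℕ => ⨆ g ∈ sieveSpace ψ J,
    ⨆ (_ : 0 < supNorm (F₀ - g) ∧ supNorm (F₀ - g) < ∞),
      (supNorm (F₀ - g))⁻¹ * supNorm (proj ρ θ₀ ψ J (F₀ - g))) atTop < ∞
  approx : ∃ C : ℝ, 0 < C ∧ ∀ J : ℕ, 1 ≤ J → ∃ g ∈ sieveSpace ψ J,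
    supNorm (F₀ - g) ≤ ENNReal.ofReal (C * (J : ℝ) ^ (-s))
  approx_deriv : ∃ C : ℝ, 0 < C ∧ ∀ J : ℕ, 1 ≤ J →
    supNorm (deriv F₀ - deriv (proj ρ θ₀ ψ J F₀)) ≤ ENNReal.ofReal (C * (J : ℝ) ^ (-s₁))

/-- Bounds on the basis functions and their derivatives, and eigenvalues of the Gram matrices
bounded away from zero and from infinity uniformly in `J`. -/
structure SieveBasis {p : ℕ} (ρ : Measure (Obs p)) (θ₀ : EuclideanSpace ℝ (Fin p))
    (ψ : ℕ → ℝ → ℝ) (αψ : ℝ) : Prop where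
  differentiable : ∀ j, 1 ≤ j → Differentiable ℝ (ψ j)
  bounds : ∃ C : ℝ, 0 < C ∧ ∀ j : ℕ, 1 ≤ j → supNorm (ψ j) ≤ ENNReal.ofReal C ∧
    supNorm (deriv (ψ j)) ≤ ENNReal.ofReal (C * (j : ℝ) ^ αψ)
  eigenvalues : ∃ c C : ℝ, 0 < c ∧ ∀ J : ℕ, 1 ≤ J → spectrum ℝ (gram ρ θ₀ ψ J) ⊆ Set.Icc c C

/-- The plug-in estimator `θc k` of `θ₀` uses the first `k` batches only and satisfies
`‖θc k - θ₀‖ = O(k^{-α_θ})` almost surely, up to a power of `log k`. -/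
structure PlugIn {Ω : Type*} [MeasurableSpace Ω] (μ : Measure Ω) {p B : ℕ}
    (obs : ℕ → Fin B → Ω → Obs p) (θ₀ : EuclideanSpace ℝ (Fin p))
    (θc : ℕ → Ω → EuclideanSpace ℝ (Fin p)) (αθ : ℝ) : Prop where
  adapted : ∀ k, Measurable[history obs k] (θc k)
  rate : ∃ r : ℝ, ∀ᵐ ω ∂μ, (fun k : ℕ => ‖θc k ω - θ₀‖) =O[atTop]
    fun k : ℕ => (k : ℝ) ^ (-αθ) * Real.log k ^ r

end OnlineSieve

end

/-! The quantity to follow is the risk R(a) = E(a'Ψ_J(z₀) - F₀(z₀))², not the coefficient error.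
Padding by zeros does not change the sieve function, so R is unaffected by the growth of the
dimension (`indexRisk_pad`), while the target coefficient b = B_{J,0} moves with J. Since b solves
the normal equations and Γ_J ≥ c, Pythagoras gives c‖a - b‖² ≤ R(a). It therefore suffices that R =
O(k^{-γ}) almost surely along the iterates, with γ = α_η - α_J.

Let D be the change of R caused by one observation, d = a - b and u = k^{-γ}. The leading part of
the mean of D is -2η‖Γd‖². The squared sieve bias, the squared plug-in error, the squared effect of
truncating the noise and the update variance η‖Ψ_J‖² ~ ηJ are all O(u). The plug-in error also
perturbs the drift by a relative amount J^{α_ψ+1/2}‖θ̌ - θ₀‖, which tends to 0. With the noise cut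
at k^τ and λ = k^{-ι} this yields E D ≤ -c₁ηR + C₁ηu, |D| ≤ C₁λ(R + u) and E D² ≤ C₁ηλ²(R + u)²
(`exists_riskStep_bounds`).

Put T = (R - Ku)₊ with K large. A second-order expansion of T^m, m even, gives a conditional
recursion E T_{k+1}^m ≤ (1 - cη)T_k^m + Cη(λu)^m (`exists_excess_contraction`), whence E T_k^m =
O(k^{-(γ+ι)m}) (`eventually_recursion_bound`). By Markov's inequality P(T_k ≥ k^{-γ}) = O(k^{-ιm});
choosing ιm > 1, Borel–Cantelli finishes. Arbitrarily high moments of the truncated recursion, each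
gaining the small factor λ, take the place of an exponential inequality, and the rate is obtained
even without the logarithm.

Three reductions make this rigorous. Truncation is eventually invisible, since τκ > 1
(`IsSample.eventually_noise_le`). A batch update is the average of B single-observation updates from
the same vector, so convexity of T^m in a and Jensen reduce it to one observation. Almost sure rates
become deterministic bounds by integrating only over decreasing events that belong to the history
(`setLIntegral_excess_succ_le`). -/

namespace OnlineSieve

/-! ### Bounded integrands, Cauchy–Schwarz, and the data of one round -/

/-- Bounded measurable real functions. -/
def BddMeas {W : Type*} [MeasurableSpace W] (g : W → ℝ) : Prop :=
  Measurable g ∧ ∃ C : ℝ, ∀ w, |g w| ≤ C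

namespace BddMeas

variable {W : Type*} [MeasurableSpace W] {g h : W → ℝ}

theorem const (r : ℝ) : BddMeas (fun _ : W => r) := ⟨measurable_const, |r|, fun _ => le_rfl⟩

theorem add (hg : BddMeas g) (hh : BddMeas h) : BddMeas (fun w => g w + h w) := by
  obtain ⟨mg, A, hA⟩ := hg
  obtain ⟨mh, A', hA'⟩ := hh
  exact ⟨mg.add mh, A + A', fun w => (abs_add_le _ _).trans (add_le_add (hA w) (hA' w))⟩

theorem mul (hg : BddMeas g) (hh : BddMeas h) : BddMeas (fun w => g w * h w) := by
  obtain ⟨mg, A, hA⟩ := hg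
  obtain ⟨mh, A', hA'⟩ := hh
  refine ⟨mg.mul mh, A * A', fun w => ?_⟩
  rw [abs_mul]
  exact mul_le_mul (hA w) (hA' w) (abs_nonneg _) ((abs_nonneg _).trans (hA w))

theorem const_mul (r : ℝ) (hg : BddMeas g) : BddMeas (fun w => r * g w) := (const r).mul hg

theorem neg (hg : BddMeas g) : BddMeas (fun w => - g w) := by
  simpa using hg.const_mul (-1)

theorem sub (hg : BddMeas g) (hh : BddMeas h) : BddMeas (fun w => g w - h w) := by
  simpa [sub_eq_add_neg] using hg.add hh.neg

theorem pow (hg : BddMeas g) (n : ℕ) : BddMeas (fun w => g w ^ n) := by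
  obtain ⟨mg, A, hA⟩ := hg
  refine ⟨mg.pow_const n, A ^ n, fun w => ?_⟩
  rw [abs_pow]
  exact pow_le_pow_left₀ (abs_nonneg _) (hA w) n

theorem integrable (hg : BddMeas g) {ρ : Measure W} [IsFiniteMeasure ρ] : Integrable g ρ := by
  obtain ⟨mg, A, hA⟩ := hg
  exact Integrable.of_bound mg.aestronglyMeasurable A (ae_of_all _ hA)

theorem inner_const {E : Type*} [NormedAddCommGroup E] [InnerProductSpace ℝ E] [MeasurableSpace E]
    [BorelSpace E] [SecondCountableTopology E] {P : W → E} (hP : Measurable P) {L : ℝ}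
    (hL : ∀ w, ‖P w‖ ≤ L) (v : E) : BddMeas (fun w => inner ℝ v (P w)) :=
  ⟨measurable_const.inner hP, ‖v‖ * L, fun w => (abs_real_inner_le_norm _ _).trans
    (mul_le_mul_of_nonneg_left (hL w) (norm_nonneg _))⟩

end BddMeas

/-- The quadratic t ↦ ∫ (t y + x)² is nonnegative, so its discriminant is not positive. -/
theorem sq_integral_mul_le {W : Type*} [MeasurableSpace W] {ρ : Measure W} [IsFiniteMeasure ρ]
    {x y : W → ℝ} (hx : BddMeas x) (hy : BddMeas y) :
    (∫ w, x w * y w ∂ρ) ^ 2 ≤ (∫ w, x w ^ 2 ∂ρ) * ∫ w, y w ^ 2 ∂ρ := by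
  have key : ∀ t : ℝ, 0 ≤ (∫ w, y w ^ 2 ∂ρ) * (t * t) + (2 * ∫ w, x w * y w ∂ρ) * t
      + ∫ w, x w ^ 2 ∂ρ := by
    intro t
    have h0 : 0 ≤ ∫ w, (t * y w + x w) ^ 2 ∂ρ := integral_nonneg fun w => sq_nonneg _
    have h1 : ∫ w, (t * y w + x w) ^ 2 ∂ρ
        = ∫ w, ((t * t) * y w ^ 2 + (2 * t) * (x w * y w)) + x w ^ 2 ∂ρ := by
      congr 1; ext w; ring
    rw [h1, integral_add (((hy.pow 2).const_mul _).add ((hx.mul hy).const_mul _)).integrable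
      (hx.pow 2).integrable, integral_add ((hy.pow 2).const_mul _).integrable
      ((hx.mul hy).const_mul _).integrable, integral_const_mul, integral_const_mul] at h0
    linarith
  have := discrim_le_zero key
  unfold discrim at this
  nlinarith

theorem abs_integral_mul_le {W : Type*} [MeasurableSpace W] {ρ : Measure W} [IsFiniteMeasure ρ]
    {x y : W → ℝ} (hx : BddMeas x) (hy : BddMeas y) {X Y : ℝ} (hX : 0 ≤ X) (hY : 0 ≤ Y)
    (hxX : ∫ w, x w ^ 2 ∂ρ ≤ X ^ 2) (hyY : ∫ w, y w ^ 2 ∂ρ ≤ Y ^ 2) :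
    |∫ w, x w * y w ∂ρ| ≤ X * Y := by
  apply abs_le_of_sq_le_sq _ (mul_nonneg hX hY)
  refine (sq_integral_mul_le hx hy).trans ?_
  rw [mul_pow]
  exact mul_le_mul hxX hyY (integral_nonneg fun w => sq_nonneg _) (sq_nonneg _)

/-- The squared `L²` distance between the sieve function with coefficients `a` and `f`. -/
noncomputable def sieveRisk {W E : Type*} [MeasurableSpace W] [NormedAddCommGroup E]
    [InnerProductSpace ℝ E] (ρ : Measure W) (P : W → E) (f : W → ℝ) (a : E) : ℝ :=
  ∫ w, (inner ℝ a (P w) - f w) ^ 2 ∂ρ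

/-- The quantitative facts about one round which control the update of the risk: `P` and `Q` are the
sieve vectors at the true and at the plug-in index, `f` is the regression function, `e` the
truncated noise and `b` the coefficient vector of the projection. -/
structure RoundBounds {W : Type*} [MeasurableSpace W] {J : ℕ} (ρ : Measure W)
    (P Q : W → EuclideanSpace ℝ (Fin J)) (f e : W → ℝ) (b : EuclideanSpace ℝ (Fin J))
    (c C ϑ η u lam L Λ : ℝ) : Prop where
  measP : Measurable P
  measQ : Measurable Q
  measf : Measurable f
  mease : Measurable e
  normP : ∀ w, ‖P w‖ ≤ L
  normQ : ∀ w, ‖Q w‖ ≤ L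
  f_le : ∀ w, |f w| ≤ C
  bQ_le : ∀ w, |inner ℝ b (Q w)| ≤ C
  e_le : ∀ w, |e w| ≤ Λ
  gram_lower : ∀ v, c * ‖v‖ ^ 2 ≤ ∫ w, (inner ℝ v (P w)) ^ 2 ∂ρ
  gram_upper : ∀ v, ∫ w, (inner ℝ v (P w)) ^ 2 ∂ρ ≤ C * ‖v‖ ^ 2
  shift : ∀ v, ∫ w, (inner ℝ v (Q w - P w)) ^ 2 ∂ρ ≤ ϑ ^ 2 * ‖v‖ ^ 2
  orth : ∀ v, ∫ w, inner ℝ v (P w) * (inner ℝ b (P w) - f w) ∂ρ = 0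
  bias : ∫ w, (inner ℝ b (P w) - f w) ^ 2 ∂ρ ≤ C * u
  shift_b : ∫ w, (inner ℝ b (Q w - P w)) ^ 2 ∂ρ ≤ C * u
  e_four : ∫ w, e w ^ 4 ∂ρ ≤ C
  e_orth : ∀ v, |∫ w, e w * inner ℝ v (Q w) ∂ρ| ≤ √(C * u) * ‖v‖
  c_pos : 0 < c
  one_le_C : 1 ≤ C
  ϑ_nonneg : 0 ≤ ϑ
  η_pos : 0 < η
  u_pos : 0 < u
  lam_pos : 0 < lam
  lam_le : lam ≤ 1
  one_le_L : 1 ≤ L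
  one_le_Λ : 1 ≤ Λ
  ηL_le : η * L ^ 2 ≤ C * u
  ηΛ_le : η * Λ ^ 2 ≤ lam ^ 2
  u_le : u ≤ lam ^ 2
  one_le_Llam : 1 ≤ L * lam ^ 2

/-- Taylor's formula of second order with an explicit remainder, by induction: multiplying the
remainder by T + D creates only the new term (n + 2) T^(n+1) D², and (n+2)² + (n+2) ≤ (n+3)². -/
theorem abs_add_pow_sub_le (T D : ℝ) (hT : 0 ≤ T) (n : ℕ) :
    |(T + D) ^ (n + 2) - T ^ (n + 2) - (n + 2) * T ^ (n + 1) * D|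
      ≤ (n + 2) ^ 2 * (D ^ 2 * (T + |D|) ^ n) := by
  induction n with
  | zero =>
    have : (T + D) ^ (0 + 2) - T ^ (0 + 2) - ((0 : ℕ) + 2) * T ^ (0 + 1) * D = D ^ 2 := by
      push_cast; ring
    rw [this, abs_of_nonneg (sq_nonneg D)]
    push_cast
    nlinarith [sq_nonneg D]
  | succ n ih =>
    have e : (T + D) ^ (n + 1 + 2) - T ^ (n + 1 + 2) - ((n + 1 : ℕ) + 2) * T ^ (n + 1 + 1) * D
        = (T + D) * ((T + D) ^ (n + 2) - T ^ (n + 2) - (n + 2) * T ^ (n + 1) * D)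
          + (n + 2) * (T ^ (n + 1) * D ^ 2) := by
      push_cast; ring
    rw [e]
    have hD := abs_nonneg D
    have h1 : |T + D| ≤ T + |D| := (abs_add_le _ _).trans (by rw [abs_of_nonneg hT])
    have h2 : T ^ (n + 1) ≤ (T + |D|) ^ (n + 1) := pow_le_pow_left₀ hT (by linarith) _
    have h3 : 0 ≤ D ^ 2 * (T + |D|) ^ (n + 1) := by positivity
    calc _ ≤ |T + D| * |(T + D) ^ (n + 2) - T ^ (n + 2) - (n + 2) * T ^ (n + 1) * D|
          + (n + 2) * (T ^ (n + 1) * D ^ 2) := by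
            refine (abs_add_le _ _).trans ?_
            rw [abs_mul, abs_of_nonneg (show (0:ℝ) ≤ (n + 2) * (T ^ (n + 1) * D ^ 2) by positivity)]
      _ ≤ (T + |D|) * ((n + 2) ^ 2 * (D ^ 2 * (T + |D|) ^ n))
          + (n + 2) * ((T + |D|) ^ (n + 1) * D ^ 2) := by gcongr
      _ = ((n + 2) ^ 2 + (n + 2)) * (D ^ 2 * (T + |D|) ^ (n + 1)) := by ring
      _ ≤ _ := by
        apply mul_le_mul_of_nonneg_right _ h3
        push_cast
        nlinarith

end OnlineSieve

/-! ### The risk as a quadratic function of the coefficients -/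

namespace OnlineSieve

theorem measurable_sieveRisk {W : Type*} [MeasurableSpace W] {J : ℕ} (ρ : Measure W)
    [IsProbabilityMeasure ρ] {P : W → EuclideanSpace ℝ (Fin J)} {f : W → ℝ} (hP : Measurable P)
    (hf : Measurable f) : Measurable (sieveRisk ρ P f) := by
  have h : StronglyMeasurable (fun q : EuclideanSpace ℝ (Fin J) × W =>
      (inner ℝ q.1 (P q.2) - f q.2) ^ 2) := by
    apply Measurable.stronglyMeasurable
    exact ((measurable_fst.inner (hP.comp measurable_snd)).sub (hf.comp measurable_snd)).pow_const 2
  exact h.integral_prod_right.measurable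

theorem sieveRisk_nonneg {W E : Type*} [MeasurableSpace W] [NormedAddCommGroup E]
    [InnerProductSpace ℝ E] (ρ : Measure W) (P : W → E) (f : W → ℝ) (a : E) :
    0 ≤ sieveRisk ρ P f a := integral_nonneg fun _ => sq_nonneg _

namespace RoundBounds

variable {W : Type*} [MeasurableSpace W] {J : ℕ} {ρ : Measure W}
    {P Q : W → EuclideanSpace ℝ (Fin J)} {f e : W → ℝ} {b : EuclideanSpace ℝ (Fin J)}
    {c C ϑ η u lam L Λ : ℝ}

theorem bddP (h : RoundBounds ρ P Q f e b c C ϑ η u lam L Λ) (v : EuclideanSpace ℝ (Fin J)) :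
    BddMeas (fun w => inner ℝ v (P w)) := BddMeas.inner_const h.measP h.normP v

theorem bddQ (h : RoundBounds ρ P Q f e b c C ϑ η u lam L Λ) (v : EuclideanSpace ℝ (Fin J)) :
    BddMeas (fun w => inner ℝ v (Q w)) := BddMeas.inner_const h.measQ h.normQ v

theorem bddf (h : RoundBounds ρ P Q f e b c C ϑ η u lam L Λ) : BddMeas f := ⟨h.measf, C, h.f_le⟩

theorem bdde (h : RoundBounds ρ P Q f e b c C ϑ η u lam L Λ) : BddMeas e := ⟨h.mease, Λ, h.e_le⟩

theorem bddQP (h : RoundBounds ρ P Q f e b c C ϑ η u lam L Λ) (v : EuclideanSpace ℝ (Fin J)) :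
    BddMeas (fun w => inner ℝ v (Q w - P w)) := by
  simpa only [inner_sub_right] using (h.bddQ v).sub (h.bddP v)

theorem lam_sq_le (h : RoundBounds ρ P Q f e b c C ϑ η u lam L Λ) : lam ^ 2 ≤ lam := by
  nlinarith [h.lam_pos, h.lam_le]

theorem η_le (h : RoundBounds ρ P Q f e b c C ϑ η u lam L Λ) : η ≤ lam ^ 2 := by
  have h1 : 1 ≤ Λ ^ 2 := one_le_pow₀ h.one_le_Λ
  nlinarith [h.ηΛ_le, h.η_pos]

theorem u_le_one (h : RoundBounds ρ P Q f e b c C ϑ η u lam L Λ) : u ≤ 1 :=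
  h.u_le.trans (h.lam_sq_le.trans h.lam_le)

variable [IsProbabilityMeasure ρ]

theorem integral_sq_Q (h : RoundBounds ρ P Q f e b c C ϑ η u lam L Λ) (hϑ : ϑ ≤ 1)
    (v : EuclideanSpace ℝ (Fin J)) :
    ∫ w, (inner ℝ v (Q w)) ^ 2 ∂ρ ≤ (2 * C * ‖v‖) ^ 2 := by
  have h1 : ∫ w, (inner ℝ v (Q w)) ^ 2 ∂ρ
      ≤ ∫ w, 2 * (inner ℝ v (P w)) ^ 2 + 2 * (inner ℝ v (Q w - P w)) ^ 2 ∂ρ := by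
    refine integral_mono ((h.bddQ v).pow 2).integrable
      ((((h.bddP v).pow 2).const_mul _).add (((h.bddQP v).pow 2).const_mul _)).integrable
      fun w => ?_
    simp only [inner_sub_right]
    nlinarith [sq_nonneg (2 * inner ℝ v (P w) - inner ℝ v (Q w))]
  rw [integral_add (((h.bddP v).pow 2).const_mul _).integrable
    (((h.bddQP v).pow 2).const_mul _).integrable, integral_const_mul, integral_const_mul] at h1
  have h2 := h.gram_upper v
  have h3 := h.shift v
  have h4 : ϑ ^ 2 ≤ 1 := by nlinarith [h.ϑ_nonneg]
  have h5 := h.one_le_C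
  have h6 : ϑ ^ 2 * ‖v‖ ^ 2 ≤ 1 * ‖v‖ ^ 2 := by gcongr
  have h7 : C * ‖v‖ ^ 2 ≤ C ^ 2 * ‖v‖ ^ 2 := by gcongr; nlinarith
  have h8 : 1 * ‖v‖ ^ 2 ≤ C ^ 2 * ‖v‖ ^ 2 := by gcongr; nlinarith
  nlinarith

/-- The image of `d` under the Gram operator. -/
theorem exists_gram_image (h : RoundBounds ρ P Q f e b c C ϑ η u lam L Λ)
    (d : EuclideanSpace ℝ (Fin J)) : ∃ v : EuclideanSpace ℝ (Fin J),
      (∀ x, inner ℝ v x = ∫ w, inner ℝ d (P w) * inner ℝ x (P w) ∂ρ) ∧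
      ‖v‖ ≤ C * ‖d‖ ∧ c * ‖d‖ ≤ ‖v‖ := by
  have hint : Integrable (fun w => (inner ℝ d (P w)) • P w) ρ := by
    refine Integrable.of_bound
      ((h.bddP d).1.smul h.measP).aestronglyMeasurable (‖d‖ * L * L) (ae_of_all _ fun w => ?_)
    rw [norm_smul]
    have := h.normP w
    have h2 : ‖(inner ℝ d (P w) : ℝ)‖ ≤ ‖d‖ * L := (abs_real_inner_le_norm _ _).trans
      (mul_le_mul_of_nonneg_left this (norm_nonneg _))
    exact mul_le_mul h2 this (norm_nonneg _) ((norm_nonneg _).trans h2)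
  have hv : ∀ x, inner ℝ (∫ w, (inner ℝ d (P w)) • P w ∂ρ) x
      = ∫ w, inner ℝ d (P w) * inner ℝ x (P w) ∂ρ := by
    intro x
    rw [real_inner_comm, ← integral_inner hint]
    simp only [inner_smul_right]
  refine ⟨_, hv, ?_, ?_⟩
  · set v := ∫ w, (inner ℝ d (P w)) • P w ∂ρ
    have hC := h.one_le_C
    have up : ∀ x : EuclideanSpace ℝ (Fin J), ∫ w, (inner ℝ x (P w)) ^ 2 ∂ρ ≤ (√C * ‖x‖) ^ 2 := by
      intro x
      rw [mul_pow, Real.sq_sqrt (by linarith)]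
      exact h.gram_upper x
    -- Cauchy–Schwarz for the Gram form at `d` and `v` reads ‖v‖² ≤ C‖d‖‖v‖. The lower bound below
    -- uses c‖d‖² ≤ ⟨v, d⟩ ≤ ‖v‖‖d‖.
    have h1 := abs_integral_mul_le (ρ := ρ) (h.bddP d) (h.bddP v) (by positivity) (by positivity)
      (up d) (up v)
    rw [← hv v, real_inner_self_eq_norm_sq, abs_of_nonneg (sq_nonneg _)] at h1
    have h2 : √C * ‖d‖ * (√C * ‖v‖) = C * ‖d‖ * ‖v‖ := by
      have := Real.mul_self_sqrt (show 0 ≤ C by linarith)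
      linear_combination (‖d‖ * ‖v‖) * this
    rw [h2, sq] at h1
    rcases (norm_nonneg v).eq_or_lt with h0 | h0
    · rw [← h0]; positivity
    · exact le_of_mul_le_mul_right h1 h0
  · set v := ∫ w, (inner ℝ d (P w)) • P w ∂ρ
    have h1 := h.gram_lower d
    have h2 : ∫ w, (inner ℝ d (P w)) ^ 2 ∂ρ = inner ℝ v d := by
      rw [hv d]; simp only [sq]
    have h3 := real_inner_le_norm v d
    rcases (norm_nonneg d).eq_or_lt with h0 | h0
    · rw [← h0]; simp
    · refine le_of_mul_le_mul_right ?_ h0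
      nlinarith

/-- Pythagoras: the normal equations `orth` remove the cross term. -/
theorem sieveRisk_eq (h : RoundBounds ρ P Q f e b c C ϑ η u lam L Λ)
    (a : EuclideanSpace ℝ (Fin J)) : sieveRisk ρ P f a
      = ∫ w, (inner ℝ (a - b) (P w)) ^ 2 ∂ρ + ∫ w, (inner ℝ b (P w) - f w) ^ 2 ∂ρ := by
  have hb := (h.bddP b).sub h.bddf
  have h1 : sieveRisk ρ P f a = ∫ w, ((inner ℝ (a - b) (P w)) ^ 2
      + 2 * (inner ℝ (a - b) (P w) * (inner ℝ b (P w) - f w)))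
      + (inner ℝ b (P w) - f w) ^ 2 ∂ρ := by
    unfold sieveRisk
    congr 1; ext w
    rw [inner_sub_left]; ring
  rw [h1, integral_add ((((h.bddP _).pow 2)).add (((h.bddP _).mul hb).const_mul _)).integrable
    (hb.pow 2).integrable, integral_add ((h.bddP _).pow 2).integrable
    (((h.bddP _).mul hb).const_mul _).integrable, integral_const_mul, h.orth]
  ring

theorem le_sieveRisk (h : RoundBounds ρ P Q f e b c C ϑ η u lam L Λ)
    (a : EuclideanSpace ℝ (Fin J)) : c * ‖a - b‖ ^ 2 ≤ sieveRisk ρ P f a := by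
  rw [h.sieveRisk_eq]
  have h1 := h.gram_lower (a - b)
  have h2 : 0 ≤ ∫ w, (inner ℝ b (P w) - f w) ^ 2 ∂ρ := integral_nonneg fun _ => sq_nonneg _
  linarith

theorem sieveRisk_le (h : RoundBounds ρ P Q f e b c C ϑ η u lam L Λ)
    (a : EuclideanSpace ℝ (Fin J)) : sieveRisk ρ P f a ≤ C * ‖a - b‖ ^ 2 + C * u := by
  rw [h.sieveRisk_eq]
  exact add_le_add (h.gram_upper _) h.bias

/-- The bias part of the risk cancels, which leaves the exact second-order expansion; its gradient
is twice the Gram image `v` of a - b. -/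
theorem sieveRisk_add (h : RoundBounds ρ P Q f e b c C ϑ η u lam L Λ)
    (a v x : EuclideanSpace ℝ (Fin J))
    (hv : ∀ x, inner ℝ v x = ∫ w, inner ℝ (a - b) (P w) * inner ℝ x (P w) ∂ρ) :
    sieveRisk ρ P f (a + x) - sieveRisk ρ P f a
      = 2 * inner ℝ v x + ∫ w, (inner ℝ x (P w)) ^ 2 ∂ρ := by
  have e1 : sieveRisk ρ P f (a + x)
      = ∫ w, (inner ℝ (a - b) (P w) ^ 2 + 2 * (inner ℝ (a - b) (P w) * inner ℝ x (P w)))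
        + inner ℝ x (P w) ^ 2 ∂ρ + ∫ w, (inner ℝ b (P w) - f w) ^ 2 ∂ρ := by
    rw [h.sieveRisk_eq]
    congr 2; ext w
    rw [add_sub_right_comm, inner_add_left]; ring
  rw [e1, h.sieveRisk_eq, integral_add
    ((((h.bddP _).pow 2)).add (((h.bddP _).mul (h.bddP _)).const_mul _)).integrable
    ((h.bddP _).pow 2).integrable, integral_add ((h.bddP _).pow 2).integrable
    (((h.bddP _).mul (h.bddP _)).const_mul _).integrable, integral_const_mul, hv]
  ring

end RoundBounds

/-! ### The effect of one observation: exact formula and moments of the residual -/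

/-- The change of the risk caused by one observation. -/
noncomputable def riskStep {W E : Type*} [MeasurableSpace W] [NormedAddCommGroup E]
    [InnerProductSpace ℝ E] (ρ : Measure W) (P Q : W → E) (f e : W → ℝ) (η : ℝ) (a : E) (w : W) :
    ℝ :=
  sieveRisk ρ P f (a + (η * (e w + f w - inner ℝ a (Q w))) • Q w) - sieveRisk ρ P f a

namespace RoundBounds

variable {W : Type*} [MeasurableSpace W] {J : ℕ} {ρ : Measure W}
    {P Q : W → EuclideanSpace ℝ (Fin J)} {f e : W → ℝ} {b : EuclideanSpace ℝ (Fin J)}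
    {c C ϑ η u lam L Λ : ℝ}

theorem bdd_resid (h : RoundBounds ρ P Q f e b c C ϑ η u lam L Λ)
    (a : EuclideanSpace ℝ (Fin J)) : BddMeas (fun w => e w + f w - inner ℝ a (Q w)) :=
  (h.bdde.add h.bddf).sub (h.bddQ a)

theorem gramForm_Q_le (h : RoundBounds ρ P Q f e b c C ϑ η u lam L Λ) (w : W) :
    ∫ x, (inner ℝ (Q w) (P x)) ^ 2 ∂ρ ≤ C * L ^ 2 := by
  refine (h.gram_upper (Q w)).trans ?_
  have := h.one_le_C
  have := h.normQ w
  gcongr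

variable [IsProbabilityMeasure ρ]

theorem riskStep_eq (h : RoundBounds ρ P Q f e b c C ϑ η u lam L Λ)
    (a v : EuclideanSpace ℝ (Fin J))
    (hv : ∀ x, inner ℝ v x = ∫ w, inner ℝ (a - b) (P w) * inner ℝ x (P w) ∂ρ) (w : W) :
    riskStep ρ P Q f e η a w
      = 2 * η * ((e w + f w - inner ℝ a (Q w)) * inner ℝ v (Q w))
        + η ^ 2 * ((e w + f w - inner ℝ a (Q w)) ^ 2 * ∫ x, (inner ℝ (Q w) (P x)) ^ 2 ∂ρ) := by
  unfold riskStep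
  rw [h.sieveRisk_add a v _ hv]
  simp only [inner_smul_right, inner_smul_left, mul_pow, integral_const_mul, conj_trivial]
  ring

theorem measurable_riskStep (h : RoundBounds ρ P Q f e b c C ϑ η u lam L Λ)
    (a : EuclideanSpace ℝ (Fin J)) : Measurable (riskStep ρ P Q f e η a) := by
  unfold riskStep
  refine ((measurable_sieveRisk ρ h.measP h.measf).comp ?_).sub measurable_const
  have := (h.bddQ a).1
  have h1 := h.measf
  have h2 := h.mease
  have h3 := h.measQ
  fun_prop

theorem bdd_gramForm_Q (h : RoundBounds ρ P Q f e b c C ϑ η u lam L Λ) :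
    BddMeas (fun w => ∫ x, (inner ℝ (Q w) (P x)) ^ 2 ∂ρ) := by
  refine ⟨?_, C * L ^ 2, fun w => ?_⟩
  · have := (measurable_sieveRisk ρ h.measP (f := fun _ => 0) measurable_const).comp h.measQ
    simpa [sieveRisk, Function.comp_def] using this
  · rw [abs_of_nonneg (integral_nonneg fun _ => sq_nonneg _)]
    exact h.gramForm_Q_le w

theorem integral_e_sq (h : RoundBounds ρ P Q f e b c C ϑ η u lam L Λ) :
    ∫ w, e w ^ 2 ∂ρ ≤ 2 * C ^ 2 := by
  have h1 : ∫ w, e w ^ 2 ∂ρ ≤ ∫ w, 1 + e w ^ 4 ∂ρ := by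
    refine integral_mono (h.bdde.pow 2).integrable
      ((BddMeas.const 1).add (h.bdde.pow 4)).integrable fun w => ?_
    nlinarith [sq_nonneg (e w ^ 2 - 1)]
  rw [integral_add (BddMeas.const 1).integrable (h.bdde.pow 4).integrable] at h1
  simp only [integral_const, probReal_univ, smul_eq_mul, mul_one] at h1
  nlinarith [h.e_four, h.one_le_C]

/-- The residual is e + (f - b'Q) - (a - b)'Q: noise, a term bounded by 2C, and a term controlled in
mean square by ‖a - b‖. -/
theorem integral_resid_sq (h : RoundBounds ρ P Q f e b c C ϑ η u lam L Λ) (hϑ : ϑ ≤ 1)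
    (a : EuclideanSpace ℝ (Fin J)) :
    ∫ w, (e w + f w - inner ℝ a (Q w)) ^ 2 ∂ρ ≤ 18 * C ^ 2 * (1 + ‖a - b‖ ^ 2) := by
  have hi := (h.bdde.pow 2).add (BddMeas.const (4 * C ^ 2))
  have hQ := (h.bddQ (a - b)).pow 2
  have h1 : ∫ w, (e w + f w - inner ℝ a (Q w)) ^ 2 ∂ρ
      ≤ ∫ w, 3 * ((e w ^ 2 + 4 * C ^ 2) + (inner ℝ (a - b) (Q w)) ^ 2) ∂ρ := by
    refine integral_mono ((h.bdd_resid a).pow 2).integrable ((hi.add hQ).const_mul 3).integrable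
      fun w => ?_
    have hf := abs_le.1 (h.f_le w)
    have hb := abs_le.1 (h.bQ_le w)
    simp only [inner_sub_left]
    generalize inner ℝ a (Q w) = x at *
    generalize inner ℝ b (Q w) = y at *
    have h4 : (f w - y) ^ 2 ≤ 4 * C ^ 2 := by nlinarith
    nlinarith [sq_nonneg (e w - (f w - y)), sq_nonneg (e w + (x - y)),
      sq_nonneg ((f w - y) + (x - y))]
  rw [integral_const_mul, integral_add hi.integrable hQ.integrable,
    integral_add (h.bdde.pow 2).integrable (BddMeas.const _).integrable] at h1
  simp only [integral_const, probReal_univ, smul_eq_mul, one_mul] at h1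
  have h2 := h.integral_sq_Q hϑ (a - b)
  have h3 := h.integral_e_sq
  nlinarith [sq_nonneg (C * ‖a - b‖)]

theorem integral_resid_pow_four (h : RoundBounds ρ P Q f e b c C ϑ η u lam L Λ) (hϑ : ϑ ≤ 1)
    (a : EuclideanSpace ℝ (Fin J)) :
    ∫ w, (e w + f w - inner ℝ a (Q w)) ^ 4 ∂ρ
      ≤ 459 * C ^ 4 * (1 + L ^ 2 * ‖a - b‖ ^ 4) := by
  have hi := (h.bdde.pow 4).add (BddMeas.const (16 * C ^ 4))
  have hQ := ((h.bddQ (a - b)).pow 2).const_mul (L ^ 2 * ‖a - b‖ ^ 2)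
  have h1 : ∫ w, (e w + f w - inner ℝ a (Q w)) ^ 4 ∂ρ
      ≤ ∫ w, 27 * ((e w ^ 4 + 16 * C ^ 4)
        + L ^ 2 * ‖a - b‖ ^ 2 * (inner ℝ (a - b) (Q w)) ^ 2) ∂ρ := by
    refine integral_mono ((h.bdd_resid a).pow 4).integrable ((hi.add hQ).const_mul 27).integrable
      fun w => ?_
    have hf := abs_le.1 (h.f_le w)
    have hb := abs_le.1 (h.bQ_le w)
    -- Of the four factors (a - b)'Q, two are bounded uniformly and two are kept for the mean
    -- square; this costs L² and not L⁴.
    have hn : (inner ℝ (a - b) (Q w)) ^ 2 ≤ L ^ 2 * ‖a - b‖ ^ 2 := by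
      rw [← sq_abs, ← mul_pow]
      refine pow_le_pow_left₀ (abs_nonneg _) ((abs_real_inner_le_norm _ _).trans ?_) 2
      rw [mul_comm]
      exact mul_le_mul_of_nonneg_right (h.normQ w) (norm_nonneg _)
    have hn' := mul_le_mul_of_nonneg_right hn (sq_nonneg (inner ℝ (a - b) (Q w)))
    refine le_trans ?_ (mul_le_mul_of_nonneg_left (add_le_add_right hn' _) (by norm_num))
    simp only [inner_sub_left]
    generalize inner ℝ a (Q w) = x at *
    generalize inner ℝ b (Q w) = y at *
    have h4 : (f w - y) ^ 2 ≤ 4 * C ^ 2 := by nlinarith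
    have h5 : (f w - y) ^ 4 ≤ 16 * C ^ 4 := by nlinarith [sq_nonneg (f w - y)]
    have h6 : (e w + f w - x) ^ 2 ≤ 3 * (e w ^ 2 + (f w - y) ^ 2 + (x - y) ^ 2) := by
      nlinarith [sq_nonneg (e w - (f w - y)), sq_nonneg (e w + (x - y)),
        sq_nonneg ((f w - y) + (x - y))]
    have h7 : (e w ^ 2 + (f w - y) ^ 2 + (x - y) ^ 2) ^ 2
        ≤ 3 * (e w ^ 4 + (f w - y) ^ 4 + (x - y) ^ 4) := by
      nlinarith [sq_nonneg (e w ^ 2 - (f w - y) ^ 2), sq_nonneg (e w ^ 2 - (x - y) ^ 2),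
        sq_nonneg ((f w - y) ^ 2 - (x - y) ^ 2)]
    have h8 := pow_le_pow_left₀ (sq_nonneg _) h6 2
    nlinarith
  rw [integral_const_mul, integral_add hi.integrable hQ.integrable,
    integral_add (h.bdde.pow 4).integrable (BddMeas.const _).integrable,
    integral_const_mul (L ^ 2 * ‖a - b‖ ^ 2)] at h1
  simp only [integral_const, probReal_univ, smul_eq_mul, one_mul] at h1
  have h2 := h.integral_sq_Q hϑ (a - b)
  have h3 := h.e_four
  have hC := h.one_le_C
  have h4 : C ≤ C ^ 4 := by simpa using pow_le_pow_right₀ hC (show 1 ≤ 4 by norm_num)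
  have h5 : C ^ 2 ≤ C ^ 4 := pow_le_pow_right₀ hC (show 2 ≤ 4 by norm_num)
  have h6 : L ^ 2 * ‖a - b‖ ^ 2 * ∫ w, (inner ℝ (a - b) (Q w)) ^ 2 ∂ρ
      ≤ 4 * C ^ 4 * (L ^ 2 * ‖a - b‖ ^ 4) := by
    calc _ ≤ L ^ 2 * ‖a - b‖ ^ 2 * (2 * C * ‖a - b‖) ^ 2 := by gcongr
      _ = 4 * C ^ 2 * (L ^ 2 * ‖a - b‖ ^ 4) := by ring
      _ ≤ _ := by gcongr
  have h7 : 0 ≤ C ^ 4 * (L ^ 2 * ‖a - b‖ ^ 4) := by positivity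
  nlinarith

end RoundBounds
end OnlineSieve

/-! ### Drift, size and second moment of the change of the risk -/

namespace OnlineSieve
namespace RoundBounds

variable {W : Type*} [MeasurableSpace W] {J : ℕ} {ρ : Measure W} [IsProbabilityMeasure ρ]
    {P Q : W → EuclideanSpace ℝ (Fin J)} {f e : W → ℝ} {b : EuclideanSpace ℝ (Fin J)}
    {c C ϑ η u lam L Λ : ℝ}

/-- The drift along the Gram image v of d = a - b is -‖v‖² ≤ -c²‖d‖², up to two kinds of error.
Those from noise, bias and shifted projection are of order √u‖d‖ and are split by Young's
inequality; those from evaluating d or v at the plug-in index are of order ϑ‖d‖² and are absorbed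
for small ϑ. -/
theorem integral_resid_mul_le (h : RoundBounds ρ P Q f e b c C ϑ η u lam L Λ)
    (hϑ : ϑ ≤ 1) (hϑc : 12 * (ϑ * C ^ 2) ≤ c ^ 2) (a v : EuclideanSpace ℝ (Fin J))
    (hv : ∀ x, inner ℝ v x = ∫ w, inner ℝ (a - b) (P w) * inner ℝ x (P w) ∂ρ)
    (hv1 : ‖v‖ ≤ C * ‖a - b‖) (hv2 : c * ‖a - b‖ ≤ ‖v‖) :
    ∫ w, (e w + f w - inner ℝ a (Q w)) * inner ℝ v (Q w) ∂ρ
      ≤ -(c ^ 2 / 2) * ‖a - b‖ ^ 2 + 25 * C ^ 5 / c ^ 2 * u := by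
  have hC := h.one_le_C
  have hc := h.c_pos
  have hϑ0 := h.ϑ_nonneg
  have hu := h.u_pos
  set m := ‖a - b‖ with hm
  have hm0 : 0 ≤ m := norm_nonneg _
  set s := √(C * u) with hs
  have hs0 : 0 ≤ s := Real.sqrt_nonneg _
  have hs2 : s ^ 2 = C * u := Real.sq_sqrt (by positivity)
  have hvm : 2 * C * ‖v‖ ≤ 2 * C ^ 2 * m := by nlinarith
  have tQ : ∫ w, (inner ℝ v (Q w)) ^ 2 ∂ρ ≤ (2 * C ^ 2 * m) ^ 2 :=
    (h.integral_sq_Q hϑ v).trans (pow_le_pow_left₀ (by positivity) hvm 2)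
  have bfb : BddMeas (fun w => inner ℝ b (P w) - f w) := (h.bddP b).sub h.bddf
  have i1 : |∫ w, e w * inner ℝ v (Q w) ∂ρ| ≤ s * (C * m) :=
    (h.e_orth v).trans (mul_le_mul_of_nonneg_left hv1 hs0)
  have i2 : |∫ w, (inner ℝ b (P w) - f w) * inner ℝ v (Q w) ∂ρ| ≤ s * (2 * C ^ 2 * m) :=
    abs_integral_mul_le bfb (h.bddQ v) hs0 (by positivity) (by rw [hs2]; exact h.bias) tQ
  have i3 : |∫ w, inner ℝ b (Q w - P w) * inner ℝ v (Q w) ∂ρ| ≤ s * (2 * C ^ 2 * m) :=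
    abs_integral_mul_le (h.bddQP b) (h.bddQ v) hs0 (by positivity) (by rw [hs2]; exact h.shift_b) tQ
  have i4 : |∫ w, inner ℝ (a - b) (Q w - P w) * inner ℝ v (Q w) ∂ρ| ≤ ϑ * m * (2 * C ^ 2 * m) :=
    abs_integral_mul_le (h.bddQP _) (h.bddQ v) (by positivity) (by positivity)
      (by rw [mul_pow]; exact h.shift _) tQ
  have i5 : |∫ w, inner ℝ (a - b) (P w) * inner ℝ v (Q w - P w) ∂ρ| ≤ C * m * (ϑ * ‖v‖) := by
    refine abs_integral_mul_le (h.bddP _) (h.bddQP v) (by positivity) (by positivity) ?_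
      (by rw [mul_pow]; exact h.shift _)
    refine (h.gram_upper _).trans ?_
    rw [mul_pow]
    gcongr
    nlinarith
  have i6 : ∫ w, inner ℝ (a - b) (P w) * inner ℝ v (P w) ∂ρ = ‖v‖ ^ 2 := by
    rw [← hv v, real_inner_self_eq_norm_sq]
  -- The residual equals e - (b'P - f) - b'(Q - P) - (a - b)'(Q - P) - (a - b)'P; in the product of
  -- the last term with v'Q, also v'Q is split around v'P, leaving ‖v‖² as the main term.
  have e1 : ∫ w, (e w + f w - inner ℝ a (Q w)) * inner ℝ v (Q w) ∂ρ
      = ∫ w, (((e w * inner ℝ v (Q w) - (inner ℝ b (P w) - f w) * inner ℝ v (Q w))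
        - inner ℝ b (Q w - P w) * inner ℝ v (Q w))
        - inner ℝ (a - b) (Q w - P w) * inner ℝ v (Q w))
        - inner ℝ (a - b) (P w) * inner ℝ v (Q w - P w)
        - inner ℝ (a - b) (P w) * inner ℝ v (P w) ∂ρ := by
    congr 1; ext w
    simp only [inner_sub_left, inner_sub_right]; ring
  have b1 := h.bdde.mul (h.bddQ v)
  have b2 := bfb.mul (h.bddQ v)
  have b3 := (h.bddQP b).mul (h.bddQ v)
  have b4 := (h.bddQP (a - b)).mul (h.bddQ v)
  have b5 := (h.bddP (a - b)).mul (h.bddQP v)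
  have b6 := (h.bddP (a - b)).mul (h.bddP v)
  rw [e1, integral_sub ((((b1.sub b2).sub b3).sub b4).sub b5).integrable b6.integrable,
    integral_sub (((b1.sub b2).sub b3).sub b4).integrable b5.integrable,
    integral_sub ((b1.sub b2).sub b3).integrable b4.integrable,
    integral_sub (b1.sub b2).integrable b3.integrable,
    integral_sub b1.integrable b2.integrable, i6]
  have hv3 : c ^ 2 * m ^ 2 ≤ ‖v‖ ^ 2 := by
    rw [← mul_pow]; exact pow_le_pow_left₀ (by positivity) hv2 2
  have i5' : C * m * (ϑ * ‖v‖) ≤ ϑ * C ^ 2 * m ^ 2 := by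
    calc _ ≤ C * m * (ϑ * (C * m)) := by gcongr
      _ = _ := by ring
  -- Young's inequality spends one quarter of c²m²; the factor 5 is 1 + 2 + 2 from `i1`, `i2`, `i3`.
  -- The plug-in terms `i4`, `i5` spend another quarter in `hth`.
  have hy : 5 * C ^ 2 * s * m ≤ c ^ 2 / 4 * m ^ 2 + 25 * C ^ 5 / c ^ 2 * u := by
    have h1 : 25 * C ^ 5 / c ^ 2 * u = 25 * C ^ 4 * s ^ 2 / c ^ 2 := by rw [hs2]; ring
    have h2 : c ^ 2 / 4 * m ^ 2 + 25 * C ^ 4 * s ^ 2 / c ^ 2 - 5 * C ^ 2 * s * m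
        = (c * m / 2 - 5 * C ^ 2 * s / c) ^ 2 := by field_simp; ring
    rw [h1]
    nlinarith [sq_nonneg (c * m / 2 - 5 * C ^ 2 * s / c)]
  have hsC : s * (C * m) ≤ C ^ 2 * s * m := by
    have : 0 ≤ s * m := by positivity
    nlinarith [mul_le_mul_of_nonneg_right (show C ≤ C ^ 2 by nlinarith) this]
  have hth : 3 * (ϑ * C ^ 2) * m ^ 2 ≤ c ^ 2 / 4 * m ^ 2 := by
    apply mul_le_mul_of_nonneg_right _ (sq_nonneg m); linarith
  rw [abs_le] at i1 i2 i3 i4 i5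
  linarith [i1.2, i2.1, i3.1, i4.1, i5.1]

theorem integral_riskStep_le (h : RoundBounds ρ P Q f e b c C ϑ η u lam L Λ)
    (hϑ : ϑ ≤ 1) (hϑc : 12 * (ϑ * C ^ 2) ≤ c ^ 2) (hlam : 36 * C ^ 4 * lam ≤ c ^ 2)
    (a : EuclideanSpace ℝ (Fin J)) :
    ∫ w, riskStep ρ P Q f e η a w ∂ρ
      ≤ η * (-(c ^ 2 / 2) * ‖a - b‖ ^ 2 + (50 * C ^ 5 / c ^ 2 + 18 * C ^ 4) * u) := by
  obtain ⟨v, hv, hv1, hv2⟩ := h.exists_gram_image (a - b)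
  have hC := h.one_le_C
  have hη := h.η_pos
  have hR := h.bdd_resid a
  have hG := h.bdd_gramForm_Q
  have h1 := h.integral_resid_mul_le hϑ hϑc a v hv hv1 hv2
  have h2 : ∫ w, (e w + f w - inner ℝ a (Q w)) ^ 2 * ∫ x, (inner ℝ (Q w) (P x)) ^ 2 ∂ρ ∂ρ
      ≤ (C * L ^ 2) * (18 * C ^ 2 * (1 + ‖a - b‖ ^ 2)) := by
    calc _ ≤ ∫ w, (C * L ^ 2) * (e w + f w - inner ℝ a (Q w)) ^ 2 ∂ρ := by
          refine integral_mono ((hR.pow 2).mul hG).integrable ((hR.pow 2).const_mul _).integrable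
            fun w => ?_
          simp only
          rw [mul_comm]
          exact mul_le_mul_of_nonneg_right (h.gramForm_Q_le w) (sq_nonneg _)
      _ ≤ _ := by
        rw [integral_const_mul]
        exact mul_le_mul_of_nonneg_left (h.integral_resid_sq hϑ a) (by positivity)
  simp only [h.riskStep_eq a v hv]
  rw [integral_add ((hR.mul (h.bddQ v)).const_mul _).integrable
    (((hR.pow 2).mul hG).const_mul _).integrable, integral_const_mul, integral_const_mul]
  set m := ‖a - b‖
  -- The second-order term carries η²L², and ηL² ≤ Cu with u ≤ lam; so it adds ηu to the forcing and
  -- a small multiple of ηm² that the drift absorbs.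
  have h3 : η * L ^ 2 * (1 + m ^ 2) ≤ C * u + C * lam * m ^ 2 := by
    have := h.ηL_le
    have h5 : u ≤ lam := h.u_le.trans h.lam_sq_le
    calc _ ≤ C * u * (1 + m ^ 2) := by gcongr
      _ = C * u + C * u * m ^ 2 := by ring
      _ ≤ _ := by gcongr
  have h4 : η ^ 2 * ((C * L ^ 2) * (18 * C ^ 2 * (1 + m ^ 2)))
      ≤ η * (18 * C ^ 4 * u + c ^ 2 / 2 * m ^ 2) := by
    calc _ = η * (18 * C ^ 3 * (η * L ^ 2 * (1 + m ^ 2))) := by ring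
      _ ≤ η * (18 * C ^ 3 * (C * u + C * lam * m ^ 2)) := by gcongr
      _ = η * (18 * C ^ 4 * u + 18 * C ^ 4 * lam * m ^ 2) := by ring
      _ ≤ _ := by
        gcongr
        linarith
  have h6 := mul_le_mul_of_nonneg_left h2 (sq_nonneg η)
  have h7 := mul_le_mul_of_nonneg_left h1 (show 0 ≤ 2 * η by positivity)
  have e : 50 * C ^ 5 / c ^ 2 = 2 * (25 * C ^ 5 / c ^ 2) := by ring
  rw [e]
  linarith

theorem abs_riskStep_le (h : RoundBounds ρ P Q f e b c C ϑ η u lam L Λ)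
    (a : EuclideanSpace ℝ (Fin J)) (w : W) :
    |riskStep ρ P Q f e η a w| ≤ 40 * C ^ 6 * (lam * (‖a - b‖ ^ 2 + u)) := by
  obtain ⟨v, hv, hv1, -⟩ := h.exists_gram_image (a - b)
  have hC := h.one_le_C
  have hη := h.η_pos
  have hu := h.u_pos
  have hL := h.one_le_L
  have hΛ := h.one_le_Λ
  have hlam := h.lam_pos
  have hul : u ≤ lam := h.u_le.trans h.lam_sq_le
  rw [h.riskStep_eq a v hv]
  have hR : |e w + f w - inner ℝ a (Q w)| ≤ 3 * C * Λ + L * ‖a - b‖ := by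
    have hd : |inner ℝ (a - b) (Q w)| ≤ L * ‖a - b‖ := by
      refine (abs_real_inner_le_norm _ _).trans ?_
      rw [mul_comm]
      exact mul_le_mul_of_nonneg_right (h.normQ w) (norm_nonneg _)
    have hf := abs_le.1 (h.f_le w)
    have hb := abs_le.1 (h.bQ_le w)
    have he := abs_le.1 (h.e_le w)
    rw [inner_sub_left] at hd
    have hd := abs_le.1 hd
    have h1 : Λ ≤ C * Λ := by nlinarith
    have h2 : C ≤ C * Λ := by nlinarith
    rw [abs_le]
    constructor <;> linarith [hd.1, hd.2, hf.1, hf.2, hb.1, hb.2, he.1, he.2]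
  have ht : |inner ℝ v (Q w)| ≤ L * (C * ‖a - b‖) := by
    refine (abs_real_inner_le_norm _ _).trans ?_
    rw [mul_comm]
    exact mul_le_mul (h.normQ w) hv1 (norm_nonneg _) (by positivity)
  set R := e w + f w - inner ℝ a (Q w)
  set m := ‖a - b‖
  have hm : 0 ≤ m := norm_nonneg _
  have hG0 : 0 ≤ ∫ x, (inner ℝ (Q w) (P x)) ^ 2 ∂ρ := integral_nonneg fun _ => sq_nonneg _
  have hG := h.gramForm_Q_le w
  have k1 : |2 * η * (R * inner ℝ v (Q w))| ≤ 2 * η * ((3 * C * Λ + L * m) * (L * (C * m))) := by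
    rw [abs_mul (2 * η), abs_mul R, abs_of_pos (show 0 < 2 * η by positivity)]
    gcongr
  have k2 : |η ^ 2 * (R ^ 2 * ∫ x, (inner ℝ (Q w) (P x)) ^ 2 ∂ρ)|
      ≤ η ^ 2 * ((2 * ((3 * C * Λ) ^ 2 + (L * m) ^ 2)) * (C * L ^ 2)) := by
    rw [abs_of_nonneg (by positivity)]
    have : R ^ 2 ≤ 2 * ((3 * C * Λ) ^ 2 + (L * m) ^ 2) := by
      rw [← sq_abs]
      refine (pow_le_pow_left₀ (abs_nonneg _) hR 2).trans ?_
      nlinarith [sq_nonneg (3 * C * Λ - L * m)]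
    gcongr
  -- Noise times gradient is the critical term. Its square splits as (ηΛ²)(ηL²)m² ≤ lam²·Cu·m², and
  -- u m² is at most (m² + u)².
  have n1 : η * Λ * L * m ≤ C * (lam * (m ^ 2 + u)) := by
    refine (pow_le_pow_iff_left₀ (by positivity) (by positivity) two_ne_zero).1 ?_
    calc (η * Λ * L * m) ^ 2 = (η * Λ ^ 2) * (η * L ^ 2) * m ^ 2 := by ring
      _ ≤ lam ^ 2 * (C * u) * m ^ 2 := by
        have := h.ηΛ_le
        have := h.ηL_le
        gcongr
      _ = C * lam ^ 2 * (u * m ^ 2) := by ring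
      _ ≤ C ^ 2 * lam ^ 2 * (m ^ 2 + u) ^ 2 := by
        gcongr
        · nlinarith
        · nlinarith [sq_nonneg (m ^ 2), mul_nonneg hu.le (sq_nonneg m)]
      _ = _ := by ring
  have n2 : η * L ^ 2 * m ^ 2 ≤ C * (lam * (m ^ 2 + u)) := by
    calc _ ≤ C * u * m ^ 2 := mul_le_mul_of_nonneg_right h.ηL_le (sq_nonneg m)
      _ ≤ C * lam * m ^ 2 := by gcongr
      _ ≤ C * lam * (m ^ 2 + u) := by gcongr; linarith
      _ = _ := by ring
  have n3 : (η * Λ ^ 2) * (η * L ^ 2) ≤ C * (lam * (m ^ 2 + u)) := by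
    calc _ ≤ lam ^ 2 * (C * u) := by
          have := h.ηΛ_le
          have := h.ηL_le
          gcongr
      _ ≤ lam * (C * (m ^ 2 + u)) := by
          gcongr
          · exact h.lam_sq_le
          · nlinarith [sq_nonneg m]
      _ = _ := by ring
  have n4 : (η * L ^ 2) * (η * L ^ 2 * m ^ 2) ≤ C ^ 2 * (lam * (m ^ 2 + u)) := by
    have : η * L ^ 2 ≤ C := h.ηL_le.trans (by nlinarith [h.u_le_one])
    calc _ ≤ C * (C * (lam * (m ^ 2 + u))) := by gcongr
      _ = _ := by ring
  set S := lam * (m ^ 2 + u)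
  have hS : 0 ≤ S := by positivity
  refine (abs_add_le _ _).trans ((add_le_add k1 k2).trans ?_)
  have p1 : C ^ 2 ≤ C ^ 6 := pow_le_pow_right₀ hC (by norm_num)
  have p2 : C ^ 3 ≤ C ^ 6 := pow_le_pow_right₀ hC (by norm_num)
  have p3 : C ^ 4 ≤ C ^ 6 := pow_le_pow_right₀ hC (by norm_num)
  calc _ = 6 * C ^ 2 * (η * Λ * L * m) + 2 * C * (η * L ^ 2 * m ^ 2)
        + 18 * C ^ 3 * ((η * Λ ^ 2) * (η * L ^ 2)) + 2 * C * ((η * L ^ 2) * (η * L ^ 2 * m ^ 2)) := by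
        ring
    _ ≤ 6 * C ^ 2 * (C * S) + 2 * C * (C * S) + 18 * C ^ 3 * (C * S) + 2 * C * (C ^ 2 * S) := by
      gcongr
    _ = 8 * (C ^ 3 * S) + 2 * (C ^ 2 * S) + 18 * (C ^ 4 * S) := by ring
    _ ≤ 8 * (C ^ 6 * S) + 2 * (C ^ 6 * S) + 18 * (C ^ 6 * S) := by gcongr
    _ ≤ _ := by nlinarith [mul_nonneg (pow_nonneg (zero_le_one.trans hC) 6) hS]

theorem integral_resid_mul_sq_le (h : RoundBounds ρ P Q f e b c C ϑ η u lam L Λ) (hϑ : ϑ ≤ 1)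
    (a v : EuclideanSpace ℝ (Fin J)) (hv1 : ‖v‖ ≤ C * ‖a - b‖) :
    ∫ w, ((e w + f w - inner ℝ a (Q w)) * inner ℝ v (Q w)) ^ 2 ∂ρ
      ≤ 54 * C ^ 6 * (L * ‖a - b‖ ^ 2 + L ^ 2 * ‖a - b‖ ^ 4) := by
  have hC := h.one_le_C
  have hL := h.one_le_L
  have bt := h.bddQ v
  have bet := (h.bdde.pow 2).mul (bt.pow 2)
  have bCt := (bt.pow 2).const_mul (4 * C ^ 2)
  have hQ := ((h.bddQ (a - b)).pow 2).const_mul (L ^ 2 * ‖v‖ ^ 2)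
  have h1 : ∫ w, ((e w + f w - inner ℝ a (Q w)) * inner ℝ v (Q w)) ^ 2 ∂ρ
      ≤ ∫ w, 3 * ((e w ^ 2 * (inner ℝ v (Q w)) ^ 2 + 4 * C ^ 2 * (inner ℝ v (Q w)) ^ 2)
        + L ^ 2 * ‖v‖ ^ 2 * (inner ℝ (a - b) (Q w)) ^ 2) ∂ρ := by
    refine integral_mono (((h.bdd_resid a).mul bt).pow 2).integrable
      (((bet.add bCt).add hQ).const_mul 3).integrable fun w => ?_
    have hf := abs_le.1 (h.f_le w)
    have hb := abs_le.1 (h.bQ_le w)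
    have hn : (inner ℝ v (Q w)) ^ 2 ≤ L ^ 2 * ‖v‖ ^ 2 := by
      rw [← sq_abs, ← mul_pow]
      refine pow_le_pow_left₀ (abs_nonneg _) ((abs_real_inner_le_norm _ _).trans ?_) 2
      rw [mul_comm]
      exact mul_le_mul_of_nonneg_right (h.normQ w) (norm_nonneg _)
    have hn' := mul_le_mul_of_nonneg_right hn (sq_nonneg (inner ℝ (a - b) (Q w)))
    refine le_trans ?_ (mul_le_mul_of_nonneg_left (add_le_add_right hn' _) (by norm_num))
    simp only [inner_sub_left]
    generalize inner ℝ a (Q w) = x at *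
    generalize inner ℝ b (Q w) = y at *
    generalize inner ℝ v (Q w) = t at *
    have h4 : (f w - y) ^ 2 ≤ 4 * C ^ 2 := by nlinarith
    have h6 : (e w + f w - x) ^ 2 ≤ 3 * (e w ^ 2 + (f w - y) ^ 2 + (x - y) ^ 2) := by
      nlinarith [sq_nonneg (e w - (f w - y)), sq_nonneg (e w + (x - y)),
        sq_nonneg ((f w - y) + (x - y))]
    rw [mul_pow]
    calc _ ≤ 3 * (e w ^ 2 + 4 * C ^ 2 + (x - y) ^ 2) * t ^ 2 := by gcongr; linarith
      _ = _ := by ring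
  rw [integral_const_mul, integral_add (bet.add bCt).integrable hQ.integrable,
    integral_add bet.integrable bCt.integrable, integral_const_mul (4 * C ^ 2),
    integral_const_mul (L ^ 2 * ‖v‖ ^ 2)] at h1
  set m := ‖a - b‖
  have hm : 0 ≤ m := norm_nonneg _
  have hvm : 2 * C * ‖v‖ ≤ 2 * C ^ 2 * m := by nlinarith
  have tQ : ∫ w, (inner ℝ v (Q w)) ^ 2 ∂ρ ≤ (2 * C ^ 2 * m) ^ 2 :=
    (h.integral_sq_Q hϑ v).trans (pow_le_pow_left₀ (by positivity) hvm 2)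
  -- Cauchy–Schwarz with the fourth moment of the noise leaves a single power of L and no Λ, which
  -- the uniform bound |e| ≤ Λ would bring in.
  have j1 : ∫ w, e w ^ 2 * (inner ℝ v (Q w)) ^ 2 ∂ρ ≤ C * (2 * C ^ 3 * L * m ^ 2) := by
    refine (le_abs_self _).trans (abs_integral_mul_le (h.bdde.pow 2) (bt.pow 2) (by linarith)
      (by positivity) ?_ ?_)
    · simp only [← pow_mul]
      exact h.e_four.trans (by nlinarith)
    · calc ∫ w, ((inner ℝ v (Q w)) ^ 2) ^ 2 ∂ρ
          ≤ ∫ w, (L * (C * m)) ^ 2 * (inner ℝ v (Q w)) ^ 2 ∂ρ := by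
            refine integral_mono ((bt.pow 2).pow 2).integrable ((bt.pow 2).const_mul _).integrable
              fun w => ?_
            simp only
            rw [sq (inner ℝ v (Q w) ^ 2)]
            apply mul_le_mul_of_nonneg_right _ (sq_nonneg _)
            rw [← sq_abs]
            refine pow_le_pow_left₀ (abs_nonneg _) ((abs_real_inner_le_norm _ _).trans ?_) 2
            rw [mul_comm]
            exact mul_le_mul (h.normQ w) hv1 (norm_nonneg _) (by positivity)
        _ ≤ (L * (C * m)) ^ 2 * (2 * C ^ 2 * m) ^ 2 := by
            rw [integral_const_mul]; gcongr
        _ = _ := by ring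
  have j2 : 4 * C ^ 2 * ∫ w, (inner ℝ v (Q w)) ^ 2 ∂ρ ≤ 16 * C ^ 6 * (L * m ^ 2) := by
    calc _ ≤ 4 * C ^ 2 * (2 * C ^ 2 * m) ^ 2 := by gcongr
      _ = 16 * C ^ 6 * (1 * m ^ 2) := by ring
      _ ≤ _ := by gcongr
  have j3 : L ^ 2 * ‖v‖ ^ 2 * ∫ w, (inner ℝ (a - b) (Q w)) ^ 2 ∂ρ
      ≤ 4 * C ^ 4 * (L ^ 2 * m ^ 4) := by
    calc _ ≤ L ^ 2 * (C * m) ^ 2 * (2 * C * m) ^ 2 := by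
          gcongr; exact h.integral_sq_Q hϑ _
      _ = _ := by ring
  have p3 : C ^ 4 ≤ C ^ 6 := pow_le_pow_right₀ hC (by norm_num)
  have q1 : C ^ 4 * (L * m ^ 2) ≤ C ^ 6 * (L * m ^ 2) := by gcongr
  have q2 : C ^ 4 * (L ^ 2 * m ^ 4) ≤ C ^ 6 * (L ^ 2 * m ^ 4) := by gcongr
  have q3 : 0 ≤ C ^ 6 * (L ^ 2 * m ^ 4) := by positivity
  nlinarith

/-- Compared with squaring the uniform bound, the mean square gains a factor η. Without it the
second-order terms of the moment recursion would exceed the drift, which is itself of order η. -/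
theorem integral_riskStep_sq_le (h : RoundBounds ρ P Q f e b c C ϑ η u lam L Λ) (hϑ : ϑ ≤ 1)
    (a : EuclideanSpace ℝ (Fin J)) :
    ∫ w, (riskStep ρ P Q f e η a w) ^ 2 ∂ρ
      ≤ 3000 * C ^ 9 * (η * lam ^ 2 * (‖a - b‖ ^ 2 + u) ^ 2) := by
  obtain ⟨v, hv, hv1, -⟩ := h.exists_gram_image (a - b)
  have hC := h.one_le_C
  have hη := h.η_pos
  have hu := h.u_pos
  have hL := h.one_le_L
  have hlam := h.lam_pos
  have hR := h.bdd_resid a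
  have hG := h.bdd_gramForm_Q
  have bRt := (hR.mul (h.bddQ v)).pow 2
  have h1 : ∫ w, (riskStep ρ P Q f e η a w) ^ 2 ∂ρ
      ≤ ∫ w, 8 * η ^ 2 * ((e w + f w - inner ℝ a (Q w)) * inner ℝ v (Q w)) ^ 2
        + 2 * η ^ 4 * (C * L ^ 2) ^ 2 * (e w + f w - inner ℝ a (Q w)) ^ 4 ∂ρ := by
    refine integral_mono ?_ ((bRt.const_mul _).add ((hR.pow 4).const_mul _)).integrable
      fun w => ?_
    · have : BddMeas (riskStep ρ P Q f e η a) := ⟨h.measurable_riskStep a, _, h.abs_riskStep_le a⟩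
      exact (this.pow 2).integrable
    · simp only [h.riskStep_eq a v hv]
      have g1 := h.gramForm_Q_le w
      have g0 : 0 ≤ ∫ x, (inner ℝ (Q w) (P x)) ^ 2 ∂ρ := integral_nonneg fun _ => sq_nonneg _
      generalize e w + f w - inner ℝ a (Q w) = R at *
      generalize inner ℝ v (Q w) = t at *
      generalize ∫ x, (inner ℝ (Q w) (P x)) ^ 2 ∂ρ = q at *
      have g2 : q ^ 2 ≤ (C * L ^ 2) ^ 2 := pow_le_pow_left₀ g0 g1 2
      have g3 : η ^ 4 * q ^ 2 * R ^ 4 ≤ η ^ 4 * (C * L ^ 2) ^ 2 * R ^ 4 := by gcongr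
      nlinarith [sq_nonneg (2 * η * (R * t) - η ^ 2 * (R ^ 2 * q))]
  rw [integral_add (bRt.const_mul _).integrable ((hR.pow 4).const_mul _).integrable,
    integral_const_mul, integral_const_mul] at h1
  have h2 := h.integral_resid_mul_sq_le hϑ a v hv1
  have h3 := h.integral_resid_pow_four hϑ a
  set m := ‖a - b‖
  have hm : 0 ≤ m := norm_nonneg _
  have hηL := h.ηL_le
  have hu1 := h.u_le_one
  set S := η * lam ^ 2 * (m ^ 2 + u) ^ 2 with hS
  have hS0 : 0 ≤ S := by positivity
  have s1 : u * m ^ 2 ≤ (m ^ 2 + u) ^ 2 := by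
    nlinarith [sq_nonneg (m ^ 2), mul_nonneg hu.le (sq_nonneg m)]
  have s2 : m ^ 4 ≤ (m ^ 2 + u) ^ 2 := by
    nlinarith [mul_nonneg hu.le (sq_nonneg m)]
  have s3 : u ^ 2 ≤ (m ^ 2 + u) ^ 2 := by
    nlinarith [mul_nonneg hu.le (sq_nonneg m), sq_nonneg (m ^ 2)]
  have t1 : η ^ 2 * (L * m ^ 2) ≤ C * S := by
    -- Only one power of L is present, so the spare factor L, with L lam² ≥ 1, pays for the required
    -- lam².
    have : η * L ≤ C * u * lam ^ 2 := by
      calc η * L ≤ η * L * (L * lam ^ 2) := le_mul_of_one_le_right (by positivity) h.one_le_Llam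
        _ = η * L ^ 2 * lam ^ 2 := by ring
        _ ≤ _ := by gcongr
    calc _ = η * (η * L) * m ^ 2 := by ring
      _ ≤ η * (C * u * lam ^ 2) * m ^ 2 := by gcongr
      _ = C * (η * lam ^ 2 * (u * m ^ 2)) := by ring
      _ ≤ _ := by rw [hS]; gcongr
  have t2 : η ^ 2 * (L ^ 2 * m ^ 4) ≤ C * S := by
    calc _ = η * (η * L ^ 2) * m ^ 4 := by ring
      _ ≤ η * (C * lam ^ 2) * m ^ 4 := by
        have : η * L ^ 2 ≤ C * lam ^ 2 :=
          hηL.trans (mul_le_mul_of_nonneg_left h.u_le (by linarith))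
        gcongr
      _ = C * (η * lam ^ 2 * m ^ 4) := by ring
      _ ≤ _ := by rw [hS]; gcongr
  have t3 : η ^ 4 * (L ^ 2) ^ 2 ≤ C ^ 2 * S := by
    calc _ = η * η * (η * L ^ 2) ^ 2 := by ring
      _ ≤ η * lam ^ 2 * (C * u) ^ 2 := by
        gcongr
        exact h.η_le
      _ = C ^ 2 * (η * lam ^ 2 * u ^ 2) := by ring
      _ ≤ _ := by rw [hS]; gcongr
  have t4 : η ^ 4 * (L ^ 2) ^ 2 * (L ^ 2 * m ^ 4) ≤ C ^ 3 * S := by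
    calc _ = η * (η * L ^ 2) ^ 3 * m ^ 4 := by ring
      _ ≤ η * (C * u) ^ 3 * m ^ 4 := by gcongr
      _ = C ^ 3 * (η * (u * u ^ 2) * m ^ 4) := by ring
      _ ≤ C ^ 3 * (η * (lam ^ 2 * 1) * (m ^ 2 + u) ^ 2) := by
        gcongr
        · exact h.u_le
        · exact pow_le_one₀ hu.le hu1
      _ = _ := by rw [hS]; ring
  have w1 := mul_le_mul_of_nonneg_left h2 (show 0 ≤ 8 * η ^ 2 by positivity)
  have w2 := mul_le_mul_of_nonneg_left h3 (show 0 ≤ 2 * η ^ 4 * (C * L ^ 2) ^ 2 by positivity)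
  have p1 : C ^ 7 ≤ C ^ 9 := pow_le_pow_right₀ hC (by norm_num)
  have p2 : C ^ 8 ≤ C ^ 9 := pow_le_pow_right₀ hC (by norm_num)
  calc _ ≤ _ := h1
    _ ≤ 8 * η ^ 2 * (54 * C ^ 6 * (L * m ^ 2 + L ^ 2 * m ^ 4))
        + 2 * η ^ 4 * (C * L ^ 2) ^ 2 * (459 * C ^ 4 * (1 + L ^ 2 * m ^ 4)) := add_le_add w1 w2
    _ = 432 * C ^ 6 * (η ^ 2 * (L * m ^ 2) + η ^ 2 * (L ^ 2 * m ^ 4))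
        + 918 * C ^ 6 * (η ^ 4 * (L ^ 2) ^ 2 + η ^ 4 * (L ^ 2) ^ 2 * (L ^ 2 * m ^ 4)) := by ring
    _ ≤ 432 * C ^ 6 * (C * S + C * S) + 918 * C ^ 6 * (C ^ 2 * S + C ^ 3 * S) := by gcongr
    _ = 864 * (C ^ 7 * S) + 918 * (C ^ 8 * S) + 918 * (C ^ 9 * S) := by ring
    _ ≤ 864 * (C ^ 9 * S) + 918 * (C ^ 9 * S) + 918 * (C ^ 9 * S) := by gcongr
    _ ≤ _ := by nlinarith [mul_nonneg (pow_nonneg (zero_le_one.trans hC) 9) hS0]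

end RoundBounds
end OnlineSieve

/-! ### Contraction of the moments of the excess risk -/

namespace OnlineSieve

/-- The preceding bounds with ‖a - b‖² replaced by the risk, to which it is comparable up to u. The
constants depend on c and C alone, hence neither on the dimension nor on the round. -/
theorem exists_riskStep_bounds (c C : ℝ) (hc : 0 < c) (hC : 1 ≤ C) :
    ∃ ϑ₀ c₁ C₁ : ℝ, 0 < ϑ₀ ∧ 0 < c₁ ∧ 1 ≤ C₁ ∧
    ∀ {W : Type} [MeasurableSpace W] {J : ℕ} {ρ : Measure W} [IsProbabilityMeasure ρ]
      {P Q : W → EuclideanSpace ℝ (Fin J)} {f e : W → ℝ} {b : EuclideanSpace ℝ (Fin J)}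
      {ϑ η u lam L Λ : ℝ}, RoundBounds ρ P Q f e b c C ϑ η u lam L Λ → ϑ ≤ ϑ₀ → lam ≤ ϑ₀ →
      ∀ a : EuclideanSpace ℝ (Fin J),
        ∫ w, riskStep ρ P Q f e η a w ∂ρ ≤ -c₁ * η * sieveRisk ρ P f a + C₁ * η * u ∧
        (∀ w, |riskStep ρ P Q f e η a w| ≤ C₁ * lam * (sieveRisk ρ P f a + u)) ∧
        ∫ w, (riskStep ρ P Q f e η a w) ^ 2 ∂ρ
          ≤ C₁ * η * lam ^ 2 * (sieveRisk ρ P f a + u) ^ 2 := by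
  set A := 1 + 1 / c with hA
  have hA1 : 1 ≤ A := by rw [hA]; have : 0 < 1 / c := by positivity
                         linarith
  -- The three entries of the threshold are what the mean square bounds at the plug-in index, the
  -- absorption of the plug-in terms and that of the second-order term require. The rate c²/(2C)
  -- comes from m² ≥ G/C - u.
  refine ⟨min 1 (min (c ^ 2 / (12 * C ^ 2)) (c ^ 2 / (36 * C ^ 4))), c ^ 2 / (2 * C),
    (50 * C ^ 5 / c ^ 2 + 18 * C ^ 4 + c ^ 2) + 40 * C ^ 6 * A + 3000 * C ^ 9 * A ^ 2,
    by positivity, by positivity, ?_, ?_⟩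
  · have h1 : 1 ≤ C ^ 6 * A := one_le_mul_of_one_le_of_one_le (one_le_pow₀ hC) hA1
    have : 0 ≤ (50 * C ^ 5 / c ^ 2 + 18 * C ^ 4 + c ^ 2) + 3000 * C ^ 9 * A ^ 2 := by positivity
    linarith
  intro W _ J ρ _ P Q f e b ϑ η u lam L Λ h hϑ hlam a
  have hϑ1 : ϑ ≤ 1 := hϑ.trans (min_le_left _ _)
  have hϑ2 : 12 * (ϑ * C ^ 2) ≤ c ^ 2 := by
    have := hϑ.trans ((min_le_right _ _).trans (min_le_left _ _))
    rw [le_div_iff₀ (by positivity)] at this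
    linarith
  have hl2 : 36 * C ^ 4 * lam ≤ c ^ 2 := by
    have := hlam.trans ((min_le_right _ _).trans (min_le_right _ _))
    rw [le_div_iff₀ (by positivity)] at this
    linarith
  have hη := h.η_pos
  have hu := h.u_pos
  have hl := h.lam_pos
  have hG := sieveRisk_nonneg ρ P f a
  have g1 := h.le_sieveRisk a
  have g2 := h.sieveRisk_le a
  have d1 := h.integral_riskStep_le hϑ1 hϑ2 hl2 a
  have d2 := h.abs_riskStep_le a
  have d3 := h.integral_riskStep_sq_le hϑ1 a
  set m := ‖a - b‖
  set G := sieveRisk ρ P f a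
  have k0 : m ^ 2 + u ≤ A * (G + u) := by
    have h1 : m ^ 2 ≤ G / c := by rw [le_div_iff₀ hc]; linarith
    have h2 : A * (G + u) = G / c + G + u + u / c := by rw [hA]; ring
    have h3 : 0 ≤ u / c := by positivity
    linarith
  have X1 : 0 ≤ 50 * C ^ 5 / c ^ 2 + 18 * C ^ 4 + c ^ 2 := by positivity
  have X2 : 0 ≤ 40 * C ^ 6 * A := by positivity
  have X3 : 0 ≤ 3000 * C ^ 9 * A ^ 2 := by positivity
  refine ⟨?_, fun w => ?_, ?_⟩
  · have h1 : -(c ^ 2 / 2) * m ^ 2 ≤ -(c ^ 2 / (2 * C)) * G + c ^ 2 / 2 * u := by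
      have h2 : c ^ 2 / (2 * C) * G ≤ c ^ 2 / (2 * C) * (C * m ^ 2 + C * u) := by gcongr
      have h3 : c ^ 2 / (2 * C) * (C * m ^ 2 + C * u) = c ^ 2 / 2 * m ^ 2 + c ^ 2 / 2 * u := by
        field_simp
      linarith
    refine d1.trans ?_
    calc _ ≤ η * (-(c ^ 2 / (2 * C)) * G + ((50 * C ^ 5 / c ^ 2 + 18 * C ^ 4 + c ^ 2)
          + 40 * C ^ 6 * A + 3000 * C ^ 9 * A ^ 2) * u) := by
          apply mul_le_mul_of_nonneg_left _ hη.le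
          have : 0 ≤ (c ^ 2 / 2 + 40 * C ^ 6 * A + 3000 * C ^ 9 * A ^ 2) * u := by positivity
          linarith
      _ = _ := by ring
  · refine (d2 w).trans ?_
    calc _ ≤ 40 * C ^ 6 * (lam * (A * (G + u))) := by gcongr
      _ = 40 * C ^ 6 * A * lam * (G + u) := by ring
      _ ≤ _ := by gcongr; linarith
  · refine d3.trans ?_
    calc _ ≤ 3000 * C ^ 9 * (η * lam ^ 2 * (A * (G + u)) ^ 2) := by gcongr
      _ = 3000 * C ^ 9 * A ^ 2 * η * lam ^ 2 * (G + u) ^ 2 := by ring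
      _ ≤ _ := by gcongr; linarith

/-- Compare T with lam·u. If T is the larger up to a constant, then lam(T + Bu) ≤ εT and the left
side is a small multiple of T^(n+2); otherwise T and lam(T + Bu) are both O(lam·u). This is how the
second-order terms are forced down to (lam·u)^(n+2). -/
theorem exists_absorption (M A B c₁ : ℝ) (hM : 0 ≤ M) (hA : 0 ≤ A) (hB : 0 ≤ B) (hc₁ : 0 < c₁)
    (n : ℕ) : ∃ ϑ₀ C₂ : ℝ, 0 < ϑ₀ ∧ 0 ≤ C₂ ∧ ∀ T lam u : ℝ, 0 ≤ T → 0 ≤ lam → 0 ≤ u → lam ≤ ϑ₀ →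
      M * ((lam * (T + B * u)) ^ 2 * (T + A * (lam * (T + B * u))) ^ n)
        ≤ c₁ * T ^ (n + 2) + C₂ * (lam * u) ^ (n + 2) := by
  obtain ⟨ε, hε0, hε1, hε⟩ : ∃ ε : ℝ, 0 < ε ∧ ε ≤ 1 ∧ M * (ε ^ 2 * (1 + A) ^ n) ≤ c₁ := by
    -- Since ε ≤ 1, ε² ≤ ε, so a bound linear in ε suffices; the 1 keeps the denominator positive
    -- when M = 0.
    refine ⟨min 1 (c₁ / (M * (1 + A) ^ n + 1)), by positivity, min_le_left _ _, ?_⟩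
    set ε := min 1 (c₁ / (M * (1 + A) ^ n + 1))
    have h1 : ε ≤ c₁ / (M * (1 + A) ^ n + 1) := min_le_right _ _
    have h2 : ε ≤ 1 := min_le_left _ _
    have h0 : 0 ≤ ε := by positivity
    rw [le_div_iff₀ (by positivity)] at h1
    have h3 : ε ^ 2 ≤ ε := by nlinarith
    have h4 : 0 ≤ M * (1 + A) ^ n := by positivity
    nlinarith
  set q := 2 * B / ε + B with hq
  have hq0 : 0 ≤ q := by positivity
  refine ⟨min 1 (ε / 2), M * (q ^ 2 * (q + A * q) ^ n), by positivity, by positivity, ?_⟩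
  intro T lam u hT hlam hu hl
  have hl1 : lam ≤ 1 := hl.trans (min_le_left _ _)
  have hl2 : lam ≤ ε / 2 := hl.trans (min_le_right _ _)
  rcases le_total (2 * B / ε * (lam * u)) T with hc | hc
  · have hy : lam * (T + B * u) ≤ ε * T := by
      have h1 : B * (lam * u) ≤ ε / 2 * T := by
        have := mul_le_mul_of_nonneg_left hc (show 0 ≤ ε / 2 by positivity)
        have e : ε / 2 * (2 * B / ε * (lam * u)) = B * (lam * u) := by field_simp
        rwa [e] at this
      have h2 : lam * T ≤ ε / 2 * T := by gcongr
      linarith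
    have hy' : lam * (T + B * u) ≤ T := hy.trans (by nlinarith)
    calc _ ≤ M * ((ε * T) ^ 2 * (T + A * T) ^ n) := by gcongr
      _ = M * (ε ^ 2 * (1 + A) ^ n) * T ^ (n + 2) := by
        rw [show T + A * T = (1 + A) * T by ring, mul_pow, mul_pow, pow_add]; ring
      _ ≤ c₁ * T ^ (n + 2) := by gcongr
      _ ≤ _ := by
        have : 0 ≤ M * (q ^ 2 * (q + A * q) ^ n) * (lam * u) ^ (n + 2) := by positivity
        linarith
  · have hy : lam * (T + B * u) ≤ q * (lam * u) := by
      have h2 : lam * T ≤ 1 * T := by gcongr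
      rw [hq]; linarith
    have hT' : T ≤ q * (lam * u) := by
      have : 0 ≤ B * (lam * u) := by positivity
      rw [hq]; linarith
    calc _ ≤ M * ((q * (lam * u)) ^ 2 * (q * (lam * u) + A * (q * (lam * u))) ^ n) := by gcongr
      _ = M * (q ^ 2 * (q + A * q) ^ n) * (lam * u) ^ (n + 2) := by
        rw [show q * (lam * u) + A * (q * (lam * u)) = (q + A * q) * (lam * u) by ring,
          mul_pow (q + A * q), pow_add (lam * u)]
        ring
      _ ≤ _ := by
        have : 0 ≤ c₁ * T ^ (n + 2) := by positivity
        linarith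

/-- The moments of the excess risk contract in one round, up to a term of small order. -/
theorem exists_excess_contraction (c C : ℝ) (hc : 0 < c) (hC : 1 ≤ C) (n : ℕ) (hn : Even n) :
    ∃ ϑ₀ K c₂ C₂ : ℝ, 0 < ϑ₀ ∧ 1 ≤ K ∧ 0 < c₂ ∧ 0 ≤ C₂ ∧
    ∀ {W : Type} [MeasurableSpace W] {J : ℕ} {ρ : Measure W} [IsProbabilityMeasure ρ]
      {P Q : W → EuclideanSpace ℝ (Fin J)} {f e : W → ℝ} {b : EuclideanSpace ℝ (Fin J)}
      {ϑ η u u' lam L Λ : ℝ}, RoundBounds ρ P Q f e b c C ϑ η u lam L Λ → ϑ ≤ ϑ₀ → lam ≤ ϑ₀ →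
      u ≤ u' → K * (u' - u) ≤ η * lam * u →
      ∀ a : EuclideanSpace ℝ (Fin J),
        Integrable (fun w => (max (sieveRisk ρ P f
          (a + (η * (e w + f w - inner ℝ a (Q w))) • Q w) - K * u) 0) ^ (n + 2)) ρ ∧
        ∫ w, (max (sieveRisk ρ P f (a + (η * (e w + f w - inner ℝ a (Q w))) • Q w) - K * u) 0)
            ^ (n + 2) ∂ρ
          ≤ (1 - c₂ * η) * (max (sieveRisk ρ P f a - K * u') 0) ^ (n + 2)
            + C₂ * η * (lam * u) ^ (n + 2) := by
  obtain ⟨ϑ₁, c₁, C₁, hϑ₁, hc₁, hC₁, hstep⟩ := exists_riskStep_bounds c C hc hC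
  -- At risk K u the drift outweighs the forcing C₁ηu with ηu to spare; the spare part pays for the
  -- lowering of the level from K u' to K u.
  set K := max 1 ((C₁ + 1) / c₁) with hK
  have hK1 : 1 ≤ K := le_max_left _ _
  have hK2 : C₁ + 1 ≤ c₁ * K := by
    have : (C₁ + 1) / c₁ ≤ K := le_max_right _ _
    rw [div_le_iff₀ hc₁] at this
    linarith
  obtain ⟨ϑ₂, C₂, hϑ₂, hC₂, habs⟩ := exists_absorption ((n + 2) ^ 2 * (4 * C₁)) (2 * C₁)
    (2 * K + 1) c₁ (by positivity) (by positivity) (by positivity) hc₁ n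
  refine ⟨min ϑ₁ ϑ₂, K, c₁, C₂, by positivity, hK1, hc₁, hC₂, ?_⟩
  intro W _ J ρ _ P Q f e b ϑ η u u' lam L Λ h hϑ hlam huu hKu a
  obtain ⟨d1, d2, d3⟩ := hstep h (hϑ.trans (min_le_left _ _)) (hlam.trans (min_le_left _ _)) a
  have hη := h.η_pos
  have hη1 : η ≤ 1 := h.η_le.trans (h.lam_sq_le.trans h.lam_le)
  have hu := h.u_pos
  have hl := h.lam_pos
  have hl1 := h.lam_le
  have hG := sieveRisk_nonneg ρ P f a
  have hDb : BddMeas (riskStep ρ P Q f e η a) := ⟨h.measurable_riskStep a, _, d2⟩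
  have hD : ∀ w, sieveRisk ρ P f (a + (η * (e w + f w - inner ℝ a (Q w))) • Q w)
      = sieveRisk ρ P f a + riskStep ρ P Q f e η a w := fun w => by unfold riskStep; ring
  simp only [hD]
  generalize riskStep ρ P Q f e η a = D at *
  generalize sieveRisk ρ P f a = G at *
  set T := max (G - K * u') 0 with hT
  have hT0 : 0 ≤ T := le_max_right _ _
  -- The excess is measured from K u' before the update and from K u after it; the level difference
  -- `g` is added to the increment D.
  set g := K * (u' - u) with hg
  have hg0 : 0 ≤ g := mul_nonneg (by linarith) (by linarith)
  have hgu : g ≤ lam * u := hKu.trans (by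
    rw [mul_assoc]; exact mul_le_of_le_one_left (by positivity) hη1)
  have hu2 : u' ≤ 2 * u := by
    have h1 : u' - u ≤ g := le_mul_of_one_le_left (by linarith) hK1
    have h2 : lam * u ≤ 1 * u := by gcongr
    linarith
  set y := lam * (T + (2 * K + 1) * u) with hy
  have hGu : G + u ≤ T + (2 * K + 1) * u := by
    have h1 : G - K * u' ≤ T := le_max_left _ _
    have h2 : K * u' ≤ K * (2 * u) := by gcongr
    linarith
  have hly : lam * (G + u) ≤ y := mul_le_mul_of_nonneg_left hGu hl.le
  have hluy : lam * u ≤ y := by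
    refine le_trans ?_ hly
    gcongr; linarith
  have hy0 : 0 ≤ y := le_trans (by positivity) hluy
  have hX : BddMeas (fun w => D w + g) := hDb.add (BddMeas.const g)
  have hXabs : ∀ w, |D w + g| ≤ 2 * C₁ * y := by
    intro w
    refine (abs_add_le _ _).trans ?_
    rw [abs_of_nonneg hg0]
    have h1 := d2 w
    have h2 : C₁ * (lam * (G + u)) ≤ C₁ * y := by gcongr
    have h3 : 1 * y ≤ C₁ * y := by gcongr
    linarith
  -- The drift is used only where the risk is above the level; elsewhere T^(n+1) = 0.
  have hX1 : T ^ (n + 1) * ∫ w, D w + g ∂ρ ≤ -(c₁ * η) * T ^ (n + 2) := by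
    rcases le_or_gt (G - K * u') 0 with hneg | hpos
    · have : T = 0 := max_eq_right hneg
      simp [this]
    · have hTG : T = G - K * u' := max_eq_left hpos.le
      have h1 : ∫ w, D w + g ∂ρ ≤ -(c₁ * η) * T := by
        rw [integral_add hDb.integrable (BddMeas.const g).integrable]
        simp only [integral_const, probReal_univ, smul_eq_mul, one_mul]
        have h2 : g ≤ η * u := hKu.trans (by
          gcongr; exact mul_le_of_le_one_right hη.le hl1)
        have h3 : (C₁ + 1) * (η * u) ≤ c₁ * K * (η * u) := by gcongr
        have h4 : c₁ * η * (K * u) ≤ c₁ * η * (K * u') := by gcongr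
        rw [hTG]
        linarith
      calc _ ≤ T ^ (n + 1) * (-(c₁ * η) * T) := by gcongr
        _ = _ := by ring
  have hX2 : ∫ w, (D w + g) ^ 2 ∂ρ ≤ 4 * C₁ * (η * y ^ 2) := by
    have h1 : ∫ w, (D w + g) ^ 2 ∂ρ ≤ ∫ w, 2 * D w ^ 2 + 2 * g ^ 2 ∂ρ := by
      refine integral_mono (hX.pow 2).integrable
        (((hDb.pow 2).const_mul 2).add (BddMeas.const _)).integrable fun w => ?_
      simp only
      nlinarith [sq_nonneg (D w - g)]
    rw [integral_add ((hDb.pow 2).const_mul 2).integrable (BddMeas.const _).integrable,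
      integral_const_mul] at h1
    simp only [integral_const, probReal_univ, smul_eq_mul, one_mul] at h1
    have h2 : C₁ * η * lam ^ 2 * (G + u) ^ 2 ≤ C₁ * (η * y ^ 2) := by
      calc _ = C₁ * (η * (lam * (G + u)) ^ 2) := by ring
        _ ≤ _ := by gcongr
    have h3 : g ^ 2 ≤ C₁ * (η * y ^ 2) := by
      calc g ^ 2 ≤ (η * lam * u) ^ 2 := by gcongr
        _ = 1 * (η * η * (lam * u) ^ 2) := by ring
        _ ≤ C₁ * (η * 1 * y ^ 2) := by gcongr
        _ = _ := by ring
    linarith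
  have hpt : ∀ w, (max (G + D w - K * u) 0) ^ (n + 2)
      ≤ T ^ (n + 2) + (n + 2) * T ^ (n + 1) * (D w + g)
        + (n + 2) ^ 2 * (T + 2 * C₁ * y) ^ n * (D w + g) ^ 2 := by
    intro w
    have h1 : max (G + D w - K * u) 0 ≤ |T + (D w + g)| := by
      refine max_le ?_ (abs_nonneg _)
      refine le_trans ?_ (le_abs_self _)
      have : G - K * u' ≤ T := le_max_left _ _
      rw [hg]; linarith
    -- The new excess is at most |T + D + g|, and the even power removes the absolute value, so the
    -- polynomial expansion applies without a positive part.
    have h2 : (max (G + D w - K * u) 0) ^ (n + 2) ≤ (T + (D w + g)) ^ (n + 2) := by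
      have he : Even (n + 2) := hn.add even_two
      rw [← he.pow_abs (T + (D w + g))]
      exact pow_le_pow_left₀ (le_max_right _ _) h1 _
    have h3 := (abs_le.1 (abs_add_pow_sub_le T (D w + g) hT0 n)).2
    have h4 : ((n:ℝ) + 2) ^ 2 * ((D w + g) ^ 2 * (T + |D w + g|) ^ n)
        ≤ (n + 2) ^ 2 * (T + 2 * C₁ * y) ^ n * (D w + g) ^ 2 := by
      have : (T + |D w + g|) ^ n ≤ (T + 2 * C₁ * y) ^ n :=
        pow_le_pow_left₀ (by positivity) (by linarith [hXabs w]) _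
      calc _ ≤ ((n:ℝ) + 2) ^ 2 * ((D w + g) ^ 2 * (T + 2 * C₁ * y) ^ n) := by gcongr
        _ = _ := by ring
    linarith
  have hmeas : BddMeas (fun w => (max (G + D w - K * u) 0) ^ (n + 2)) := by
    refine BddMeas.pow ⟨?_, G + C₁ * lam * (G + u), fun w => ?_⟩ _
    · exact ((hDb.1.const_add G).sub_const _).max measurable_const
    · rw [abs_of_nonneg (le_max_right _ _)]
      refine max_le ?_ (by positivity)
      have := (abs_le.1 (d2 w)).2
      have : 0 ≤ K * u := by positivity
      linarith
  refine ⟨hmeas.integrable, ?_⟩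
  calc _ ≤ ∫ w, T ^ (n + 2) + (n + 2) * T ^ (n + 1) * (D w + g)
        + (n + 2) ^ 2 * (T + 2 * C₁ * y) ^ n * (D w + g) ^ 2 ∂ρ :=
        integral_mono hmeas.integrable (((BddMeas.const _).add (hX.const_mul _)).add
          ((hX.pow 2).const_mul _)).integrable hpt
    _ = T ^ (n + 2) + (n + 2) * (T ^ (n + 1) * ∫ w, D w + g ∂ρ)
        + (n + 2) ^ 2 * (T + 2 * C₁ * y) ^ n * ∫ w, (D w + g) ^ 2 ∂ρ := by
        rw [integral_add ((BddMeas.const _).add (hX.const_mul _)).integrable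
          ((hX.pow 2).const_mul _).integrable, integral_add (BddMeas.const _).integrable
          (hX.const_mul _).integrable, integral_const_mul, integral_const_mul]
        simp only [integral_const, probReal_univ, smul_eq_mul, one_mul]
        ring
    _ ≤ T ^ (n + 2) + (n + 2) * (-(c₁ * η) * T ^ (n + 2))
        + (n + 2) ^ 2 * (T + 2 * C₁ * y) ^ n * (4 * C₁ * (η * y ^ 2)) := by gcongr
    _ = T ^ (n + 2) + (n + 2) * (-(c₁ * η) * T ^ (n + 2))
        + η * ((n + 2) ^ 2 * (4 * C₁) * (y ^ 2 * (T + 2 * C₁ * y) ^ n)) := by ring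
    _ ≤ T ^ (n + 2) + (n + 2) * (-(c₁ * η) * T ^ (n + 2))
        + η * (c₁ * T ^ (n + 2) + C₂ * (lam * u) ^ (n + 2)) := by
        gcongr
        exact habs T lam u hT0 hl.le hu.le (hlam.trans (min_le_right _ _))
    -- Of the n + 2 copies of c₁ηT^(n+2) supplied by the drift, one pays for the second-order terms
    -- and at least one remains.
    _ ≤ _ := by
      have : 0 ≤ (n:ℝ) * (c₁ * η * T ^ (n + 2)) := by positivity
      linarith

end OnlineSieve

/-! ### Sieve vectors, Gram matrices and projections -/

namespace OnlineSieve

theorem abs_le_of_supNorm_le {f : ℝ → ℝ} {C : ℝ} (hC : 0 ≤ C) (h : supNorm f ≤ ENNReal.ofReal C)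
    (z : ℝ) : |f z| ≤ C := by
  have h1 : ‖f z‖ₑ ≤ ENNReal.ofReal C := (le_iSup (fun z => ‖f z‖ₑ) z).trans h
  rw [← ofReal_norm, ENNReal.ofReal_le_ofReal_iff hC] at h1
  exact h1

theorem exists_abs_le_of_supNorm_lt_top {f : ℝ → ℝ} (h : supNorm f < ∞) :
    ∃ C : ℝ, 0 ≤ C ∧ ∀ z, |f z| ≤ C :=
  ⟨(supNorm f).toReal, ENNReal.toReal_nonneg, abs_le_of_supNorm_le ENNReal.toReal_nonneg
    (by rw [ENNReal.ofReal_toReal h.ne])⟩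

theorem measurable_index_uncurry {p : ℕ} :
    Measurable (fun q : EuclideanSpace ℝ (Fin p) × Obs p => index q.1 q.2) := by
  unfold index
  fun_prop

theorem measurable_index {p : ℕ} (θ : EuclideanSpace ℝ (Fin p)) :
    Measurable (fun w : Obs p => index θ w) := by
  unfold index
  fun_prop

theorem abs_index_sub_le {p : ℕ} (θ θ₀ : EuclideanSpace ℝ (Fin p)) (w : Obs p) :
    |index θ w - index θ₀ w| ≤ ‖w.2.1‖ * ‖θ - θ₀‖ := by
  unfold index
  rw [add_sub_add_left_eq_sub, ← inner_sub_right]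
  exact abs_real_inner_le_norm _ _

section Basis

variable {ψ : ℕ → ℝ → ℝ}

theorem continuous_sieveVec (hd : ∀ j, 1 ≤ j → Differentiable ℝ (ψ j)) (J : ℕ) :
    Continuous (sieveVec ψ J) := by
  unfold sieveVec
  refine (PiLp.continuous_toLp 2 _).comp (continuous_pi fun j => ?_)
  exact (hd _ (Nat.le_add_left 1 j)).continuous

theorem norm_le_mul_sqrt {J : ℕ} {x : EuclideanSpace ℝ (Fin J)} {C : ℝ} (hC : 0 ≤ C)
    (h : ∀ i, |x i| ≤ C) : ‖x‖ ≤ C * √J := by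
  rw [EuclideanSpace.norm_eq]
  apply Real.sqrt_le_iff.2 ⟨by positivity, ?_⟩
  rw [mul_pow, Real.sq_sqrt (Nat.cast_nonneg _)]
  calc ∑ i, ‖x i‖ ^ 2 ≤ ∑ _i : Fin J, C ^ 2 :=
        Finset.sum_le_sum fun i _ => pow_le_pow_left₀ (norm_nonneg _) (h i) 2
    _ = _ := by simp; ring

theorem norm_sieveVec_le {C : ℝ} (hC : 0 ≤ C) (hb : ∀ j, 1 ≤ j → ∀ z, |ψ j z| ≤ C) (J : ℕ)
    (z : ℝ) : ‖sieveVec ψ J z‖ ≤ C * √J :=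
  norm_le_mul_sqrt hC fun i => hb _ (Nat.le_add_left 1 i) z

theorem norm_sieveVec_sub_le {C αψ : ℝ} (hC : 0 ≤ C) (hα : 0 ≤ αψ)
    (hd : ∀ j, 1 ≤ j → Differentiable ℝ (ψ j))
    (hb : ∀ j : ℕ, 1 ≤ j → ∀ z, |deriv (ψ j) z| ≤ C * (j : ℝ) ^ αψ) (J : ℕ) (z z' : ℝ) :
    ‖sieveVec ψ J z - sieveVec ψ J z'‖ ≤ C * ((J : ℝ) ^ αψ * √J * |z - z'|) := by
  have h := norm_le_mul_sqrt (x := sieveVec ψ J z - sieveVec ψ J z')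
    (C := C * (J : ℝ) ^ αψ * |z - z'|) (by positivity) fun i => ?_
  · calc _ ≤ _ := h
      _ = _ := by ring
  · have hi : 1 ≤ (i : ℕ) + 1 := Nat.le_add_left 1 i
    have hiJ : (((i : ℕ) + 1 : ℕ) : ℝ) ≤ J := by exact_mod_cast i.2
    have := Convex.norm_image_sub_le_of_norm_deriv_le (f := ψ (i + 1)) (C := C * (J : ℝ) ^ αψ)
      (fun x _ => (hd _ hi).differentiableAt) (fun x _ => ?_) convex_univ
      (Set.mem_univ z') (Set.mem_univ z)
    · exact this
    · refine (hb _ hi x).trans ?_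
      gcongr

theorem inner_sieveVec {J : ℕ} (a : EuclideanSpace ℝ (Fin J)) (z : ℝ) :
    inner ℝ a (sieveVec ψ J z) = ∑ i : Fin J, a i * ψ ((i : ℕ) + 1) z := by
  simp [sieveVec, PiLp.inner_apply, mul_comm]

theorem exists_inner_sieveVec_of_mem {J : ℕ} {g : ℝ → ℝ} (hg : g ∈ sieveSpace ψ J) :
    ∃ γ : EuclideanSpace ℝ (Fin J), ∀ z, g z = inner ℝ γ (sieveVec ψ J z) := by
  obtain ⟨c, hc⟩ := (Submodule.mem_span_range_iff_exists_fun ℝ).1 hg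
  refine ⟨WithLp.toLp 2 c, fun z => ?_⟩
  rw [inner_sieveVec, ← hc]
  simp [Finset.sum_apply]

end Basis

section Gram

variable {p : ℕ} {ρ : Measure (Obs p)} {θ₀ : EuclideanSpace ℝ (Fin p)} {ψ : ℕ → ℝ → ℝ}

theorem gram_isHermitian (J : ℕ) : (gram ρ θ₀ ψ J).IsHermitian := by
  ext i j
  simp only [gram, Matrix.conjTranspose_apply, Matrix.of_apply, star_trivial]
  congr 1; ext w; rw [mul_comm]

theorem isUnit_gram {J : ℕ} {c C : ℝ} (hc : 0 < c)
    (h : spectrum ℝ (gram ρ θ₀ ψ J) ⊆ Set.Icc c C) : IsUnit (gram ρ θ₀ ψ J) := by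
  by_contra hn
  exact absurd (h ((spectrum.zero_mem_iff ℝ).2 hn)).1 (not_le.2 hc)

variable [IsProbabilityMeasure ρ]

theorem integral_inner_mul_eq (J : ℕ)
    (hψ : ∀ j, 1 ≤ j → BddMeas (ψ j)) {g : Obs p → ℝ} (hg : BddMeas g)
    (v : EuclideanSpace ℝ (Fin J)) :
    ∫ w, inner ℝ v (sieveVec ψ J (index θ₀ w)) * g w ∂ρ
      = ∑ i, v i * ∫ w, sieveVec ψ J (index θ₀ w) i * g w ∂ρ := by
  have hb : ∀ i : Fin J, BddMeas (fun w : Obs p => ψ ((i : ℕ) + 1) (index θ₀ w) * g w) := by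
    intro i
    obtain ⟨m, A, hA⟩ := hψ ((i : ℕ) + 1) (Nat.le_add_left 1 i)
    exact BddMeas.mul ⟨m.comp (measurable_index θ₀), A, fun w => hA _⟩ hg
  simp only [inner_sieveVec, Finset.sum_mul, mul_assoc]
  rw [integral_finsetSum _ fun i _ => ((hb i).const_mul _).integrable]
  simp only [integral_const_mul]
  rfl

theorem bddMeas_inner_sieveVec {J : ℕ} (hψ : ∀ j, 1 ≤ j → BddMeas (ψ j))
    (θ : EuclideanSpace ℝ (Fin p)) (v : EuclideanSpace ℝ (Fin J)) :
    BddMeas (fun w : Obs p => inner ℝ v (sieveVec ψ J (index θ w))) := by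
  simp only [inner_sieveVec]
  have : ∀ s : Finset (Fin J),
      BddMeas (fun w : Obs p => ∑ i ∈ s, v i * ψ ((i : ℕ) + 1) (index θ w)) := by
    intro s
    induction s using Finset.cons_induction with
    | empty => simpa using BddMeas.const 0
    | cons i s hi ih =>
      simp only [Finset.sum_cons]
      obtain ⟨m, A, hA⟩ := hψ ((i : ℕ) + 1) (Nat.le_add_left 1 i)
      refine BddMeas.add (BddMeas.const_mul _ ⟨m.comp (measurable_index θ), A, fun w => hA _⟩) ih
  exact this _

theorem integral_inner_mul_inner (J : ℕ) (hψ : ∀ j, 1 ≤ j → BddMeas (ψ j))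
    (v x : EuclideanSpace ℝ (Fin J)) :
    ∫ w, inner ℝ v (sieveVec ψ J (index θ₀ w)) * inner ℝ x (sieveVec ψ J (index θ₀ w)) ∂ρ
      = v.ofLp ⬝ᵥ (gram ρ θ₀ ψ J *ᵥ x.ofLp) := by
  rw [integral_inner_mul_eq J hψ (bddMeas_inner_sieveVec hψ θ₀ x)]
  refine Finset.sum_congr rfl fun i _ => ?_
  congr 1
  have hc : BddMeas (fun w : Obs p => sieveVec ψ J (index θ₀ w) i) := by
    obtain ⟨m, A, hA⟩ := hψ ((i : ℕ) + 1) (Nat.le_add_left 1 i)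
    exact ⟨m.comp (measurable_index θ₀), A, fun w => hA _⟩
  have := integral_inner_mul_eq (ρ := ρ) (θ₀ := θ₀) J hψ hc x
  simp only [mul_comm (inner ℝ x _)] at this
  rw [this]
  simp only [Matrix.mulVec, dotProduct, gram, Matrix.of_apply]
  refine Finset.sum_congr rfl fun j _ => ?_
  rw [mul_comm]
  congr 2; ext w; rw [mul_comm]

/-- A - c and C - A are Hermitian with nonnegative spectrum, hence positive semidefinite. -/
theorem dotProduct_mulVec_bounds {n : ℕ} {A : Matrix (Fin n) (Fin n) ℝ} (hA : A.IsHermitian)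
    {c C : ℝ} (h : spectrum ℝ A ⊆ Set.Icc c C) (v : EuclideanSpace ℝ (Fin n)) :
    c * ‖v‖ ^ 2 ≤ v.ofLp ⬝ᵥ (A *ᵥ v.ofLp) ∧ v.ofLp ⬝ᵥ (A *ᵥ v.ofLp) ≤ C * ‖v‖ ^ 2 := by
  have hv : v.ofLp ⬝ᵥ v.ofLp = ‖v‖ ^ 2 := by
    rw [EuclideanSpace.norm_sq_eq]
    simp [dotProduct, sq]
  have hH : ∀ r : ℝ, (algebraMap ℝ (Matrix (Fin n) (Fin n) ℝ) r).IsHermitian := by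
    intro r
    rw [Matrix.algebraMap_eq_diagonal]
    exact Matrix.isHermitian_diagonal _
  have hm : ∀ r : ℝ, (algebraMap ℝ (Matrix (Fin n) (Fin n) ℝ) r) *ᵥ v.ofLp = r • v.ofLp := by
    intro r
    rw [Algebra.algebraMap_eq_smul_one, Matrix.smul_mulVec, Matrix.one_mulVec]
  constructor
  · have h1 : (A - algebraMap ℝ _ c).PosSemidef := by
      rw [Matrix.posSemidef_iff_isHermitian_and_spectrum_nonneg]
      refine ⟨hA.sub (hH c), ?_⟩
      rw [← spectrum.sub_singleton_eq]
      rintro _ ⟨x, hx, y, rfl, rfl⟩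
      exact sub_nonneg.2 (h hx).1
    have h2 := h1.dotProduct_mulVec_nonneg v.ofLp
    rw [Matrix.sub_mulVec, hm, dotProduct_sub, star_trivial, dotProduct_smul, hv] at h2
    simpa using h2
  · have h1 : (algebraMap ℝ _ C - A).PosSemidef := by
      rw [Matrix.posSemidef_iff_isHermitian_and_spectrum_nonneg]
      refine ⟨(hH C).sub hA, ?_⟩
      rw [← spectrum.singleton_sub_eq]
      rintro _ ⟨y, rfl, x, hx, rfl⟩
      exact sub_nonneg.2 (h hx).2
    have h2 := h1.dotProduct_mulVec_nonneg v.ofLp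
    rw [Matrix.sub_mulVec, hm, dotProduct_sub, star_trivial, dotProduct_smul, hv] at h2
    simpa using h2

/-- The normal equations of least squares. The lower spectral bound makes the Gram matrix
invertible, so that its inverse in `projCoef` is a genuine one. -/
theorem projCoef_orth {J : ℕ} {c C : ℝ} (hc : 0 < c) (hψ : ∀ j, 1 ≤ j → BddMeas (ψ j))
    (h : spectrum ℝ (gram ρ θ₀ ψ J) ⊆ Set.Icc c C) {F : ℝ → ℝ} (hF : BddMeas F)
    (v : EuclideanSpace ℝ (Fin J)) :
    ∫ w, inner ℝ v (sieveVec ψ J (index θ₀ w)) *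
      (inner ℝ (projCoef ρ θ₀ ψ J F) (sieveVec ψ J (index θ₀ w)) - F (index θ₀ w)) ∂ρ = 0 := by
  have hFi : BddMeas (fun w : Obs p => F (index θ₀ w)) :=
    ⟨hF.1.comp (measurable_index θ₀), hF.2.imp fun A hA w => hA _⟩
  have hv := bddMeas_inner_sieveVec hψ θ₀ v
  simp only [mul_sub]
  rw [integral_sub (hv.mul (bddMeas_inner_sieveVec hψ θ₀ _)).integrable (hv.mul hFi).integrable,
    integral_inner_mul_inner J hψ, integral_inner_mul_eq J hψ hFi, sub_eq_zero]
  unfold projCoef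
  rw [Matrix.mulVec_mulVec, Matrix.mul_nonsing_inv _
    ((Matrix.isUnit_iff_isUnit_det _).1 (isUnit_gram hc h)), Matrix.one_mulVec]
  rfl

/-- The mean squared error of the projection, and its distance to any other sieve function. -/
theorem projCoef_pythagoras {J : ℕ} {c C : ℝ} (hc : 0 < c) (hψ : ∀ j, 1 ≤ j → BddMeas (ψ j))
    (h : spectrum ℝ (gram ρ θ₀ ψ J) ⊆ Set.Icc c C) {F : ℝ → ℝ} (hF : BddMeas F)
    (γ : EuclideanSpace ℝ (Fin J)) :
    ∫ w, (inner ℝ (projCoef ρ θ₀ ψ J F) (sieveVec ψ J (index θ₀ w)) - F (index θ₀ w)) ^ 2 ∂ρ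
      + c * ‖γ - projCoef ρ θ₀ ψ J F‖ ^ 2
      ≤ ∫ w, (inner ℝ γ (sieveVec ψ J (index θ₀ w)) - F (index θ₀ w)) ^ 2 ∂ρ := by
  have hFi : BddMeas (fun w : Obs p => F (index θ₀ w)) :=
    ⟨hF.1.comp (measurable_index θ₀), hF.2.imp fun A hA w => hA _⟩
  set b := projCoef ρ θ₀ ψ J F
  have hP := fun v : EuclideanSpace ℝ (Fin J) => bddMeas_inner_sieveVec hψ θ₀ v
  have hb := (hP b).sub hFi
  have h1 : ∫ w, (inner ℝ γ (sieveVec ψ J (index θ₀ w)) - F (index θ₀ w)) ^ 2 ∂ρ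
      = ∫ w, (inner ℝ (γ - b) (sieveVec ψ J (index θ₀ w)) * inner ℝ (γ - b) (sieveVec ψ J (index θ₀ w))
        + 2 * (inner ℝ (γ - b) (sieveVec ψ J (index θ₀ w))
          * (inner ℝ b (sieveVec ψ J (index θ₀ w)) - F (index θ₀ w))))
      + (inner ℝ b (sieveVec ψ J (index θ₀ w)) - F (index θ₀ w)) ^ 2 ∂ρ := by
    congr 1; ext w
    rw [inner_sub_left]; ring
  rw [h1, integral_add (((hP _).mul (hP _)).add (((hP _).mul hb).const_mul _)).integrable
    (hb.pow 2).integrable, integral_add ((hP _).mul (hP _)).integrable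
    (((hP _).mul hb).const_mul _).integrable, integral_const_mul, projCoef_orth hc hψ h hF,
    integral_inner_mul_inner J hψ]
  have := (dotProduct_mulVec_bounds (gram_isHermitian J) h (γ - b)).1
  linarith

end Gram

/-! ### Truncation of the noise -/

section Noise

variable {p : ℕ} {ρ : Measure (Obs p)} [IsProbabilityMeasure ρ] {θ₀ : EuclideanSpace ℝ (Fin p)}
  {F₀ : ℝ → ℝ}

theorem IndexModel.integral_noise_mul (hmodel : IndexModel ρ F₀ θ₀)
    {g : ℝ × EuclideanSpace ℝ (Fin p) → ℝ} (hg : BddMeas g) :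
    ∫ w, noise F₀ θ₀ w * g (w.1, w.2.1) ∂ρ = 0 := by
  have hle : MeasurableSpace.comap (fun w : Obs p => (w.1, w.2.1)) inferInstance
      ≤ (inferInstance : MeasurableSpace (Obs p)) :=
    Measurable.comap_le (measurable_fst.prodMk measurable_snd.fst)
  obtain ⟨mg, A, hA⟩ := hg
  have hs : StronglyMeasurable[MeasurableSpace.comap (fun w : Obs p => (w.1, w.2.1)) inferInstance]
      (fun w : Obs p => g (w.1, w.2.1)) :=
    (mg.comp (comap_measurable _)).stronglyMeasurable
  have hint : Integrable ((fun w : Obs p => g (w.1, w.2.1)) * noise F₀ θ₀) ρ := by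
    refine hmodel.integrable_noise.bdd_mul (c := A) (hs.mono hle).aestronglyMeasurable
      (ae_of_all _ fun w => hA _)
  have h1 := condExp_mul_of_stronglyMeasurable_left hs hint hmodel.integrable_noise
  rw [← integral_condExp hle (f := (fun w : Obs p => noise F₀ θ₀ w * g (w.1, w.2.1)))]
  have e : (fun w : Obs p => noise F₀ θ₀ w * g (w.1, w.2.1))
      = (fun w : Obs p => g (w.1, w.2.1)) * noise F₀ θ₀ := by
    ext w; simp [mul_comm]
  rw [e]
  apply integral_eq_zero_of_ae
  filter_upwards [h1, hmodel.condExp_noise] with w h2 h3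
  rw [h2]
  simp [h3]

/-- The noise, set to zero where it exceeds `Λ` in absolute value. -/
noncomputable def truncNoise {p : ℕ} (F₀ : ℝ → ℝ) (θ₀ : EuclideanSpace ℝ (Fin p)) (Λ : ℝ)
    (w : Obs p) : ℝ :=
  if |noise F₀ θ₀ w| ≤ Λ then noise F₀ θ₀ w else 0

theorem measurable_noise (hF : Measurable F₀) : Measurable (noise F₀ θ₀) :=
  measurable_snd.snd.sub (hF.comp (measurable_index θ₀))

theorem measurable_truncNoise (hF : Measurable F₀) (Λ : ℝ) : Measurable (truncNoise F₀ θ₀ Λ) :=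
  Measurable.ite (measurableSet_le (measurable_noise hF).norm measurable_const)
    (measurable_noise hF) measurable_const

theorem abs_truncNoise_le {Λ : ℝ} (hΛ : 0 ≤ Λ) (w : Obs p) : |truncNoise F₀ θ₀ Λ w| ≤ Λ := by
  unfold truncNoise
  split_ifs with h
  · exact h
  · simpa using hΛ

theorem truncNoise_pow_four_le {κ : ℝ} (hκ : 4 ≤ κ) (Λ : ℝ) (w : Obs p) :
    truncNoise F₀ θ₀ Λ w ^ 4 ≤ 1 + |noise F₀ θ₀ w| ^ κ := by
  have h0 : 0 ≤ |noise F₀ θ₀ w| ^ κ := Real.rpow_nonneg (abs_nonneg _) _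
  unfold truncNoise
  split_ifs with h
  · have e : noise F₀ θ₀ w ^ 4 = |noise F₀ θ₀ w| ^ (4 : ℝ) := by
      rw [← Even.pow_abs (by decide : Even 4)]; norm_cast
    rw [e]
    rcases le_total |noise F₀ θ₀ w| 1 with h1 | h1
    · have := Real.rpow_le_one (abs_nonneg _) h1 (show (0:ℝ) ≤ 4 by norm_num)
      linarith
    · have := Real.rpow_le_rpow_of_exponent_le h1 hκ
      linarith
  · norm_num; linarith

/-- Where the noise is cut it exceeds Λ, and |x| = |x|^(1-κ)|x|^κ with 1 - κ ≤ 0. -/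
theorem abs_noise_sub_truncNoise_le {κ : ℝ} (hκ : 1 ≤ κ) {Λ : ℝ} (hΛ : 0 < Λ) (w : Obs p) :
    |noise F₀ θ₀ w - truncNoise F₀ θ₀ Λ w| ≤ Λ ^ (1 - κ) * |noise F₀ θ₀ w| ^ κ := by
  have h0 : 0 ≤ Λ ^ (1 - κ) * |noise F₀ θ₀ w| ^ κ := by positivity
  unfold truncNoise
  split_ifs with h
  · simpa using h0
  · push Not at h
    rw [sub_zero]
    have hn : 0 < |noise F₀ θ₀ w| := hΛ.trans h
    calc |noise F₀ θ₀ w| = |noise F₀ θ₀ w| ^ (1 - κ) * |noise F₀ θ₀ w| ^ κ := by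
          rw [← Real.rpow_add hn]; simp
      _ ≤ _ := by
        apply mul_le_mul_of_nonneg_right _ (by positivity)
        exact Real.rpow_le_rpow_of_nonpos hΛ h.le (by linarith)

/-- Truncation destroys the centring only through the discarded tail, because the full noise is
orthogonal to bounded functions of (x₀, X). The plug-in sieve vector at a fixed θ is such a
function. -/
theorem IndexModel.abs_integral_truncNoise_mul_le (hmodel : IndexModel ρ F₀ θ₀)
    (hF : Measurable F₀) {κ : ℝ} (hκ : 1 ≤ κ)
    (hε : Integrable (fun w : Obs p => |noise F₀ θ₀ w| ^ κ) ρ) {Λ : ℝ} (hΛ : 0 < Λ)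
    {g : ℝ × EuclideanSpace ℝ (Fin p) → ℝ} (hg : Measurable g) {A : ℝ} (hA : ∀ x, |g x| ≤ A) :
    |∫ w, truncNoise F₀ θ₀ Λ w * g (w.1, w.2.1) ∂ρ|
      ≤ (∫ w, |noise F₀ θ₀ w| ^ κ ∂ρ) * Λ ^ (1 - κ) * A := by
  have hgm : Measurable (fun w : Obs p => g (w.1, w.2.1)) :=
    hg.comp (measurable_fst.prodMk measurable_snd.fst)
  have hi1 : Integrable (fun w : Obs p => noise F₀ θ₀ w * g (w.1, w.2.1)) ρ :=
    hmodel.integrable_noise.mul_bdd (c := A) hgm.aestronglyMeasurable (ae_of_all _ fun w => hA _)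
  have hi2 : Integrable (fun w : Obs p => truncNoise F₀ θ₀ Λ w * g (w.1, w.2.1)) ρ :=
    (BddMeas.mul ⟨measurable_truncNoise hF Λ, Λ, abs_truncNoise_le hΛ.le⟩
      ⟨hgm, A, fun w => hA _⟩).integrable
  have h0 := hmodel.integral_noise_mul ⟨hg, A, hA⟩
  have h1 : ∫ w, truncNoise F₀ θ₀ Λ w * g (w.1, w.2.1) ∂ρ
      = - ∫ w, (noise F₀ θ₀ w - truncNoise F₀ θ₀ Λ w) * g (w.1, w.2.1) ∂ρ := by
    simp only [sub_mul]
    rw [integral_sub hi1 hi2, h0]; ring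
  rw [h1, abs_neg]
  have h2 : ∀ w, |(noise F₀ θ₀ w - truncNoise F₀ θ₀ Λ w) * g (w.1, w.2.1)|
      ≤ Λ ^ (1 - κ) * A * |noise F₀ θ₀ w| ^ κ := by
    intro w
    rw [abs_mul]
    calc _ ≤ (Λ ^ (1 - κ) * |noise F₀ θ₀ w| ^ κ) * A :=
          mul_le_mul (abs_noise_sub_truncNoise_le hκ hΛ w) (hA _) (abs_nonneg _) (by positivity)
      _ = _ := by ring
  calc _ ≤ ∫ w, |(noise F₀ θ₀ w - truncNoise F₀ θ₀ Λ w) * g (w.1, w.2.1)| ∂ρ :=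
        abs_integral_le_integral_abs
    _ ≤ ∫ w, Λ ^ (1 - κ) * A * |noise F₀ θ₀ w| ^ κ ∂ρ :=
        integral_mono_of_nonneg (ae_of_all _ fun _ => abs_nonneg _) (hε.const_mul _)
          (ae_of_all _ h2)
    _ = _ := by rw [integral_const_mul]; ring

end Noise
end OnlineSieve

/-! ### Verification of the round bounds -/

namespace OnlineSieve

variable {p : ℕ} {ρ : Measure (Obs p)} {θ₀ : EuclideanSpace ℝ (Fin p)}
  {ψ : ℕ → ℝ → ℝ} {F₀ : ℝ → ℝ} {s s₁ αψ κ : ℝ}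

theorem SieveBasis.bddMeas (hbasis : SieveBasis ρ θ₀ ψ αψ) (j : ℕ) (hj : 1 ≤ j) :
    BddMeas (ψ j) := by
  obtain ⟨C, hC, h⟩ := hbasis.bounds
  exact ⟨(hbasis.differentiable j hj).continuous.measurable, C,
    abs_le_of_supNorm_le hC.le (h j hj).1⟩

/-- Uniform sieve approximation at rate `J^{-s}` with coefficient vectors, and boundedness of the
regression function. -/
theorem exists_sieve_approx (hbasis : SieveBasis ρ θ₀ ψ αψ) (happrox : SieveApprox ρ θ₀ ψ F₀ s s₁) :
    ∃ A : ℝ, 0 < A ∧ (∀ z, |F₀ z| ≤ A) ∧ ∀ J : ℕ, 1 ≤ J → ∃ γ : EuclideanSpace ℝ (Fin J),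
      ∀ z, |inner ℝ γ (sieveVec ψ J z) - F₀ z| ≤ A * (J : ℝ) ^ (-s) := by
  obtain ⟨D, hD, hψ⟩ := hbasis.bounds
  obtain ⟨A, hA, h⟩ := happrox.approx
  have key : ∀ J : ℕ, 1 ≤ J → ∃ γ : EuclideanSpace ℝ (Fin J),
      ∀ z, |inner ℝ γ (sieveVec ψ J z) - F₀ z| ≤ A * (J : ℝ) ^ (-s) := by
    intro J hJ
    obtain ⟨g, hg, hgF⟩ := h J hJ
    obtain ⟨γ, hγ⟩ := exists_inner_sieveVec_of_mem hg
    refine ⟨γ, fun z => ?_⟩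
    rw [← hγ z, abs_sub_comm]
    exact abs_le_of_supNorm_le (by positivity) hgF z
  -- The approximation at J = 1 already bounds F₀: it lies within A of a bounded function.
  obtain ⟨γ, hγ⟩ := key 1 le_rfl
  refine ⟨A + ‖γ‖ * (D * √(1 : ℕ)), by positivity, fun z => ?_, fun J hJ => ?_⟩
  · have h1 := hγ z
    have h2 : |inner ℝ γ (sieveVec ψ 1 z)| ≤ ‖γ‖ * (D * √(1 : ℕ)) :=
      (abs_real_inner_le_norm _ _).trans (mul_le_mul_of_nonneg_left
        (norm_sieveVec_le hD.le (fun j hj => abs_le_of_supNorm_le hD.le (hψ j hj).1) 1 z)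
        (norm_nonneg _))
    simp only [Nat.cast_one, Real.one_rpow, mul_one] at h1 h2 ⊢
    rw [abs_le] at *
    constructor <;> linarith [h1.1, h1.2, h2.1, h2.2]
  · obtain ⟨γ', hγ'⟩ := key J hJ
    refine ⟨γ', fun z => (hγ' z).trans ?_⟩
    have : 0 ≤ ‖γ‖ * (D * √(1 : ℕ)) := by positivity
    gcongr
    linarith

/-- The projections have uniformly bounded derivatives. -/
theorem exists_lipschitz_proj (hbasis : SieveBasis ρ θ₀ ψ αψ)
    (happrox : SieveApprox ρ θ₀ ψ F₀ s s₁) (hs₁ : 0 < s₁) (hF₀' : supNorm (deriv F₀) < ∞) :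
    ∃ A : ℝ, 0 < A ∧ ∀ J : ℕ, 1 ≤ J → ∀ z z', |inner ℝ (projCoef ρ θ₀ ψ J F₀)
      (sieveVec ψ J z - sieveVec ψ J z')| ≤ A * |z - z'| := by
  obtain ⟨A, hA, h⟩ := happrox.approx_deriv
  obtain ⟨D, hD, hF⟩ := exists_abs_le_of_supNorm_lt_top hF₀'
  refine ⟨A + D, by positivity, fun J hJ z z' => ?_⟩
  have e : ∀ z, proj ρ θ₀ ψ J F₀ z
      = ∑ i : Fin J, (projCoef ρ θ₀ ψ J F₀) i * ψ ((i : ℕ) + 1) z := fun z => by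
    unfold proj
    rw [real_inner_comm, inner_sieveVec]
  have hdiff : Differentiable ℝ (proj ρ θ₀ ψ J F₀) := by
    rw [show proj ρ θ₀ ψ J F₀ = _ from funext e]
    exact Differentiable.fun_sum fun i _ =>
      (hbasis.differentiable _ (Nat.le_add_left 1 i)).const_mul _
  have := Convex.norm_image_sub_le_of_norm_deriv_le (f := proj ρ θ₀ ψ J F₀) (C := A + D)
      (fun x _ => hdiff.differentiableAt) (fun x _ => ?_) convex_univ
      (Set.mem_univ z') (Set.mem_univ z)
  · rw [inner_sub_right]
    simpa only [proj, real_inner_comm, Real.norm_eq_abs] using this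
  · have h1 := abs_le_of_supNorm_le (by positivity) (h J hJ) x
    have h2 := hF x
    have h3 : (J : ℝ) ^ (-s₁) ≤ 1 :=
      Real.rpow_le_one_of_one_le_of_nonpos (by exact_mod_cast hJ) (by linarith)
    have h4 : A * (J : ℝ) ^ (-s₁) ≤ A := mul_le_of_le_one_right hA.le h3
    simp only [Pi.sub_apply] at h1
    rw [Real.norm_eq_abs]
    rw [abs_le] at *
    constructor <;> linarith [h1.1, h1.2, h2.1, h2.2]

variable [IsProbabilityMeasure ρ]

/-- The bias of the projection, and boundedness of the projections. -/
theorem exists_bias_bounds (hbasis : SieveBasis ρ θ₀ ψ αψ) (happrox : SieveApprox ρ θ₀ ψ F₀ s s₁)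
    (hs : 1 < s) (hF₀ : Measurable F₀) :
    ∃ A : ℝ, 0 < A ∧ ∀ J : ℕ, 1 ≤ J →
      ∫ w, (inner ℝ (projCoef ρ θ₀ ψ J F₀) (sieveVec ψ J (index θ₀ w)) - F₀ (index θ₀ w)) ^ 2 ∂ρ
        ≤ A * (J : ℝ) ^ (-(2 * s)) ∧
      ∀ z, |inner ℝ (projCoef ρ θ₀ ψ J F₀) (sieveVec ψ J z)| ≤ A := by
  obtain ⟨D, hD, hψ⟩ := hbasis.bounds
  obtain ⟨A, hA, hFA, happ⟩ := exists_sieve_approx hbasis happrox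
  obtain ⟨c, C, hc, hspec⟩ := hbasis.eigenvalues
  have hF : BddMeas F₀ := ⟨hF₀, A, hFA⟩
  refine ⟨A ^ 2 + 2 * A + A / √c * D, by positivity, fun J hJ => ?_⟩
  obtain ⟨γ, hγ⟩ := happ J hJ
  have hJ1 : (1 : ℝ) ≤ J := by exact_mod_cast hJ
  have hpy := projCoef_pythagoras hc hbasis.bddMeas (hspec J hJ) hF γ
  set b := projCoef ρ θ₀ ψ J F₀
  have hP := fun v : EuclideanSpace ℝ (Fin J) => bddMeas_inner_sieveVec hbasis.bddMeas θ₀ v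
  have hFi : BddMeas (fun w : Obs p => F₀ (index θ₀ w)) :=
    ⟨hF₀.comp (measurable_index θ₀), A, fun w => hFA _⟩
  have h1 : ∫ w, (inner ℝ γ (sieveVec ψ J (index θ₀ w)) - F₀ (index θ₀ w)) ^ 2 ∂ρ
      ≤ (A * (J : ℝ) ^ (-s)) ^ 2 := by
    calc _ ≤ ∫ _w, (A * (J : ℝ) ^ (-s)) ^ 2 ∂ρ := by
          refine integral_mono (((hP γ).sub hFi).pow 2).integrable (BddMeas.const _).integrable
            fun w => ?_
          simp only
          rw [← sq_abs]
          exact pow_le_pow_left₀ (abs_nonneg _) (hγ _) 2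
      _ = _ := by simp
  have e2 : (A * (J : ℝ) ^ (-s)) ^ 2 = A ^ 2 * (J : ℝ) ^ (-(2 * s)) := by
    rw [mul_pow, ← Real.rpow_natCast ((J : ℝ) ^ (-s)), ← Real.rpow_mul (by positivity)]
    congr 2; push_cast; ring
  constructor
  · have h2 : 0 ≤ c * ‖γ - b‖ ^ 2 := by positivity
    have h3 : 0 ≤ (2 * A + A / √c * D) * (J : ℝ) ^ (-(2 * s)) := by positivity
    linarith
  · intro z
    have h2 : c * ‖γ - b‖ ^ 2 ≤ (A * (J : ℝ) ^ (-s)) ^ 2 := by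
      have : 0 ≤ ∫ w, (inner ℝ b (sieveVec ψ J (index θ₀ w)) - F₀ (index θ₀ w)) ^ 2 ∂ρ :=
        integral_nonneg fun _ => sq_nonneg _
      linarith
    have h3 : ‖γ - b‖ ≤ A / √c * (J : ℝ) ^ (-s) := by
      refine (pow_le_pow_iff_left₀ (by positivity) (by positivity) two_ne_zero).1 ?_
      rw [show A / √c * (J : ℝ) ^ (-s) = A * (J : ℝ) ^ (-s) / √c by ring, div_pow,
        Real.sq_sqrt hc.le, le_div_iff₀ hc]
      linarith
    have h4 : ‖sieveVec ψ J z‖ ≤ D * √J :=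
      norm_sieveVec_le hD.le (fun j hj => abs_le_of_supNorm_le hD.le (hψ j hj).1) J z
    -- The projection is within O(J^{-s}) of the approximating coefficients γ, while the sieve
    -- vector grows like √J; as s > 1/2, the projections inherit a uniform bound from F₀.
    have h5 : (J : ℝ) ^ (-s) * √J ≤ 1 := by
      rw [Real.sqrt_eq_rpow, ← Real.rpow_add (by linarith)]
      exact Real.rpow_le_one_of_one_le_of_nonpos hJ1 (by linarith)
    have h6 : (J : ℝ) ^ (-s) ≤ 1 := Real.rpow_le_one_of_one_le_of_nonpos hJ1 (by linarith)
    have h7 : |inner ℝ (γ - b) (sieveVec ψ J z)| ≤ A / √c * D := by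
      refine (abs_real_inner_le_norm _ _).trans ?_
      calc _ ≤ (A / √c * (J : ℝ) ^ (-s)) * (D * √J) := by gcongr
        _ = A / √c * D * ((J : ℝ) ^ (-s) * √J) := by ring
        _ ≤ _ := mul_le_of_le_one_right (by positivity) h5
    have h8 := hγ z
    have h9 : A * (J : ℝ) ^ (-s) ≤ A := mul_le_of_le_one_right hA.le h6
    have h10 := hFA z
    rw [inner_sub_left] at h7
    have h11 := sq_nonneg A
    rw [abs_le] at *
    constructor <;> linarith [h7.1, h7.2, h8.1, h8.2, h10.1, h10.2]

/-- The plug-in error δ enters twice. For a general direction the sieve function is only Lipschitz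
with constant of order J^{α_ψ}√J‖v‖, which gives ϑ; the projection itself is Lipschitz uniformly in
J, so along b the error is just δ². -/
theorem exists_roundBounds (hmodel : IndexModel ρ F₀ θ₀) (hbasis : SieveBasis ρ θ₀ ψ αψ)
    (hαψ : 0 < αψ) (happrox : SieveApprox ρ θ₀ ψ F₀ s s₁) (hs₁ : 0 < s₁) (hs : 1 < s)
    (hF₀ : Measurable F₀) (hF₀' : supNorm (deriv F₀) < ∞)
    (hX : Integrable (fun w : Obs p => ‖w.2.1‖ ^ 2) ρ) (hκ : 4 ≤ κ)
    (hε : Integrable (fun w : Obs p => |noise F₀ θ₀ w| ^ κ) ρ) :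
    ∃ c C₀ : ℝ, 0 < c ∧ 1 ≤ C₀ ∧ ∀ (J : ℕ) (θ : EuclideanSpace ℝ (Fin p)) (δ η u lam Λ C : ℝ),
      1 ≤ J → ‖θ - θ₀‖ ≤ δ → C₀ ≤ C → 0 < η → 0 < u → 0 < lam → lam ≤ 1 → 1 ≤ Λ →
      C₀ * (J : ℝ) ^ (-(2 * s)) ≤ C * u → C₀ * δ ^ 2 ≤ C * u →
      C₀ * (Λ ^ (1 - κ) * √J) ≤ √(C * u) → η * (C₀ * √J) ^ 2 ≤ C * u → η * Λ ^ 2 ≤ lam ^ 2 →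
      u ≤ lam ^ 2 → 1 ≤ C₀ * √J * lam ^ 2 →
      RoundBounds ρ (fun w => sieveVec ψ J (index θ₀ w)) (fun w => sieveVec ψ J (index θ w))
        (fun w => F₀ (index θ₀ w)) (truncNoise F₀ θ₀ Λ) (projCoef ρ θ₀ ψ J F₀) c C
        (C₀ * ((J : ℝ) ^ αψ * √J * δ)) η u lam (C₀ * √J) Λ := by
  obtain ⟨D, hD, hψ⟩ := hbasis.bounds
  obtain ⟨A₁, hA₁, hFA, -⟩ := exists_sieve_approx hbasis happrox
  obtain ⟨A₂, hA₂, hLip⟩ := exists_lipschitz_proj hbasis happrox hs₁ hF₀'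
  obtain ⟨A₃, hA₃, hbias⟩ := exists_bias_bounds hbasis happrox hs hF₀
  obtain ⟨c, C₁, hc, hspec⟩ := hbasis.eigenvalues
  set E := ∫ w, ‖w.2.1‖ ^ 2 ∂ρ with hE
  have hE0 : 0 ≤ E := integral_nonneg fun _ => sq_nonneg _
  set M := ∫ w, |noise F₀ θ₀ w| ^ κ ∂ρ with hM
  have hM0 : 0 ≤ M := integral_nonneg fun _ => Real.rpow_nonneg (abs_nonneg _) _
  have hψb := fun (j : ℕ) (hj : 1 ≤ j) => abs_le_of_supNorm_le hD.le (hψ j hj).1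
  have hψd := fun (j : ℕ) (hj : 1 ≤ j) => abs_le_of_supNorm_le (by positivity) (hψ j hj).2
  have hJ' : ∀ (J : ℕ) z z', ‖sieveVec ψ J z - sieveVec ψ J z'‖ ≤ _ :=
    norm_sieveVec_sub_le hD.le hαψ.le hbasis.differentiable hψd
  have pE : 0 ≤ A₂ ^ 2 * E := by positivity
  have pM : 0 ≤ M * D := by positivity
  have pD : 0 ≤ D * √E := by positivity
  have pC := abs_nonneg C₁
  have pD0 := hD.le
  -- One constant that dominates every bound needed below, including the products of bounds that
  -- occur in the shift and noise terms.
  refine ⟨c, 1 + D + A₁ + A₂ ^ 2 * E + A₃ + |C₁| + M + M * D + D * √E, hc, by linarith, ?_⟩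
  set C₀ := 1 + D + A₁ + A₂ ^ 2 * E + A₃ + |C₁| + M + M * D + D * √E with hC₀
  intro J θ δ η u lam Λ C hJ hθ hC hη hu hlam hlam1 hΛ b1 b2 b3 b4 b5 b6 b7
  have hC₀1 : 1 ≤ C₀ := by linarith
  have hJ1 : (1 : ℝ) ≤ √J := Real.one_le_sqrt.2 (by exact_mod_cast hJ)
  have hδ : 0 ≤ δ := (norm_nonneg _).trans hθ
  have hcont := continuous_sieveVec hbasis.differentiable J
  have hnorm : ∀ z, ‖sieveVec ψ J z‖ ≤ C₀ * √J := fun z =>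
    (norm_sieveVec_le hD.le hψb J z).trans (by gcongr; linarith)
  have hgram := fun v => dotProduct_mulVec_bounds (gram_isHermitian J) (hspec J hJ) v
  have hsq : ∀ v : EuclideanSpace ℝ (Fin J), ∫ w, (inner ℝ v (sieveVec ψ J (index θ₀ w))) ^ 2 ∂ρ
      = v.ofLp ⬝ᵥ (gram ρ θ₀ ψ J *ᵥ v.ofLp) := fun v => by
    simpa only [sq] using integral_inner_mul_inner J hbasis.bddMeas v v
  have hind : ∀ w : Obs p, |index θ w - index θ₀ w| ^ 2 ≤ ‖w.2.1‖ ^ 2 * δ ^ 2 := by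
    intro w
    rw [← mul_pow]
    refine pow_le_pow_left₀ (abs_nonneg _) ((abs_index_sub_le θ θ₀ w).trans ?_) 2
    gcongr
  have hshift : ∀ (v : EuclideanSpace ℝ (Fin J)) (A : ℝ), (∀ z z',
      |inner ℝ v (sieveVec ψ J z - sieveVec ψ J z')| ≤ A * |z - z'|) →
      ∫ w, (inner ℝ v (sieveVec ψ J (index θ w) - sieveVec ψ J (index θ₀ w))) ^ 2 ∂ρ
        ≤ A ^ 2 * E * δ ^ 2 := by
    intro v A hv
    calc _ ≤ ∫ w, A ^ 2 * δ ^ 2 * ‖w.2.1‖ ^ 2 ∂ρ := by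
          refine integral_mono_of_nonneg (ae_of_all _ fun _ => sq_nonneg _) (hX.const_mul _)
            (ae_of_all _ fun w => ?_)
          simp only
          rw [← sq_abs]
          calc _ ≤ (A * |index θ w - index θ₀ w|) ^ 2 :=
                pow_le_pow_left₀ (abs_nonneg _) (hv _ _) 2
            _ = A ^ 2 * |index θ w - index θ₀ w| ^ 2 := by ring
            _ ≤ A ^ 2 * (‖w.2.1‖ ^ 2 * δ ^ 2) := by gcongr; exact hind w
            _ = _ := by ring
      _ = _ := by rw [integral_const_mul]; ring
  refine
    { measP := hcont.measurable.comp (measurable_index θ₀)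
      measQ := hcont.measurable.comp (measurable_index θ)
      measf := hF₀.comp (measurable_index θ₀)
      mease := measurable_truncNoise hF₀ Λ
      normP := fun w => hnorm _
      normQ := fun w => hnorm _
      f_le := fun w => (hFA _).trans (by linarith)
      bQ_le := fun w => ((hbias J hJ).2 _).trans (by linarith)
      e_le := abs_truncNoise_le (by linarith)
      gram_lower := fun v => by rw [hsq]; exact (hgram v).1
      gram_upper := fun v => by
        rw [hsq]
        refine (hgram v).2.trans ?_
        gcongr
        linarith [le_abs_self C₁]
      shift := fun v => ?_
      orth := fun v => projCoef_orth hc hbasis.bddMeas (hspec J hJ) ⟨hF₀, A₁, hFA⟩ v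
      bias := ?_
      shift_b := ?_
      e_four := ?_
      e_orth := fun v => ?_
      c_pos := hc
      one_le_C := hC₀1.trans hC
      ϑ_nonneg := by positivity
      η_pos := hη
      u_pos := hu
      lam_pos := hlam
      lam_le := hlam1
      one_le_L := one_le_mul_of_one_le_of_one_le hC₀1 hJ1
      one_le_Λ := hΛ
      ηL_le := b4
      ηΛ_le := b5
      u_le := b6
      one_le_Llam := b7 }
  · refine (hshift v (‖v‖ * (D * ((J : ℝ) ^ αψ * √J))) fun z z' => ?_).trans ?_
    · refine (abs_real_inner_le_norm _ _).trans ?_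
      calc _ ≤ ‖v‖ * (D * ((J : ℝ) ^ αψ * √J * |z - z'|)) := by gcongr; exact hJ' J z z'
        _ = _ := by ring
    · calc _ = ‖v‖ ^ 2 * ((D ^ 2 * E) * ((J : ℝ) ^ αψ * √J * δ) ^ 2) := by ring
        _ = ‖v‖ ^ 2 * ((D * √E) ^ 2 * ((J : ℝ) ^ αψ * √J * δ) ^ 2) := by
            rw [mul_pow D, Real.sq_sqrt hE0]
        _ ≤ ‖v‖ ^ 2 * (C₀ ^ 2 * ((J : ℝ) ^ αψ * √J * δ) ^ 2) := by gcongr; linarith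
        _ = _ := by ring
  · refine (hbias J hJ).1.trans (le_trans ?_ b1)
    gcongr
    linarith
  · refine (hshift _ A₂ (hLip J hJ)).trans (le_trans ?_ b2)
    gcongr
    linarith
  · calc ∫ w, truncNoise F₀ θ₀ Λ w ^ 4 ∂ρ ≤ ∫ w, 1 + |noise F₀ θ₀ w| ^ κ ∂ρ :=
          integral_mono_of_nonneg (ae_of_all _ fun _ => by positivity)
            ((integrable_const 1).add hε) (ae_of_all _ (truncNoise_pow_four_le hκ Λ))
      _ = 1 + M := by rw [integral_add (integrable_const 1) hε]; simp [hM]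
      _ ≤ C := by linarith
  · have hg : Measurable (fun x : ℝ × EuclideanSpace ℝ (Fin p) =>
        inner ℝ v (sieveVec ψ J (x.1 + inner ℝ x.2 θ))) :=
      measurable_const.inner (hcont.measurable.comp
        (measurable_fst.add (measurable_snd.inner measurable_const)))
    have := hmodel.abs_integral_truncNoise_mul_le hF₀ (by linarith) hε (by linarith : 0 < Λ) hg
      (A := ‖v‖ * (D * √J)) fun x => (abs_real_inner_le_norm _ _).trans
        (mul_le_mul_of_nonneg_left (norm_sieveVec_le hD.le hψb J _) (norm_nonneg _))
    refine this.trans ?_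
    calc _ = M * D * (Λ ^ (1 - κ) * √J) * ‖v‖ := by ring
      _ ≤ C₀ * (Λ ^ (1 - κ) * √J) * ‖v‖ := by gcongr; linarith
      _ ≤ _ := by gcongr

end OnlineSieve

/-! ### Powers of k: sieve dimension, learning rate and exponents -/

namespace OnlineSieve

theorem eventually_mul_rpow_le {a b : ℝ} (hab : a < b) (A : ℝ) {B : ℝ} (hB : 0 < B) :
    ∀ᶠ k : ℕ in atTop, A * ((k + 1 : ℕ) : ℝ) ^ a ≤ B * ((k + 1 : ℕ) : ℝ) ^ b := by
  have h1 : Tendsto (fun k : ℕ => ((k + 1 : ℕ) : ℝ) ^ (b - a)) atTop atTop :=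
    (tendsto_rpow_atTop (sub_pos.2 hab)).comp
      (tendsto_natCast_atTop_atTop.comp (tendsto_add_atTop_nat 1))
  filter_upwards [h1.eventually_ge_atTop (A / B)] with k hk
  have hx : (0 : ℝ) < ((k + 1 : ℕ) : ℝ) := by positivity
  rw [div_le_iff₀ hB] at hk
  calc A * ((k + 1 : ℕ) : ℝ) ^ a ≤ ((k + 1 : ℕ) : ℝ) ^ (b - a) * B * ((k + 1 : ℕ) : ℝ) ^ a := by
        gcongr
    _ = B * (((k + 1 : ℕ) : ℝ) ^ (b - a) * ((k + 1 : ℕ) : ℝ) ^ a) := by ring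
    _ = _ := by rw [← Real.rpow_add hx]; simp

theorem sieveDim_succ (J₀ : ℕ) (αJ : ℝ) (k : ℕ) :
    sieveDim J₀ αJ (k + 1) = ⌊(J₀ : ℝ) * ((k + 1 : ℕ) : ℝ) ^ αJ⌋₊ := by
  simp [sieveDim]

theorem sieveDim_le (J₀ : ℕ) (αJ : ℝ) (k : ℕ) :
    (sieveDim J₀ αJ (k + 1) : ℝ) ≤ J₀ * ((k + 1 : ℕ) : ℝ) ^ αJ := by
  rw [sieveDim_succ]
  exact Nat.floor_le (by positivity)

theorem le_sieveDim {J₀ : ℕ} (hJ₀ : 1 ≤ J₀) {αJ : ℝ} (hα : 0 ≤ αJ) (k : ℕ) :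
    1 ≤ sieveDim J₀ αJ (k + 1) ∧
      ((k + 1 : ℕ) : ℝ) ^ αJ / 2 ≤ (sieveDim J₀ αJ (k + 1) : ℝ) := by
  have h1 : (1 : ℝ) ≤ J₀ := by exact_mod_cast hJ₀
  have h2 : (1 : ℝ) ≤ ((k + 1 : ℕ) : ℝ) ^ αJ :=
    Real.one_le_rpow (by exact_mod_cast Nat.le_add_left 1 k) hα
  have h3 : ((k + 1 : ℕ) : ℝ) ^ αJ ≤ J₀ * ((k + 1 : ℕ) : ℝ) ^ αJ :=
    le_mul_of_one_le_left (by linarith) h1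
  rw [sieveDim_succ]
  have h4 : 1 ≤ ⌊(J₀ : ℝ) * ((k + 1 : ℕ) : ℝ) ^ αJ⌋₊ := Nat.le_floor (by push_cast at *; linarith)
  refine ⟨h4, ?_⟩
  have h5 := Nat.lt_floor_add_one ((J₀ : ℝ) * ((k + 1 : ℕ) : ℝ) ^ αJ)
  have h6 : (1 : ℝ) ≤ (⌊(J₀ : ℝ) * ((k + 1 : ℕ) : ℝ) ^ αJ⌋₊ : ℝ) := by exact_mod_cast h4
  linarith

theorem monotone_sieveDim (J₀ : ℕ) {αJ : ℝ} (hα : 0 ≤ αJ) (k : ℕ) :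
    sieveDim J₀ αJ k ≤ sieveDim J₀ αJ (k + 1) := by
  rcases k with _ | k
  · simp [sieveDim]
  · rw [sieveDim_succ, sieveDim_succ]
    apply Nat.floor_le_floor
    gcongr
    simp

theorem one_le_sieveDim {J₀ : ℕ} (hJ₀ : 1 ≤ J₀) {αJ : ℝ} (hα : 0 ≤ αJ) (k : ℕ) :
    1 ≤ sieveDim J₀ αJ k := by
  rcases k with _ | k
  · simpa [sieveDim] using hJ₀
  · exact (le_sieveDim hJ₀ hα k).1

theorem rpow_neg_natCast_le {a : ℝ} (ha : 0 ≤ a) {k : ℕ} (hk : 1 ≤ k) :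
    (k : ℝ) ^ (-a) ≤ 2 ^ a * ((k + 1 : ℕ) : ℝ) ^ (-a) := by
  have hk' : (1 : ℝ) ≤ k := by exact_mod_cast hk
  have h1 : ((k + 1 : ℕ) : ℝ) / 2 ≤ k := by push_cast; linarith
  calc (k : ℝ) ^ (-a) ≤ (((k + 1 : ℕ) : ℝ) / 2) ^ (-a) :=
        Real.rpow_le_rpow_of_nonpos (by positivity) h1 (by linarith)
    _ = _ := by
      rw [Real.div_rpow (by positivity) (by norm_num), Real.rpow_neg (by norm_num : (0:ℝ) ≤ 2),
        div_inv_eq_mul, mul_comm]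

/-- The level k^{-a} falls by a relative amount O(1/k) per round, which is less than the contraction
η because α_η < 1. The proof uses (x/k)^a ≤ x/k ≤ 1 + 2/x with x = k + 1. -/
theorem rpow_neg_sub_le {a : ℝ} (ha1 : a ≤ 1) {k : ℕ} (hk : 1 ≤ k) :
    (k : ℝ) ^ (-a) - ((k + 1 : ℕ) : ℝ) ^ (-a) ≤ 2 * ((k + 1 : ℕ) : ℝ) ^ (-a - 1) := by
  have hk' : (1 : ℝ) ≤ k := by exact_mod_cast hk
  have hx : (0 : ℝ) < ((k + 1 : ℕ) : ℝ) := by positivity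
  set x : ℝ := ((k + 1 : ℕ) : ℝ) with hxd
  have hxk : x = k + 1 := by rw [hxd]; push_cast; ring
  have h1 : (x / k) ^ a ≤ x / k := by
    have : 1 ≤ x / k := by rw [le_div_iff₀ (by linarith)]; linarith
    simpa using Real.rpow_le_rpow_of_exponent_le this ha1
  have h2 : x / k ≤ 1 + 2 / x := by
    rw [div_le_iff₀ (by linarith), hxk, add_mul, one_mul, div_mul_eq_mul_div]
    have : 1 ≤ 2 * (k : ℝ) / (k + 1) := by rw [le_div_iff₀ (by linarith)]; linarith
    linarith
  have h3 : (k : ℝ) ^ (-a) = x ^ (-a) * (x / k) ^ a := by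
    rw [Real.div_rpow hx.le (by linarith), Real.rpow_neg hx.le, Real.rpow_neg (by linarith)]
    field_simp
  have h4 : 0 ≤ x ^ (-a) := by positivity
  rw [h3, Real.rpow_sub_one hx.ne']
  calc _ ≤ x ^ (-a) * (1 + 2 / x) - x ^ (-a) := by gcongr; linarith
    _ = _ := by ring

/-- The relations between the exponents which the argument uses: `γ` is the exponent of the target
rate of the risk, `ϕ` that of the plug-in estimator, `τ` that of the truncation level and `ι` a
small gain. -/
structure Exponents (αη αJ αψ s κ γ ϕ τ ι : ℝ) : Prop where
  αJ_pos : 0 < αJ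
  αψ_pos : 0 < αψ
  γ_eq : γ = αη - αJ
  γ_pos : 0 < γ
  γ_le : γ ≤ 1
  s_pos : 0 < s
  γ_le_s : γ ≤ αJ * (2 * s)
  ϕ_pos : 0 < ϕ
  γ_le_ϕ : γ ≤ 2 * ϕ
  ϕ_gt : αJ * (αψ + 1 / 2) < ϕ
  τ_pos : 0 < τ
  τκ : αη ≤ 2 * τ * (κ - 1)
  ι_pos : 0 < ι
  ι_γ : 2 * ι ≤ γ
  ι_τ : 2 * ι < αη - 2 * τ
  ι_J : 4 * ι < αJ
  ι_η : ι < 1 - αη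

section Params

variable {αη αJ αψ s κ γ ϕ τ ι : ℝ}

/-- These inequalities hold from round 2 on once C is large. They are kept apart from the eventual
ones since C must be fixed first: the thresholds ϑ₀ and K of the contraction depend on it. -/
theorem Exponents.static_conditions (h : Exponents αη αJ αψ s κ γ ϕ τ ι) {η₀ : ℝ} (hη₀ : 0 < η₀)
    {J₀ : ℕ} (hJ₀ : 1 ≤ J₀) (C₀ : ℝ) (hC₀ : 1 ≤ C₀) :
    ∃ C, C₀ ≤ C ∧ ∀ k : ℕ, 1 ≤ k →
      C₀ * (sieveDim J₀ αJ (k + 1) : ℝ) ^ (-(2 * s)) ≤ C * ((k + 1 : ℕ) : ℝ) ^ (-γ) ∧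
      C₀ * ((k : ℝ) ^ (-ϕ)) ^ 2 ≤ C * ((k + 1 : ℕ) : ℝ) ^ (-γ) ∧
      C₀ * ((((k + 1 : ℕ) : ℝ) ^ τ) ^ (1 - κ) * √(sieveDim J₀ αJ (k + 1)))
        ≤ √(C * ((k + 1 : ℕ) : ℝ) ^ (-γ)) ∧
      learnRate η₀ αη (k + 1) * (C₀ * √(sieveDim J₀ αJ (k + 1))) ^ 2
        ≤ C * ((k + 1 : ℕ) : ℝ) ^ (-γ) := by
  have hJ₀' : (1 : ℝ) ≤ J₀ := by exact_mod_cast hJ₀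
  have w1 : 0 ≤ C₀ * 2 ^ (2 * s) := by positivity
  have w2 : 0 ≤ C₀ * (2 ^ ϕ) ^ 2 := by positivity
  have w3 : 0 ≤ C₀ ^ 2 * J₀ := by positivity
  have w4 : 0 ≤ η₀ * C₀ ^ 2 * J₀ := by positivity
  refine ⟨C₀ + C₀ * 2 ^ (2 * s) + C₀ * (2 ^ ϕ) ^ 2 + C₀ ^ 2 * J₀ + η₀ * C₀ ^ 2 * J₀,
    by linarith, fun k hk => ?_⟩
  set C := C₀ + C₀ * 2 ^ (2 * s) + C₀ * (2 ^ ϕ) ^ 2 + C₀ ^ 2 * J₀ + η₀ * C₀ ^ 2 * J₀ with hC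
  have hx1 : (1 : ℝ) ≤ ((k + 1 : ℕ) : ℝ) := by exact_mod_cast Nat.le_add_left 1 k
  obtain ⟨hJ1, hJlow⟩ := le_sieveDim hJ₀ h.αJ_pos.le k
  have hJup := sieveDim_le J₀ αJ k
  have hδ := rpow_neg_natCast_le h.ϕ_pos.le hk
  generalize hJe : (sieveDim J₀ αJ (k + 1) : ℝ) = J at *
  have hηe : learnRate η₀ αη (k + 1) = η₀ * ((k + 1 : ℕ) : ℝ) ^ (-αη) := rfl
  rw [hηe]
  generalize ((k + 1 : ℕ) : ℝ) = x at *
  have hx0 : 0 < x := by linarith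
  have hJ0 : 0 ≤ J := le_trans (by positivity) hJlow
  have hu : 0 < x ^ (-γ) := by positivity
  refine ⟨?_, ?_, ?_, ?_⟩
  · have h1 : J ^ (-(2 * s)) ≤ 2 ^ (2 * s) * x ^ (-γ) := by
      calc J ^ (-(2 * s)) ≤ (x ^ αJ / 2) ^ (-(2 * s)) :=
            Real.rpow_le_rpow_of_nonpos (by positivity) hJlow (by linarith [h.s_pos])
        _ = 2 ^ (2 * s) * x ^ (-(αJ * (2 * s))) := by
            rw [Real.div_rpow (by positivity) (by norm_num),
              Real.rpow_neg (by norm_num : (0:ℝ) ≤ 2), div_inv_eq_mul, mul_comm,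
              ← Real.rpow_mul hx0.le, mul_neg]
        _ ≤ _ := by
            gcongr
            exact h.γ_le_s
    calc _ ≤ C₀ * (2 ^ (2 * s) * x ^ (-γ)) := by gcongr
      _ = C₀ * 2 ^ (2 * s) * x ^ (-γ) := by ring
      _ ≤ _ := by gcongr; linarith
  · calc _ ≤ C₀ * (2 ^ ϕ * x ^ (-ϕ)) ^ 2 := by gcongr
      _ = C₀ * (2 ^ ϕ) ^ 2 * x ^ (-(2 * ϕ)) := by
          rw [mul_pow, ← Real.rpow_natCast (x ^ (-ϕ)), ← Real.rpow_mul hx0.le]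
          push_cast
          rw [show -ϕ * 2 = -(2 * ϕ) by ring]
          ring
      _ ≤ C₀ * (2 ^ ϕ) ^ 2 * x ^ (-γ) := by
          gcongr
          exact h.γ_le_ϕ
      _ ≤ _ := by gcongr; linarith
  · apply Real.le_sqrt_of_sq_le
    calc (C₀ * ((x ^ τ) ^ (1 - κ) * √J)) ^ 2 = C₀ ^ 2 * ((x ^ τ) ^ (1 - κ)) ^ 2 * J := by
          rw [mul_pow, mul_pow, Real.sq_sqrt hJ0]; ring
      _ ≤ C₀ ^ 2 * ((x ^ τ) ^ (1 - κ)) ^ 2 * (J₀ * x ^ αJ) := by gcongr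
      _ = C₀ ^ 2 * J₀ * x ^ (2 * τ * (1 - κ) + αJ) := by
          rw [← Real.rpow_mul hx0.le, ← Real.rpow_natCast (x ^ (τ * (1 - κ))),
            ← Real.rpow_mul hx0.le, Real.rpow_add hx0]
          push_cast
          rw [show τ * (1 - κ) * 2 = 2 * τ * (1 - κ) by ring]
          ring
      _ ≤ C₀ ^ 2 * J₀ * x ^ (-γ) := by
          gcongr
          rw [h.γ_eq]; linarith [h.τκ]
      _ ≤ _ := by gcongr; linarith
  · calc _ = η₀ * x ^ (-αη) * C₀ ^ 2 * J := by rw [mul_pow, Real.sq_sqrt hJ0]; ring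
      _ ≤ η₀ * x ^ (-αη) * C₀ ^ 2 * (J₀ * x ^ αJ) := by gcongr
      _ = η₀ * C₀ ^ 2 * J₀ * x ^ (-γ) := by
          rw [h.γ_eq, show -(αη - αJ) = -αη + αJ by ring, Real.rpow_add hx0]; ring
      _ ≤ _ := by gcongr; linarith

/-- Every inequality compares two powers of k with strictly ordered exponents, or is implied by such
a comparison, so it holds for large k whatever ϑ₀ and K are. -/
theorem Exponents.eventual_conditions (h : Exponents αη αJ αψ s κ γ ϕ τ ι) {η₀ : ℝ} (hη₀ : 0 < η₀)
    {J₀ : ℕ} (hJ₀ : 1 ≤ J₀) (C₀ : ℝ) (hC₀ : 1 ≤ C₀) {ϑ₀ : ℝ} (hϑ₀ : 0 < ϑ₀) (K : ℝ) :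
    ∀ᶠ k : ℕ in atTop, 1 ≤ k ∧
      learnRate η₀ αη (k + 1) * (((k + 1 : ℕ) : ℝ) ^ τ) ^ 2 ≤ (((k + 1 : ℕ) : ℝ) ^ (-ι)) ^ 2 ∧
      ((k + 1 : ℕ) : ℝ) ^ (-γ) ≤ (((k + 1 : ℕ) : ℝ) ^ (-ι)) ^ 2 ∧
      1 ≤ C₀ * √(sieveDim J₀ αJ (k + 1)) * (((k + 1 : ℕ) : ℝ) ^ (-ι)) ^ 2 ∧
      C₀ * ((sieveDim J₀ αJ (k + 1) : ℝ) ^ αψ * √(sieveDim J₀ αJ (k + 1)) * (k : ℝ) ^ (-ϕ)) ≤ ϑ₀ ∧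
      ((k + 1 : ℕ) : ℝ) ^ (-ι) ≤ ϑ₀ ∧
      K * ((k : ℝ) ^ (-γ) - ((k + 1 : ℕ) : ℝ) ^ (-γ))
        ≤ learnRate η₀ αη (k + 1) * ((k + 1 : ℕ) : ℝ) ^ (-ι) * ((k + 1 : ℕ) : ℝ) ^ (-γ) := by
  have hι := h.ι_pos
  filter_upwards [eventually_ge_atTop 1,
    eventually_mul_rpow_le (show -αη + 2 * τ < -(2 * ι) by linarith [h.ι_τ]) η₀ one_pos,
    eventually_mul_rpow_le (show 4 * ι < αJ from h.ι_J) 1 (show (0:ℝ) < 1 / 2 by norm_num),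
    eventually_mul_rpow_le (show αJ * (αψ + 1 / 2) - ϕ < 0 by linarith [h.ϕ_gt])
      (C₀ * (J₀ : ℝ) ^ (αψ + 1 / 2) * 2 ^ ϕ) hϑ₀,
    eventually_mul_rpow_le (show -ι < 0 by linarith) 1 hϑ₀,
    eventually_mul_rpow_le (show -γ - 1 < -αη - ι - γ by linarith [h.ι_η]) (2 * |K|) hη₀]
    with k hk c1 c2 c3 c4 c5
  have hx1 : (1 : ℝ) ≤ ((k + 1 : ℕ) : ℝ) := by exact_mod_cast Nat.le_add_left 1 k
  obtain ⟨hJ1, hJlow⟩ := le_sieveDim hJ₀ h.αJ_pos.le k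
  have hJup := sieveDim_le J₀ αJ k
  have hδ := rpow_neg_natCast_le h.ϕ_pos.le hk
  have hγd := rpow_neg_sub_le h.γ_le hk
  have hkx : 0 ≤ (k : ℝ) ^ (-γ) - ((k + 1 : ℕ) : ℝ) ^ (-γ) :=
    sub_nonneg.2 (Real.rpow_le_rpow_of_nonpos (by exact_mod_cast hk) (by push_cast; linarith)
      (by linarith [h.γ_pos]))
  generalize hJe : (sieveDim J₀ αJ (k + 1) : ℝ) = J at *
  have hηe : learnRate η₀ αη (k + 1) = η₀ * ((k + 1 : ℕ) : ℝ) ^ (-αη) := rfl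
  rw [hηe]
  generalize ((k + 1 : ℕ) : ℝ) = x at *
  have hx0 : 0 < x := by linarith
  have hJ0 : 0 < J := lt_of_lt_of_le (by positivity) hJlow
  have e1 : (x ^ (-ι)) ^ 2 = x ^ (-(2 * ι)) := by
    rw [← Real.rpow_natCast, ← Real.rpow_mul hx0.le]
    congr 1; push_cast; ring
  rw [e1]
  simp only [Real.rpow_zero, mul_one, one_mul] at c1 c2 c3 c4
  refine ⟨hk, ?_, ?_, ?_, ?_, c4, ?_⟩
  · refine le_trans (le_of_eq ?_) c1
    rw [← Real.rpow_natCast (x ^ τ), ← Real.rpow_mul hx0.le, mul_assoc, ← Real.rpow_add hx0]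
    congr 2; push_cast; ring
  · exact Real.rpow_le_rpow_of_exponent_le hx1 (by linarith [h.ι_γ])
  · have h1 : x ^ (2 * ι) ≤ √J := by
      apply Real.le_sqrt_of_sq_le
      rw [← Real.rpow_natCast, ← Real.rpow_mul hx0.le]
      push_cast
      rw [show 2 * ι * 2 = 4 * ι by ring]
      linarith
    calc (1 : ℝ) = 1 * x ^ (2 * ι) * x ^ (-(2 * ι)) := by
          rw [one_mul, ← Real.rpow_add hx0]; simp
      _ ≤ _ := by gcongr
  · refine le_trans ?_ c3
    have e2 : J ^ αψ * √J = J ^ (αψ + 1 / 2) := by rw [Real.sqrt_eq_rpow, Real.rpow_add hJ0]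
    rw [e2]
    have hψ := h.αψ_pos
    calc C₀ * (J ^ (αψ + 1 / 2) * (k : ℝ) ^ (-ϕ))
        ≤ C₀ * ((J₀ * x ^ αJ) ^ (αψ + 1 / 2) * (2 ^ ϕ * x ^ (-ϕ))) := by gcongr
      _ = _ := by
        rw [Real.mul_rpow (by positivity) (by positivity), ← Real.rpow_mul hx0.le,
          sub_eq_add_neg, Real.rpow_add hx0]
        ring
  · have e3 : η₀ * x ^ (-αη) * x ^ (-ι) * x ^ (-γ) = η₀ * x ^ (-αη - ι - γ) := by
      rw [sub_eq_add_neg, sub_eq_add_neg, Real.rpow_add hx0, Real.rpow_add hx0]; ring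
    rw [e3]
    refine le_trans ?_ c5
    calc _ ≤ |K| * ((k : ℝ) ^ (-γ) - x ^ (-γ)) := by gcongr; exact le_abs_self K
      _ ≤ |K| * (2 * x ^ (-γ - 1)) := by gcongr
      _ = _ := by ring

end Params
end OnlineSieve

/-! ### Contraction along the tuning sequences, and the scalar recursion -/

namespace OnlineSieve

/-- The risk of the sieve function with coefficient vector `a`. -/
noncomputable def indexRisk {p : ℕ} (ρ : Measure (Obs p)) (θ₀ : EuclideanSpace ℝ (Fin p))
    (ψ : ℕ → ℝ → ℝ) (F₀ : ℝ → ℝ) {J : ℕ} (a : EuclideanSpace ℝ (Fin J)) : ℝ :=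
  sieveRisk ρ (fun w => sieveVec ψ J (index θ₀ w)) (fun w => F₀ (index θ₀ w)) a

/-- The coefficient vector after an update with the single observation `w`, whose noise is
truncated at `Λ`. -/
noncomputable def truncUpdate {p : ℕ} (F₀ : ℝ → ℝ) (θ₀ : EuclideanSpace ℝ (Fin p)) (ψ : ℕ → ℝ → ℝ)
    {J : ℕ} (η Λ : ℝ) (θ : EuclideanSpace ℝ (Fin p)) (a : EuclideanSpace ℝ (Fin J)) (w : Obs p) :
    EuclideanSpace ℝ (Fin J) :=
  a + (η * (truncNoise F₀ θ₀ Λ w + F₀ (index θ₀ w) - inner ℝ a (sieveVec ψ J (index θ w))))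
    • sieveVec ψ J (index θ w)

section

variable {p : ℕ} {ρ : Measure (Obs p)} [IsProbabilityMeasure ρ] {θ₀ : EuclideanSpace ℝ (Fin p)}
  {ψ : ℕ → ℝ → ℝ} {F₀ : ℝ → ℝ} {s s₁ αη αJ αψ κ γ ϕ τ ι : ℝ}

/-- The contraction with u = (k+1)^{-γ}, u' = k^{-γ}, lam = (k+1)^{-ι}, Λ = (k+1)^τ and plug-in
radius k^{-ϕ}. Values in [0, ∞] spare any integrability claim about the iterates. -/
theorem exists_eventual_contraction (hmodel : IndexModel ρ F₀ θ₀) (hbasis : SieveBasis ρ θ₀ ψ αψ)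
    (happrox : SieveApprox ρ θ₀ ψ F₀ s s₁) (hs₁ : 0 < s₁) (hs : 1 < s)
    (hF₀ : Measurable F₀) (hF₀' : supNorm (deriv F₀) < ∞)
    (hX : Integrable (fun w : Obs p => ‖w.2.1‖ ^ 2) ρ) (hκ : 4 ≤ κ)
    (hε : Integrable (fun w : Obs p => |noise F₀ θ₀ w| ^ κ) ρ)
    (hexp : Exponents αη αJ αψ s κ γ ϕ τ ι) {η₀ : ℝ} (hη₀ : 0 < η₀) {J₀ : ℕ} (hJ₀ : 1 ≤ J₀)
    (n : ℕ) (hn : Even n) :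
    ∃ K c₂ C₂ : ℝ, 1 ≤ K ∧ 0 < c₂ ∧ 0 ≤ C₂ ∧ ∀ᶠ k : ℕ in atTop,
      ∀ θ : EuclideanSpace ℝ (Fin p), ‖θ - θ₀‖ ≤ (k : ℝ) ^ (-ϕ) →
      ∀ a : EuclideanSpace ℝ (Fin (sieveDim J₀ αJ (k + 1))),
        ∫⁻ w, ENNReal.ofReal ((max (indexRisk ρ θ₀ ψ F₀
            (truncUpdate F₀ θ₀ ψ (learnRate η₀ αη (k + 1)) (((k + 1 : ℕ) : ℝ) ^ τ) θ a w)
            - K * ((k + 1 : ℕ) : ℝ) ^ (-γ)) 0) ^ (n + 2)) ∂ρ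
          ≤ ENNReal.ofReal (1 - c₂ * learnRate η₀ αη (k + 1))
              * ENNReal.ofReal ((max (indexRisk ρ θ₀ ψ F₀ a - K * (k : ℝ) ^ (-γ)) 0) ^ (n + 2))
            + ENNReal.ofReal (C₂ * learnRate η₀ αη (k + 1)
              * ((k + 1 : ℕ) : ℝ) ^ (-((ι + γ) * (n + 2 : ℕ)))) := by
  obtain ⟨c, C₀, hc, hC₀, hround⟩ := exists_roundBounds hmodel hbasis hexp.αψ_pos happrox hs₁ hs hF₀
    hF₀' hX hκ hε
  obtain ⟨C, hC, hstat⟩ := hexp.static_conditions hη₀ hJ₀ C₀ hC₀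
  obtain ⟨ϑ₀, K, c₂, C₂, hϑ₀, hK, hc₂, hC₂, hcontr⟩ :=
    exists_excess_contraction c C hc (hC₀.trans hC) n hn
  refine ⟨K, c₂, C₂, hK, hc₂, hC₂, ?_⟩
  filter_upwards [hexp.eventual_conditions hη₀ hJ₀ C₀ hC₀ hϑ₀ K] with k hk θ hθ a
  obtain ⟨hk1, d1, d2, d3, d4, d5, d6⟩ := hk
  obtain ⟨e1, e2, e3, e4⟩ := hstat k hk1
  have hx1 : (1 : ℝ) ≤ ((k + 1 : ℕ) : ℝ) := by exact_mod_cast Nat.le_add_left 1 k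
  have hx0 : (0 : ℝ) < ((k + 1 : ℕ) : ℝ) := by positivity
  have hη : 0 < learnRate η₀ αη (k + 1) := by unfold learnRate; positivity
  have hlam1 : ((k + 1 : ℕ) : ℝ) ^ (-ι) ≤ 1 :=
    Real.rpow_le_one_of_one_le_of_nonpos hx1 (by linarith [hexp.ι_pos])
  have hR := hround _ θ _ _ _ (((k + 1 : ℕ) : ℝ) ^ (-ι)) (((k + 1 : ℕ) : ℝ) ^ τ) C
    (le_sieveDim hJ₀ hexp.αJ_pos.le k).1 hθ hC hη (by positivity) (by positivity) hlam1
    (Real.one_le_rpow hx1 hexp.τ_pos.le) e1 e2 e3 e4 d1 d2 d3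
  have hmono : ((k + 1 : ℕ) : ℝ) ^ (-γ) ≤ (k : ℝ) ^ (-γ) :=
    Real.rpow_le_rpow_of_nonpos (by exact_mod_cast hk1) (by push_cast; linarith)
      (by linarith [hexp.γ_pos])
  obtain ⟨hint, hle⟩ := hcontr hR d4 d5 hmono d6 a
  rw [← Real.rpow_add hx0, ← Real.rpow_natCast (((k + 1 : ℕ) : ℝ) ^ (-ι + -γ)),
    ← Real.rpow_mul hx0.le] at hle
  have hint' := ofReal_integral_eq_lintegral_ofReal hint
    (ae_of_all _ fun w => pow_nonneg (le_max_right _ _) _)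
  refine le_trans (le_of_eq hint'.symm) ((ENNReal.ofReal_le_ofReal hle).trans ?_)
  refine ENNReal.ofReal_add_le.trans ?_
  -- Nonnegativity of the power is enough; 1 - c₂η need not be nonnegative.
  rw [ENNReal.ofReal_mul' (pow_nonneg (le_max_right _ _) _)]
  refine add_le_add le_rfl (le_of_eq ?_)
  congr 3
  ring

end

/-- From k to k + 1 the bound k^{-a} shrinks by a factor at least 1 - a/(k+1), by Bernoulli's
inequality, whereas the recursion contracts by 1 - cη with η much larger than 1/k. Half of the
contraction pays for the shrinking bound and half for the forcing term. -/
theorem eventually_recursion_bound {η₀ αη c C a : ℝ} (hη₀ : 0 < η₀) (hα0 : 0 < αη) (hα : αη < 1)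
    (hc : 0 < c) (hC : 0 ≤ C) (ha : 1 ≤ a) :
    ∀ᶠ k₀ : ℕ in atTop, ∀ x : ℕ → ℝ≥0∞, x k₀ ≠ ∞ →
      (∀ k, k₀ ≤ k → x (k + 1) ≤ ENNReal.ofReal (1 - c * learnRate η₀ αη (k + 1)) * x k
        + ENNReal.ofReal (C * learnRate η₀ αη (k + 1) * ((k + 1 : ℕ) : ℝ) ^ (-a))) →
      ∃ M : ℝ, 0 ≤ M ∧ ∀ k, k₀ ≤ k → x k ≤ ENNReal.ofReal (M * (k : ℝ) ^ (-a)) := by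
  have h1 := eventually_mul_rpow_le (show -1 < -αη by linarith) a
    (show 0 < c * η₀ / 2 by positivity)
  have h2 := eventually_mul_rpow_le (show -αη < 0 by linarith) (c * η₀) one_pos
  obtain ⟨k₁, hk₁⟩ := eventually_atTop.1 (h1.and h2)
  filter_upwards [eventually_ge_atTop k₁, eventually_ge_atTop 1] with k₀ hk₀ hk₀1 x hx hrec
  have hk₀' : (0 : ℝ) < k₀ := by exact_mod_cast hk₀1
  -- The first summand makes C ≤ M c/2, the half reserved for the forcing; the second starts the
  -- induction at k₀.
  set M := 2 * C / c + (x k₀).toReal * (k₀ : ℝ) ^ a with hM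
  have hM0 : 0 ≤ M := by positivity
  refine ⟨M, hM0, fun k hk => ?_⟩
  induction k, hk using Nat.le_induction with
  | base =>
    rw [← ENNReal.ofReal_toReal hx]
    apply ENNReal.ofReal_le_ofReal
    have : M * (k₀ : ℝ) ^ (-a) = 2 * C / c * (k₀ : ℝ) ^ (-a) + (x k₀).toReal := by
      rw [hM, add_mul, mul_assoc _ _ ((k₀ : ℝ) ^ (-a)), ← Real.rpow_add hk₀']; simp
    rw [this]
    have : 0 ≤ 2 * C / c * (k₀ : ℝ) ^ (-a) := by positivity
    linarith
  | succ k hk ih =>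
    obtain ⟨g1, g2⟩ := hk₁ k (hk₀.trans hk)
    have hk' : (1 : ℝ) ≤ k := by exact_mod_cast hk₀1.trans hk
    have hη : learnRate η₀ αη (k + 1) = η₀ * ((k + 1 : ℕ) : ℝ) ^ (-αη) := rfl
    have hηpos : 0 < learnRate η₀ αη (k + 1) := by rw [hη]; positivity
    have hxpos : (0 : ℝ) < ((k + 1 : ℕ) : ℝ) := by positivity
    have g1' : a / ((k + 1 : ℕ) : ℝ) ≤ c / 2 * learnRate η₀ αη (k + 1) := by
      rw [hη, div_eq_mul_inv, ← Real.rpow_neg_one]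
      calc _ ≤ _ := g1
        _ = _ := by ring
    have g2' : c * learnRate η₀ αη (k + 1) ≤ 1 := by
      rw [hη]
      simp only [Real.rpow_zero, mul_one] at g2
      linarith
    set e := learnRate η₀ αη (k + 1)
    set y : ℝ := ((k + 1 : ℕ) : ℝ) with hy
    have hyk : y = k + 1 := by rw [hy]; push_cast; ring
    have hr : 1 - a / y ≤ (k / y) ^ a := by
      have h3 := one_add_mul_self_le_rpow_one_add (s := -(1 / y)) (p := a) (by
        rw [neg_le_neg_iff, div_le_one hxpos]; linarith) ha
      have h4 : 1 + -(1 / y) = k / y := by field_simp; linarith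
      rw [h4] at h3
      calc 1 - a / y = 1 + a * -(1 / y) := by ring
        _ ≤ _ := h3
    have hya : y ^ (-a) = (k : ℝ) ^ (-a) * (k / y) ^ a := by
      rw [Real.div_rpow (by linarith) hxpos.le, Real.rpow_neg hxpos.le, Real.rpow_neg (by linarith)]
      field_simp
    have hr1 : (k / y) ^ a ≤ 1 := by
      apply Real.rpow_le_one (by positivity) _ (by linarith)
      rw [div_le_one hxpos]; linarith
    refine (hrec k hk).trans ?_
    calc _ ≤ ENNReal.ofReal (1 - c * e) * ENNReal.ofReal (M * (k : ℝ) ^ (-a))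
          + ENNReal.ofReal (C * e * y ^ (-a)) := by gcongr
      _ = ENNReal.ofReal ((1 - c * e) * (M * (k : ℝ) ^ (-a)) + C * e * y ^ (-a)) := by
          rw [← ENNReal.ofReal_mul (by linarith), ENNReal.ofReal_add]
          · exact mul_nonneg (by linarith) (by positivity)
          · positivity
      _ ≤ _ := by
        apply ENNReal.ofReal_le_ofReal
        have hCM : C ≤ M * (c / 2) := by
          have : 2 * C / c ≤ M := by
            rw [hM]
            have : 0 ≤ (x k₀).toReal * (k₀ : ℝ) ^ a := by positivity
            linarith
          rw [div_le_iff₀ hc] at this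
          linarith
        have hkey : (1 - c * e) * M + C * e * (k / y) ^ a ≤ M * (k / y) ^ a := by
          have h5 : C * e * (k / y) ^ a ≤ C * e := mul_le_of_le_one_right (by positivity) hr1
          have h6 : M * (1 - a / y) ≤ M * (k / y) ^ a := by gcongr
          have h7 : M * (a / y) ≤ M * (c / 2 * e) := by gcongr
          have h8 : C * e ≤ M * (c / 2) * e := by gcongr
          linarith
        have hk0 : 0 ≤ (k : ℝ) ^ (-a) := by positivity
        rw [hya]
        have := mul_le_mul_of_nonneg_left hkey hk0
        linarith

end OnlineSieve

/-! ### Padding, convexity, and independence of a fresh observation from the past -/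

namespace OnlineSieve

theorem inner_pad_sieveVec (ψ : ℕ → ℝ → ℝ) {m n : ℕ} (hmn : m ≤ n) (a : EuclideanSpace ℝ (Fin m))
    (z : ℝ) : inner ℝ (pad n a) (sieveVec ψ n z) = inner ℝ a (sieveVec ψ m z) := by
  obtain ⟨d, rfl⟩ := Nat.exists_eq_add_of_le hmn
  rw [inner_sieveVec, inner_sieveVec, Fin.sum_univ_add]
  simp [pad]

theorem indexRisk_pad {p : ℕ} (ρ : Measure (Obs p)) (θ₀ : EuclideanSpace ℝ (Fin p))
    (ψ : ℕ → ℝ → ℝ) (F₀ : ℝ → ℝ) {m n : ℕ} (hmn : m ≤ n) (a : EuclideanSpace ℝ (Fin m)) :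
    indexRisk ρ θ₀ ψ F₀ (pad n a) = indexRisk ρ θ₀ ψ F₀ a := by
  unfold indexRisk sieveRisk
  simp only [inner_pad_sieveVec ψ hmn]

theorem measurable_pad {m n : ℕ} :
    Measurable (pad n : EuclideanSpace ℝ (Fin m) → EuclideanSpace ℝ (Fin n)) := by
  unfold pad
  refine (PiLp.continuous_toLp 2 _).measurable.comp (measurable_pi_lambda _ fun i => ?_)
  by_cases h : (i : ℕ) < m
  · simp only [h, dite_true]
    fun_prop
  · simp only [h, dite_false]
    exact measurable_const

section Risk

variable {p : ℕ} {ρ : Measure (Obs p)} [IsProbabilityMeasure ρ] {θ₀ : EuclideanSpace ℝ (Fin p)}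
  {ψ : ℕ → ℝ → ℝ} {F₀ : ℝ → ℝ}

theorem measurable_indexRisk (hd : ∀ j, 1 ≤ j → Differentiable ℝ (ψ j)) (hF : Measurable F₀)
    (J : ℕ) : Measurable (indexRisk ρ θ₀ ψ F₀ (J := J)) :=
  measurable_sieveRisk ρ ((continuous_sieveVec hd J).measurable.comp (measurable_index θ₀))
    (hF.comp (measurable_index θ₀))

theorem convexOn_indexRisk (hψ : ∀ j, 1 ≤ j → BddMeas (ψ j)) (hF : BddMeas F₀) (J : ℕ) :
    ConvexOn ℝ Set.univ (indexRisk ρ θ₀ ψ F₀ (J := J)) := by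
  refine ⟨convex_univ, fun x _ y _ a b ha hb hab => ?_⟩
  have hFi : BddMeas (fun w : Obs p => F₀ (index θ₀ w)) :=
    ⟨hF.1.comp (measurable_index θ₀), hF.2.imp fun A hA w => hA _⟩
  have hP := fun v : EuclideanSpace ℝ (Fin J) =>
    ((bddMeas_inner_sieveVec hψ θ₀ v).sub hFi).pow 2
  simp only [indexRisk, sieveRisk, smul_eq_mul]
  rw [← integral_const_mul, ← integral_const_mul, ← integral_add ((hP x).const_mul a).integrable
    ((hP y).const_mul b).integrable]
  refine integral_mono (hP _).integrable
    (((hP x).const_mul a).add ((hP y).const_mul b)).integrable fun w => ?_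
  simp only [inner_add_left, inner_smul_left, conj_trivial]
  generalize inner ℝ x (sieveVec ψ J (index θ₀ w)) = X
  generalize inner ℝ y (sieveVec ψ J (index θ₀ w)) = Y
  generalize F₀ (index θ₀ w) = Z
  have e : b = 1 - a := by linarith
  subst e
  nlinarith [mul_nonneg (mul_nonneg ha hb) (sq_nonneg (X - Y))]

/-- This is what reduces a batch to a single observation by Jensen's inequality; no independence
inside the batch is needed. -/
theorem convexOn_excess_pow (hψ : ∀ j, 1 ≤ j → BddMeas (ψ j)) (hF : BddMeas F₀) (J : ℕ) (r : ℝ)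
    (m : ℕ) : ConvexOn ℝ Set.univ
      (fun a : EuclideanSpace ℝ (Fin J) => (max (indexRisk ρ θ₀ ψ F₀ a - r) 0) ^ m) := by
  have h1 : ConvexOn ℝ Set.univ
      (fun a : EuclideanSpace ℝ (Fin J) => max (indexRisk ρ θ₀ ψ F₀ a - r) 0) :=
    ConvexOn.sup (f := fun a => indexRisk ρ θ₀ ψ F₀ a - r)
      (by simpa only [sub_eq_add_neg, Pi.add_def] using
        (convexOn_indexRisk hψ hF J).add (convexOn_const (-r) convex_univ))
      (convexOn_const 0 convex_univ)
  exact h1.pow (fun _ _ => le_max_right _ _) m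

theorem mul_norm_sub_projCoef_sq_le {J : ℕ} {c C : ℝ} (hc : 0 < c)
    (hψ : ∀ j, 1 ≤ j → BddMeas (ψ j)) (h : spectrum ℝ (gram ρ θ₀ ψ J) ⊆ Set.Icc c C)
    (hF : BddMeas F₀) (a : EuclideanSpace ℝ (Fin J)) :
    c * ‖a - projCoef ρ θ₀ ψ J F₀‖ ^ 2 ≤ indexRisk ρ θ₀ ψ F₀ a := by
  refine le_trans ?_ (projCoef_pythagoras hc hψ h hF a)
  exact le_add_of_nonneg_left (integral_nonneg fun _ => sq_nonneg _)

theorem measurable_truncUpdate (hd : ∀ j, 1 ≤ j → Differentiable ℝ (ψ j)) (hF : Measurable F₀)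
    (J : ℕ) (η Λ : ℝ) : Measurable (fun q : (EuclideanSpace ℝ (Fin J) × EuclideanSpace ℝ (Fin p))
      × Obs p => truncUpdate F₀ θ₀ ψ η Λ q.1.2 q.1.1 q.2) := by
  have h1 : Measurable (fun q : (EuclideanSpace ℝ (Fin J) × EuclideanSpace ℝ (Fin p)) × Obs p =>
      sieveVec ψ J (index q.1.2 q.2)) :=
    (continuous_sieveVec hd J).measurable.comp
      (measurable_index_uncurry.comp (measurable_fst.snd.prodMk measurable_snd))
  have h2 : Measurable (fun q : (EuclideanSpace ℝ (Fin J) × EuclideanSpace ℝ (Fin p)) × Obs p =>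
      truncNoise F₀ θ₀ Λ q.2) := (measurable_truncNoise hF Λ).comp measurable_snd
  have h3 : Measurable (fun q : (EuclideanSpace ℝ (Fin J) × EuclideanSpace ℝ (Fin p)) × Obs p =>
      F₀ (index θ₀ q.2)) := hF.comp ((measurable_index θ₀).comp measurable_snd)
  have h4 : Measurable (fun q : (EuclideanSpace ℝ (Fin J) × EuclideanSpace ℝ (Fin p)) × Obs p =>
      inner ℝ q.1.1 (sieveVec ψ J (index q.1.2 q.2))) := measurable_fst.fst.inner h1
  unfold truncUpdate
  exact measurable_fst.fst.add ((((h2.add h3).sub h4).const_mul η).smul h1)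

end Risk

section History

variable {Ω : Type*} {p B : ℕ} {obs : ℕ → Fin B → Ω → Obs p}

theorem history_mono {i j : ℕ} (hij : i ≤ j) : history obs i ≤ history obs j :=
  biSup_mono fun _ hk => Finset.Icc_subset_Icc_right hij hk

theorem measurable_history_obs {j k : ℕ} (hj : 1 ≤ j) (hjk : j ≤ k) (i : Fin B) :
    Measurable[history obs k] (obs j i) := by
  have : MeasurableSpace.comap (obs j i) inferInstance ≤ history obs k :=
    (le_iSup (fun i : Fin B => MeasurableSpace.comap (obs j i) inferInstance) i).trans
      (le_iSup₂ (f := fun (j : ℕ) (_ : j ∈ Finset.Icc 1 k) =>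
        ⨆ i : Fin B, MeasurableSpace.comap (obs j i) inferInstance) j (Finset.mem_Icc.2 ⟨hj, hjk⟩))
  exact Measurable.mono (comap_measurable _) this le_rfl

variable [mΩ : MeasurableSpace Ω] {μ : Measure Ω} {ρ : Measure (Obs p)}

theorem IsSample.history_le (hs : IsSample μ ρ obs) (k : ℕ) : history obs k ≤ mΩ :=
  iSup₂_le fun j hj => iSup_le fun i => (hs.meas j (Finset.mem_Icc.1 hj).1 i).comap_le

theorem IsSample.indep_history (hs : IsSample μ ρ obs) (k : ℕ) (i : Fin B) :
    Indep (history obs k) (MeasurableSpace.comap (obs (k + 1) i) inferInstance) μ := by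
  have h := indep_iSup_of_disjoint
    (m := fun q : ℕ × Fin B => MeasurableSpace.comap (obs (q.1 + 1) q.2) inferInstance)
    (fun q => (hs.meas (q.1 + 1) (Nat.le_add_left 1 _) q.2).comap_le) hs.indep.iIndep
    -- The family is shifted by one: q.1 < k stands for the rounds 1, …, k, and (k, i) for
    -- observation i of round k + 1.
    (S := {q | q.1 < k}) (T := {(k, i)}) (by simp)
  rw [iSup_singleton] at h
  refine indep_of_indep_of_le_left h ?_
  refine iSup₂_le fun j hj => iSup_le fun i' => ?_
  obtain ⟨hj1, hjk⟩ := Finset.mem_Icc.1 hj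
  have e : j - 1 + 1 = j := Nat.sub_add_cancel hj1
  have := le_iSup₂ (f := fun (q : ℕ × Fin B) (_ : q ∈ {q : ℕ × Fin B | q.1 < k}) =>
    MeasurableSpace.comap (obs (q.1 + 1) q.2) (inferInstance : MeasurableSpace (Obs p)))
    (j - 1, i') (by show j - 1 < k; omega)
  simpa only [e] using this

variable [IsProbabilityMeasure μ]

/-- Integrating out a fresh observation which is independent of the past. -/
theorem IsSample.setLIntegral_fresh (hs : IsSample μ ρ obs) (k : ℕ) (i : Fin B)
    {α : Type*} [MeasurableSpace α] {S : Ω → α} (hS : Measurable[history obs k] S) {A : Set Ω}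
    (hA : MeasurableSet[history obs k] A) {Φ : α × Obs p → ℝ≥0∞} (hΦ : Measurable Φ) :
    ∫⁻ ω in A, Φ (S ω, obs (k + 1) i ω) ∂μ = ∫⁻ ω in A, ∫⁻ w, Φ (S ω, w) ∂ρ ∂μ := by
  have hle := hs.history_le k
  have hobs := hs.meas (k + 1) (Nat.le_add_left 1 _) i
  have hlaw := hs.law (k + 1) (Nat.le_add_left 1 _) i
  have : IsProbabilityMeasure ρ := hlaw ▸ Measure.isProbabilityMeasure_map hobs.aemeasurable
  -- The indicator of A is made a coordinate of the state, so that the product law handles the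
  -- restriction to A as well.
  set S' : Ω → α × ℝ≥0∞ := fun ω => (S ω, A.indicator (fun _ => 1) ω) with hS'd
  have hS' : Measurable[history obs k] S' :=
    hS.prodMk ((@measurable_const ℝ≥0∞ Ω _ (history obs k) 1).indicator hA)
  have hS'm : Measurable S' := hS'.mono hle le_rfl
  have hAm : MeasurableSet A := hle _ hA
  have hind : IndepFun S' (obs (k + 1) i) μ :=
    (IndepFun_iff_Indep _ _ _).2 (indep_of_indep_of_le_left (hs.indep_history k i) hS'.comap_le)
  have hprod := (indepFun_iff_map_prod_eq_prod_map_map hS'm.aemeasurable hobs.aemeasurable).1 hind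
  set g : (α × ℝ≥0∞) × Obs p → ℝ≥0∞ := fun q => q.1.2 * Φ (q.1.1, q.2) with hg
  have hgm : Measurable g :=
    measurable_fst.snd.mul (hΦ.comp (measurable_fst.fst.prodMk measurable_snd))
  have e1 : ∫⁻ ω in A, Φ (S ω, obs (k + 1) i ω) ∂μ = ∫⁻ ω, g (S' ω, obs (k + 1) i ω) ∂μ := by
    rw [← lintegral_indicator hAm]
    refine lintegral_congr fun ω => ?_
    by_cases h : ω ∈ A <;> simp [hg, hS'd, h]
  have e2 : ∫⁻ ω in A, ∫⁻ w, Φ (S ω, w) ∂ρ ∂μ = ∫⁻ ω, ∫⁻ w, g (S' ω, w) ∂ρ ∂μ := by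
    rw [← lintegral_indicator hAm]
    refine lintegral_congr fun ω => ?_
    by_cases h : ω ∈ A <;> simp [hg, hS'd, h]
  rw [e1, e2, ← lintegral_map (f := g) hgm (hS'm.prodMk hobs), hprod,
    lintegral_prod _ hgm.aemeasurable, hlaw, lintegral_map hgm.lintegral_prod_right' hS'm]

end History

section Iterates

variable {Ω : Type*} {p B : ℕ} {θ₀ : EuclideanSpace ℝ (Fin p)} {ψ : ℕ → ℝ → ℝ} {F₀ : ℝ → ℝ}
  {obs : ℕ → Fin B → Ω → Obs p} {θc : ℕ → Ω → EuclideanSpace ℝ (Fin p)}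

theorem measurable_sieveIter (hd : ∀ j, 1 ≤ j → Differentiable ℝ (ψ j))
    (hθ : ∀ k, Measurable[history obs k] (θc k)) (J : ℕ → ℕ) (η : ℕ → ℝ)
    (b₀ : EuclideanSpace ℝ (Fin (J 0))) (k : ℕ) :
    Measurable[history obs k]
      (fun ω => sieveIter ψ J η b₀ (fun k i => obs k i ω) (fun k => θc k ω) k) := by
  induction k with
  | zero => exact measurable_const
  | succ k ih =>
    have hle : history obs k ≤ history obs (k + 1) := history_mono (Nat.le_succ k)
    have ha : Measurable[history obs (k + 1)] (fun ω => pad (J (k + 1))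
        (sieveIter ψ J η b₀ (fun k i => obs k i ω) (fun k => θc k ω) k)) :=
      measurable_pad.comp (ih.mono hle le_rfl)
    have hθ' : Measurable[history obs (k + 1)] (θc k) := (hθ k).mono hle le_rfl
    have ho : ∀ i, Measurable[history obs (k + 1)] (obs (k + 1) i) := fun i =>
      measurable_history_obs (Nat.le_add_left 1 k) le_rfl i
    have hΨ : ∀ i, Measurable[history obs (k + 1)]
        (fun ω => sieveVec ψ (J (k + 1)) (index (θc k ω) (obs (k + 1) i ω))) := fun i =>
      (continuous_sieveVec hd _).measurable.comp
        (measurable_index_uncurry.comp (hθ'.prodMk (ho i)))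
    simp only [sieveIter]
    refine ha.add ?_
    apply Measurable.fun_const_smul
    refine Finset.measurable_fun_sum _ fun i _ => ?_
    exact ((ho i).snd.snd.sub ((hΨ i).inner ha)).smul (hΨ i)

/-- All B corrections start from the same padded vector, so the batch step is an average; noise
within Λ is not altered by truncation. -/
theorem sieveIter_succ_eq_avg (hB : 1 ≤ B) (J : ℕ → ℕ) (η : ℕ → ℝ)
    (b₀ : EuclideanSpace ℝ (Fin (J 0))) (W : ℕ → Fin B → Obs p)
    (θ : ℕ → EuclideanSpace ℝ (Fin p)) (k : ℕ) (Λ : ℝ)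
    (hΛ : ∀ i, |noise F₀ θ₀ (W (k + 1) i)| ≤ Λ) :
    sieveIter ψ J η b₀ W θ (k + 1) = ∑ i : Fin B, (1 / (B : ℝ)) •
      truncUpdate F₀ θ₀ ψ (η (k + 1)) Λ (θ k)
        (pad (J (k + 1)) (sieveIter ψ J η b₀ W θ k)) (W (k + 1) i) := by
  have hB' : (B : ℝ) ≠ 0 := by exact_mod_cast (by omega : B ≠ 0)
  have hY : ∀ i, truncNoise F₀ θ₀ Λ (W (k + 1) i) + F₀ (index θ₀ (W (k + 1) i))
      = (W (k + 1) i).2.2 := fun i => by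
    rw [truncNoise, if_pos (hΛ i), noise, sub_add_cancel]
  simp only [sieveIter, truncUpdate, hY, smul_add, Finset.sum_add_distrib, Finset.sum_const,
    Finset.card_univ, Fintype.card_fin, ← Nat.cast_smul_eq_nsmul ℝ, smul_smul]
  rw [mul_one_div_cancel hB', one_smul, Finset.smul_sum]
  congr 1
  refine Finset.sum_congr rfl fun i _ => ?_
  rw [smul_smul]
  congr 1
  rw [real_inner_comm]
  ring

end Iterates
end OnlineSieve

/-! ### The moment recursion for the iterates, and Borel–Cantelli -/

namespace OnlineSieve

section Recursion

variable {Ω : Type*} [mΩ : MeasurableSpace Ω] {μ : Measure Ω} [IsProbabilityMeasure μ] {p B : ℕ}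
  {ρ : Measure (Obs p)} [IsProbabilityMeasure ρ] {θ₀ : EuclideanSpace ℝ (Fin p)}
  {ψ : ℕ → ℝ → ℝ} {F₀ : ℝ → ℝ} {obs : ℕ → Fin B → Ω → Obs p}
  {θc : ℕ → Ω → EuclideanSpace ℝ (Fin p)}

/-- The bound on the new noise is not known at time k, hence two events: on A' the true step is the
average of truncated ones, so Jensen applies; the integral of the nonnegative truncated terms is
then enlarged to A, which lies in the history, and the fresh observation is integrated out there. -/
theorem setLIntegral_excess_succ_le (hB : 1 ≤ B) (hs : IsSample μ ρ obs)
    (hd : ∀ j, 1 ≤ j → Differentiable ℝ (ψ j)) (hψ : ∀ j, 1 ≤ j → BddMeas (ψ j))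
    (hF : BddMeas F₀) (hθ : ∀ k, Measurable[history obs k] (θc k)) (J : ℕ → ℕ) (η : ℕ → ℝ)
    (b₀ : EuclideanSpace ℝ (Fin (J 0))) (k m : ℕ) (hJ : J k ≤ J (k + 1)) {δ Λ q q' : ℝ}
    {α β : ℝ≥0∞}
    (hstep : ∀ θ : EuclideanSpace ℝ (Fin p), ‖θ - θ₀‖ ≤ δ →
      ∀ a : EuclideanSpace ℝ (Fin (J (k + 1))),
        ∫⁻ w, ENNReal.ofReal ((max (indexRisk ρ θ₀ ψ F₀
            (truncUpdate F₀ θ₀ ψ (η (k + 1)) Λ θ a w) - q') 0) ^ m) ∂ρ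
          ≤ α * ENNReal.ofReal ((max (indexRisk ρ θ₀ ψ F₀ a - q) 0) ^ m) + β)
    {A A' : Set Ω} (hA : MeasurableSet[history obs k] A) (hAA : A' ⊆ A) (hA' : MeasurableSet A')
    (hδ : ∀ ω ∈ A, ‖θc k ω - θ₀‖ ≤ δ)
    (hΛ : ∀ ω ∈ A', ∀ i, |noise F₀ θ₀ (obs (k + 1) i ω)| ≤ Λ) :
    ∫⁻ ω in A', ENNReal.ofReal ((max (indexRisk ρ θ₀ ψ F₀
        (sieveIter ψ J η b₀ (fun k i => obs k i ω) (fun k => θc k ω) (k + 1)) - q') 0) ^ m) ∂μ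
      ≤ α * ∫⁻ ω in A, ENNReal.ofReal ((max (indexRisk ρ θ₀ ψ F₀
        (sieveIter ψ J η b₀ (fun k i => obs k i ω) (fun k => θc k ω) k) - q) 0) ^ m) ∂μ + β := by
  have hle := hs.history_le k
  have hAm : MeasurableSet A := hle _ hA
  have hiter := measurable_sieveIter hd hθ J η b₀ k
  set Φ : (EuclideanSpace ℝ (Fin (J (k + 1))) × EuclideanSpace ℝ (Fin p)) × Obs p → ℝ≥0∞ :=
    fun x => ENNReal.ofReal ((max (indexRisk ρ θ₀ ψ F₀
      (truncUpdate F₀ θ₀ ψ (η (k + 1)) Λ x.1.2 x.1.1 x.2) - q') 0) ^ m) with hΦd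
  have hΦ : Measurable Φ :=
    (((((measurable_indexRisk hd hF.1 _).comp
      (measurable_truncUpdate hd hF.1 _ _ _)).sub_const q').max measurable_const).pow_const
        m).ennreal_ofReal
  set S : Ω → EuclideanSpace ℝ (Fin (J (k + 1))) × EuclideanSpace ℝ (Fin p) := fun ω =>
    (pad (J (k + 1)) (sieveIter ψ J η b₀ (fun k i => obs k i ω) (fun k => θc k ω) k), θc k ω)
    with hSd
  have hS : Measurable[history obs k] S := (measurable_pad.comp hiter).prodMk (hθ k)
  have hB' : (0 : ℝ) < B := by exact_mod_cast hB
  have hobs : ∀ i, Measurable (obs (k + 1) i) := hs.meas (k + 1) (Nat.le_add_left 1 k)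
  have hΦi : ∀ i, Measurable (fun ω => Φ (S ω, obs (k + 1) i ω)) := fun i =>
    hΦ.comp ((hS.mono hle le_rfl).prodMk (hobs i))
  have hjensen : ∀ ω ∈ A', ENNReal.ofReal ((max (indexRisk ρ θ₀ ψ F₀
      (sieveIter ψ J η b₀ (fun k i => obs k i ω) (fun k => θc k ω) (k + 1)) - q') 0) ^ m)
      ≤ ∑ i : Fin B, ENNReal.ofReal (1 / (B : ℝ)) * Φ (S ω, obs (k + 1) i ω) := by
    intro ω hω
    rw [sieveIter_succ_eq_avg (F₀ := F₀) (θ₀ := θ₀) hB J η b₀ _ _ k Λ (hΛ ω hω)]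
    have h1 := (convexOn_excess_pow (ρ := ρ) (θ₀ := θ₀) hψ hF (J (k + 1)) q' m).map_sum_le
      (t := Finset.univ) (w := fun _ : Fin B => 1 / (B : ℝ))
      (p := fun i => truncUpdate F₀ θ₀ ψ (η (k + 1)) Λ (θc k ω) (S ω).1 (obs (k + 1) i ω))
      (fun _ _ => by positivity) (by simp [hB'.ne']) (fun _ _ => Set.mem_univ _)
    refine (ENNReal.ofReal_le_ofReal h1).trans ?_
    rw [ENNReal.ofReal_sum_of_nonneg fun i _ => by
      rw [smul_eq_mul]
      exact mul_nonneg (by positivity) (pow_nonneg (le_max_right _ _) _)]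
    refine le_of_eq (Finset.sum_congr rfl fun i _ => ?_)
    rw [smul_eq_mul, ENNReal.ofReal_mul (by positivity)]
  have hone : ∑ _i : Fin B, ENNReal.ofReal (1 / (B : ℝ)) = 1 := by
    rw [← ENNReal.ofReal_sum_of_nonneg fun _ _ => by positivity]
    simp [hB'.ne']
  have hμA : μ A ≤ 1 := prob_le_one
  have hTm : Measurable (fun ω => ENNReal.ofReal ((max (indexRisk ρ θ₀ ψ F₀
      (sieveIter ψ J η b₀ (fun k i => obs k i ω) (fun k => θc k ω) k) - q) 0) ^ m)) :=
    (((((measurable_indexRisk hd hF.1 _).comp (hiter.mono hle le_rfl)).sub_const q).max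
      measurable_const).pow_const m).ennreal_ofReal
  set X := ∫⁻ ω in A, ENNReal.ofReal ((max (indexRisk ρ θ₀ ψ F₀
        (sieveIter ψ J η b₀ (fun k i => obs k i ω) (fun k => θc k ω) k) - q) 0) ^ m) ∂μ with hX
  have hfresh : ∀ i : Fin B, ∫⁻ ω in A, Φ (S ω, obs (k + 1) i ω) ∂μ ≤ α * X + β := by
    intro i
    rw [hs.setLIntegral_fresh k i hS hA hΦ]
    calc _ ≤ ∫⁻ ω in A, α * ENNReal.ofReal ((max (indexRisk ρ θ₀ ψ F₀
          (sieveIter ψ J η b₀ (fun k i => obs k i ω) (fun k => θc k ω) k) - q) 0) ^ m) + β ∂μ := by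
          refine setLIntegral_mono' hAm fun ω hω => ?_
          have h2 := hstep (θc k ω) (hδ ω hω) (S ω).1
          simp only [hSd, indexRisk_pad ρ θ₀ ψ F₀ hJ] at h2
          exact h2
      _ = α * X + β * μ A := by
          rw [lintegral_add_left (hTm.const_mul α), lintegral_const_mul _ hTm, lintegral_const,
            Measure.restrict_apply_univ]
      _ ≤ _ := by
          gcongr
          exact mul_le_of_le_one_right' hμA
  calc _ ≤ ∫⁻ ω in A', ∑ i : Fin B, ENNReal.ofReal (1 / (B : ℝ)) * Φ (S ω, obs (k + 1) i ω) ∂μ :=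
        setLIntegral_mono' hA' hjensen
    _ ≤ ∫⁻ ω in A, ∑ i : Fin B, ENNReal.ofReal (1 / (B : ℝ)) * Φ (S ω, obs (k + 1) i ω) ∂μ :=
        lintegral_mono_set hAA
    _ = ∑ i : Fin B, ENNReal.ofReal (1 / (B : ℝ)) * ∫⁻ ω in A, Φ (S ω, obs (k + 1) i ω) ∂μ := by
        rw [lintegral_finsetSum _ fun i _ => (hΦi i).const_mul _]
        exact Finset.sum_congr rfl fun i _ => lintegral_const_mul _ (hΦi i)
    _ ≤ ∑ i : Fin B, ENNReal.ofReal (1 / (B : ℝ)) * (α * X + β) :=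
        Finset.sum_le_sum fun i _ => mul_le_mul_right (hfresh i) _
    _ = α * X + β := by rw [← Finset.sum_mul, hone, one_mul]

end Recursion

/-- A Borel–Cantelli criterion through Markov's inequality. -/
theorem ae_eventually_lt_one_of_setLIntegral_le {Ω : Type*} [MeasurableSpace Ω] {μ : Measure Ω}
    {f : ℕ → Ω → ℝ≥0∞} {A : ℕ → Set Ω} {M b : ℝ} (hb : 1 < b) (k₀ : ℕ)
    (hf : ∀ k, k₀ ≤ k → Measurable (f k))
    (h : ∀ k, k₀ ≤ k → ∫⁻ ω in A k, f k ω ∂μ ≤ ENNReal.ofReal (M * (k : ℝ) ^ (-b))) :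
    ∀ᵐ ω ∂μ, ∀ᶠ k in atTop, ω ∈ A k → f k ω < 1 := by
  set S : ℕ → Set Ω := fun k => {ω | k₀ ≤ k ∧ ω ∈ A k ∧ 1 ≤ f k ω} with hS
  have hle : ∀ k, μ (S k) ≤ ENNReal.ofReal (M * (k : ℝ) ^ (-b)) := by
    intro k
    by_cases hk : k₀ ≤ k
    · have h1 := mul_meas_ge_le_lintegral (μ := μ.restrict (A k)) (hf k hk) 1
      rw [one_mul, Measure.restrict_apply (measurableSet_le measurable_const (hf k hk))] at h1
      refine (measure_mono ?_).trans (h1.trans (h k hk))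
      exact fun ω hω => ⟨hω.2.2, hω.2.1⟩
    · have : S k = ∅ := by
        ext ω; simp [hS, hk]
      rw [this, measure_empty]
      exact zero_le
  have hsum : Summable fun k : ℕ => M * (k : ℝ) ^ (-b) :=
    (Real.summable_nat_rpow.2 (by linarith)).mul_left M
  have hne : ∑' k, μ (S k) ≠ ∞ :=
    ne_top_of_le_ne_top hsum.tsum_ofReal_ne_top (ENNReal.tsum_le_tsum hle)
  filter_upwards [ae_eventually_notMem hne] with ω hω
  filter_upwards [hω, eventually_ge_atTop k₀] with k hk hk0 hA
  by_contra hlt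
  exact hk ⟨hk0, hA, not_lt.1 hlt⟩

/-- With `τ κ > 1` the noise in round `k` is eventually at most `k ^ τ`. -/
theorem IsSample.eventually_noise_le {Ω : Type*} [MeasurableSpace Ω] {μ : Measure Ω} {p B : ℕ}
    {ρ : Measure (Obs p)} {θ₀ : EuclideanSpace ℝ (Fin p)} {F₀ : ℝ → ℝ}
    {obs : ℕ → Fin B → Ω → Obs p}
    (hs : IsSample μ ρ obs) (hF : Measurable F₀) {κ τ : ℝ} (hκ : 0 < κ) (hτκ : 1 < τ * κ)
    (hε : Integrable (fun w : Obs p => |noise F₀ θ₀ w| ^ κ) ρ) :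
    ∀ᵐ ω ∂μ, ∀ᶠ k : ℕ in atTop, ∀ i, |noise F₀ θ₀ (obs k i ω)| ≤ (k : ℝ) ^ τ := by
  simp only [eventually_all]
  intro i
  have hn := measurable_noise (θ₀ := θ₀) hF
  have hg : Measurable (fun w : Obs p => ENNReal.ofReal (|noise F₀ θ₀ w| ^ κ)) :=
    (hn.abs.pow_const κ).ennreal_ofReal
  have hgk : ∀ k, 1 ≤ k →
      Measurable fun ω => ENNReal.ofReal (|noise F₀ θ₀ (obs k i ω)| ^ κ) :=
    fun k hk => hg.comp (hs.meas k hk i)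
  have hlaw : ∀ k, 1 ≤ k → ∫⁻ w, ENNReal.ofReal (|noise F₀ θ₀ w| ^ κ) ∂ρ
      = ∫⁻ ω, ENNReal.ofReal (|noise F₀ θ₀ (obs k i ω)| ^ κ) ∂μ := fun k hk => by
    rw [← hs.law k hk i, lintegral_map hg (hs.meas k hk i)]
  have := ae_eventually_lt_one_of_setLIntegral_le (μ := μ) (A := fun _ => Set.univ)
    (f := fun k ω => ENNReal.ofReal (|noise F₀ θ₀ (obs k i ω)| ^ κ)
      * ENNReal.ofReal ((k : ℝ) ^ (-(τ * κ))))
    (M := ∫ w, |noise F₀ θ₀ w| ^ κ ∂ρ) hτκ 1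
    (fun k hk => (hgk k hk).mul_const _) (fun k hk => by
      rw [Measure.restrict_univ, lintegral_mul_const _ (hgk k hk),
        ENNReal.ofReal_mul (integral_nonneg fun _ => Real.rpow_nonneg (abs_nonneg _) _),
        ofReal_integral_eq_lintegral_ofReal hε
          (ae_of_all _ fun _ => Real.rpow_nonneg (abs_nonneg _) _), ← hlaw k hk])
  filter_upwards [this] with ω hω
  filter_upwards [hω, eventually_ge_atTop 1] with k hk hk1
  have hk0 : (0 : ℝ) < k := by exact_mod_cast hk1
  have h1 := hk (Set.mem_univ _)
  rw [← ENNReal.ofReal_mul (Real.rpow_nonneg (abs_nonneg _) _), ENNReal.ofReal_lt_one,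
    Real.rpow_neg hk0.le, ← div_eq_mul_inv, div_lt_one (by positivity), Real.rpow_mul hk0.le] at h1
  exact (Real.rpow_le_rpow_iff (abs_nonneg _) (by positivity) hκ).1 h1.le

end OnlineSieve

/-! ### Choice of the exponents and the almost sure rate of the risk -/

namespace OnlineSieve

/-- The moment condition leaves room for τ in (1/κ, α_η/2): above 1/κ truncation is eventually
invisible, below α_η/2 the factor ηΛ² tends to 0. The exponent ϕ is slightly below α_θ, yet large
enough for ϑ → 0 and δ² = O(u). -/
theorem exists_exponents {αη αJ αψ αθ s κ : ℝ} (hαη : 0 < αη) (hαJ : 0 < αJ) (hαψ : 0 < αψ)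
    (h₁ : αη < 1) (h₂ : 2 * αJ < αη) (h₃ : αJ * (1 + αψ) < αθ) (h₄ : 1 < s)
    (hκ : 2 + 2 / αη < κ)
    (h₉ : αη < min (2 * αθ - 2 * αJ * αψ) (αJ * (2 * s + 1))) :
    ∃ γ ϕ τ ι : ℝ, Exponents αη αJ αψ s κ γ ϕ τ ι ∧ ϕ < αθ ∧ 1 < τ * κ := by
  obtain ⟨h9a, h9b⟩ := lt_min_iff.1 h₉
  have hJψ : 0 < αJ * αψ := by positivity
  obtain ⟨ϕ, hϕ1, hϕ2⟩ := exists_between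
    (show max ((αη - αJ) / 2) (αJ * (1 + αψ)) < αθ from max_lt (by linarith) h₃)
  obtain ⟨hϕa, hϕb⟩ := max_lt_iff.1 hϕ1
  have hκ0 : 0 < κ := by
    have : 0 < 2 / αη := by positivity
    linarith
  have hκη : 1 / κ < αη / 2 := by
    rw [div_lt_div_iff₀ hκ0 two_pos]
    have : 2 / αη * αη = 2 := by field_simp
    nlinarith
  obtain ⟨τ, hτ1, hτ2⟩ := exists_between hκη
  have hτ0 : 0 < τ := lt_trans (by positivity) hτ1
  have hτκ : 1 < τ * κ := by rwa [div_lt_iff₀ hκ0] at hτ1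
  -- A quarter of the smallest slack left in the strict inequalities.
  obtain ⟨ι, hι0, hι⟩ := exists_between
    (show (0 : ℝ) < min (min (αη - αJ) (αη - 2 * τ)) (min αJ (1 - αη)) / 4 by
      have : 0 < min (min (αη - αJ) (αη - 2 * τ)) (min αJ (1 - αη)) :=
        lt_min (lt_min (by linarith) (by linarith)) (lt_min hαJ (by linarith))
      positivity)
  have hι4 : 4 * ι < min (min (αη - αJ) (αη - 2 * τ)) (min αJ (1 - αη)) := by linarith
  simp only [lt_min_iff] at hι4
  obtain ⟨⟨i1, i2⟩, i3, i4⟩ := hι4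
  refine ⟨αη - αJ, ϕ, τ, ι, ?_, hϕ2, hτκ⟩
  constructor <;> first | assumption | rfl | nlinarith

variable {Ω : Type*} [MeasurableSpace Ω] {μ : Measure Ω} {p B : ℕ}
  {ρ : Measure (Obs p)} {θ₀ : EuclideanSpace ℝ (Fin p)}
  {ψ : ℕ → ℝ → ℝ} {F₀ : ℝ → ℝ} {obs : ℕ → Fin B → Ω → Obs p}
  {θc : ℕ → Ω → EuclideanSpace ℝ (Fin p)}

/-- The loss from α_θ to ϕ swallows the power of the logarithm and the random constant. -/
theorem PlugIn.eventually_norm_sub_le {αθ ϕ : ℝ} (h : PlugIn μ obs θ₀ θc αθ) (hϕ : ϕ < αθ) :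
    ∀ᵐ ω ∂μ, ∀ᶠ k : ℕ in atTop, ‖θc k ω - θ₀‖ ≤ (k : ℝ) ^ (-ϕ) := by
  obtain ⟨r, hr⟩ := h.rate
  have h1 : (fun k : ℕ => (k : ℝ) ^ (-αθ) * Real.log k ^ r) =o[atTop]
      fun k : ℕ => (k : ℝ) ^ (-αθ) * (k : ℝ) ^ (αθ - ϕ) :=
    (isBigO_refl _ _).mul_isLittleO
      ((isLittleO_log_rpow_rpow_atTop r (sub_pos.2 hϕ)).comp_tendsto tendsto_natCast_atTop_atTop)
  filter_upwards [hr] with ω hω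
  filter_upwards [(hω.trans_isLittleO h1).bound one_pos, eventually_ge_atTop 1] with k hk hk1
  have hk0 : (0 : ℝ) < k := by exact_mod_cast hk1
  rw [norm_norm, one_mul, ← Real.rpow_add hk0, Real.norm_of_nonneg (by positivity)] at hk
  refine hk.trans (le_of_eq ?_)
  congr 1; ring

variable [IsProbabilityMeasure μ] [IsProbabilityMeasure ρ]

/-- Moments are controlled only on events where the excess at a starting round is bounded and the
plug-in and noise bounds have held since. Almost every path lies in all of these events for some
integers k₀ and M, and there are only countably many pairs. -/
theorem ae_eventually_indexRisk_le (hB : 1 ≤ B) (hmodel : IndexModel ρ F₀ θ₀)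
    (hsample : IsSample μ ρ obs) {s s₁ αη αJ αψ αθ κ γ ϕ τ ι : ℝ}
    (hbasis : SieveBasis ρ θ₀ ψ αψ) (happrox : SieveApprox ρ θ₀ ψ F₀ s s₁) (hs₁ : 0 < s₁)
    (hs : 1 < s) (hF₀ : Measurable F₀) (hF₀' : supNorm (deriv F₀) < ∞)
    (hX : Integrable (fun w : Obs p => ‖w.2.1‖ ^ 2) ρ) (hκ : 4 ≤ κ)
    (hε : Integrable (fun w : Obs p => |noise F₀ θ₀ w| ^ κ) ρ)
    (hplug : PlugIn μ obs θ₀ θc αθ) (hϕ : ϕ < αθ) (hτκ : 1 < τ * κ) (hαη : 0 < αη) (hαη1 : αη < 1)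
    (hexp : Exponents αη αJ αψ s κ γ ϕ τ ι) {η₀ : ℝ} (hη₀ : 0 < η₀) {J₀ : ℕ} (hJ₀ : 1 ≤ J₀)
    (b₀ : EuclideanSpace ℝ (Fin (sieveDim J₀ αJ 0))) :
    ∃ K : ℝ, 0 ≤ K ∧ ∀ᵐ ω ∂μ, ∀ᶠ k : ℕ in atTop, indexRisk ρ θ₀ ψ F₀
      (sieveIter ψ (sieveDim J₀ αJ) (learnRate η₀ αη) b₀ (fun k i => obs k i ω)
        (fun k => θc k ω) k) ≤ K * (k : ℝ) ^ (-γ) := by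
  -- A moment so high that the gain k^{-ι(n+2)} is summable.
  obtain ⟨n, hn, hnι⟩ : ∃ n : ℕ, Even n ∧ 1 < ι * (n + 2 : ℕ) := by
    obtain ⟨N, hN⟩ := exists_nat_gt (1 / ι)
    refine ⟨2 * N, even_two_mul N, ?_⟩
    rw [div_lt_iff₀ hexp.ι_pos] at hN
    push_cast
    nlinarith [hexp.ι_pos, (Nat.cast_nonneg N : (0 : ℝ) ≤ N)]
  obtain ⟨K, c₂, C₂, hK, hc₂, hC₂, hcontr⟩ := exists_eventual_contraction hmodel hbasis happrox hs₁ hs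
    hF₀ hF₀' hX hκ hε hexp hη₀ hJ₀ n hn
  obtain ⟨A₁, -, hFA, -⟩ := exists_sieve_approx hbasis happrox
  have hF : BddMeas F₀ := ⟨hF₀, A₁, hFA⟩
  have hd := hbasis.differentiable
  set m := n + 2 with hm
  set a := (ι + γ) * (m : ℕ) with ha
  have ha1 : 1 ≤ a := by
    have : 0 ≤ γ * (m : ℝ) := mul_nonneg hexp.γ_pos.le (Nat.cast_nonneg _)
    rw [ha, add_mul]; linarith
  set b : (k : ℕ) → Ω → EuclideanSpace ℝ (Fin (sieveDim J₀ αJ k)) := fun k ω =>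
    sieveIter ψ (sieveDim J₀ αJ) (learnRate η₀ αη) b₀ (fun k i => obs k i ω) (fun k => θc k ω) k
    with hb
  have hbm : ∀ k, Measurable[history obs k] (b k) := fun k =>
    measurable_sieveIter hd hplug.adapted _ _ b₀ k
  set T : ℕ → Ω → ℝ := fun k ω => max (indexRisk ρ θ₀ ψ F₀ (b k ω) - K * (k : ℝ) ^ (-γ)) 0 with hT
  have hT0 : ∀ k ω, 0 ≤ T k ω := fun _ _ => le_max_right _ _
  have hTm : ∀ k, Measurable[history obs k] (T k) := fun k =>
    (((measurable_indexRisk hd hF₀ _).comp (hbm k)).sub_const _).max measurable_const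
  have hTm' : ∀ k, Measurable (T k) := fun k => (hTm k).mono (hsample.history_le k) le_rfl
  obtain ⟨k₁, hk₁⟩ := eventually_atTop.1 (hcontr.and
    (eventually_recursion_bound hη₀ hαη hαη1 hc₂ hC₂ ha1))
  -- The plug-in bound runs up to l = k, as θc k is used in round k + 1; the noise bound starts at
  -- k₀ + 1. The bound M serves to make the recursion start from a finite value.
  set A : ℕ → ℕ → ℕ → Set Ω := fun k₀ M k => ({ω | T k₀ ω ^ m ≤ M} ∩
    ⋂ l ∈ Finset.Icc k₀ k, {ω | ‖θc l ω - θ₀‖ ≤ (l : ℝ) ^ (-ϕ)}) ∩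
    ⋂ l ∈ Finset.Ioc k₀ k, ⋂ i, {ω | |noise F₀ θ₀ (obs l i ω)| ≤ (l : ℝ) ^ τ} with hA
  have hAm : ∀ k₀ M k, k₀ ≤ k → MeasurableSet[history obs k] (A k₀ M k) := by
    intro k₀ M k hk
    refine MeasurableSet.inter (MeasurableSet.inter ?_ ?_) ?_
    · have hT' : Measurable[history obs k] (T k₀) := (hTm k₀).mono (history_mono hk) le_rfl
      exact hT' (measurableSet_le (measurable_id.pow_const m) measurable_const)
    · refine Finset.measurableSet_biInter _ fun l hl => ?_
      have hθ : Measurable[history obs k] (θc l) :=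
        (hplug.adapted l).mono (history_mono (Finset.mem_Icc.1 hl).2) le_rfl
      exact hθ (measurableSet_le (measurable_id.sub_const θ₀).norm measurable_const)
    · refine Finset.measurableSet_biInter _ fun l hl => MeasurableSet.iInter fun i => ?_
      obtain ⟨hl1, hl2⟩ := Finset.mem_Ioc.1 hl
      exact measurable_history_obs (obs := obs) (by omega : 1 ≤ l) hl2 i
        (measurableSet_le (measurable_noise (θ₀ := θ₀) hF₀).abs measurable_const)
  have hAmono : ∀ k₀ M k, A k₀ M (k + 1) ⊆ A k₀ M k := by
    intro k₀ M k
    refine Set.inter_subset_inter (Set.inter_subset_inter_right _ ?_) ?_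
    · exact Set.biInter_subset_biInter_left (Finset.Icc_subset_Icc_right (Nat.le_succ k))
    · exact Set.biInter_subset_biInter_left (Finset.Ioc_subset_Ioc_right (Nat.le_succ k))
  have hmain : ∀ k₀ M : ℕ, k₁ ≤ k₀ → ∀ᵐ ω ∂μ, ∀ᶠ k in atTop, ω ∈ A k₀ M k →
      T k ω < (k : ℝ) ^ (-γ) := by
    intro k₀ M hk₀
    obtain ⟨M', hM', hx⟩ := (hk₁ k₀ hk₀).2
      (fun k => ∫⁻ ω in A k₀ M k, ENNReal.ofReal (T k ω ^ m) ∂μ) (by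
        refine ne_top_of_le_ne_top (b := ENNReal.ofReal M) ENNReal.ofReal_ne_top ?_
        calc _ ≤ ∫⁻ ω in A k₀ M k₀, ENNReal.ofReal M ∂μ :=
              setLIntegral_mono' (hsample.history_le _ _ (hAm k₀ M k₀ le_rfl)) fun ω hω =>
                ENNReal.ofReal_le_ofReal hω.1.1
          _ = ENNReal.ofReal M * μ (A k₀ M k₀) := by
              rw [lintegral_const, Measure.restrict_apply_univ]
          _ ≤ _ := mul_le_of_le_one_right' prob_le_one)
      (fun k hk => setLIntegral_excess_succ_le hB hsample hd hbasis.bddMeas hF hplug.adapted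
        (sieveDim J₀ αJ) (learnRate η₀ αη) b₀ k m (monotone_sieveDim J₀ hexp.αJ_pos.le k)
        (hk₁ k (hk₀.trans hk)).1 (hAm k₀ M k hk) (hAmono k₀ M k)
        (hsample.history_le _ _ (hAm k₀ M (k + 1) (hk.trans (Nat.le_succ k))))
        (fun ω hω => Set.mem_iInter₂.1 hω.1.2 k (Finset.mem_Icc.2 ⟨hk, le_rfl⟩))
        (fun ω hω i => by
          have h := Set.mem_iInter₂.1 hω.2 (k + 1) (Finset.mem_Ioc.2 ⟨by omega, le_rfl⟩)
          exact Set.mem_iInter.1 h i))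
    have hTk : ∀ k, Measurable fun ω => ENNReal.ofReal (T k ω ^ m) := fun k =>
      ((hTm' k).pow_const m).ennreal_ofReal
    -- Markov's inequality for (T_k k^γ)^m: the moment bound k^{-(ι+γ)m} leaves k^{-ιm} after the
    -- normalisation.
    have := ae_eventually_lt_one_of_setLIntegral_le (μ := μ) (A := A k₀ M)
      (f := fun k ω => ENNReal.ofReal (T k ω ^ m) * ENNReal.ofReal ((k : ℝ) ^ (γ * m)))
      (M := M') hnι (max k₀ 1) (fun k _ => (hTk k).mul_const _) (fun k hk => by
        have hk0 : (0 : ℝ) < k := by exact_mod_cast (le_max_right k₀ 1).trans hk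
        rw [lintegral_mul_const _ (hTk k)]
        refine (mul_le_mul_left (hx k ((le_max_left _ _).trans hk)) _).trans (le_of_eq ?_)
        rw [← ENNReal.ofReal_mul (by positivity), mul_assoc, ← Real.rpow_add hk0]
        congr 3
        rw [ha]; ring)
    filter_upwards [this] with ω hω
    filter_upwards [hω, eventually_ge_atTop 1] with k hk hk1 hkA
    have hk0 : (0 : ℝ) < k := by exact_mod_cast hk1
    have h1 := hk hkA
    rw [← ENNReal.ofReal_mul (pow_nonneg (hT0 k ω) _), ENNReal.ofReal_lt_one, Real.rpow_mul hk0.le,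
      Real.rpow_natCast, ← mul_pow] at h1
    have h2 : T k ω * (k : ℝ) ^ γ < 1 := by
      by_contra hge
      exact absurd h1 (not_lt.2 (one_le_pow₀ (not_lt.1 hge)))
    rw [Real.rpow_neg hk0.le, ← one_div, lt_div_iff₀ (by positivity)]
    exact h2
  refine ⟨K + 1, by linarith, ?_⟩
  have hall : ∀ᵐ ω ∂μ, ∀ k₀ M : ℕ, k₁ ≤ k₀ → ∀ᶠ k in atTop, ω ∈ A k₀ M k →
      T k ω < (k : ℝ) ^ (-γ) := by
    rw [ae_all_iff]; intro k₀
    rw [ae_all_iff]; intro M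
    by_cases hk : k₁ ≤ k₀
    · filter_upwards [hmain k₀ M hk] with ω hω _ using hω
    · exact ae_of_all _ fun ω h => absurd h hk
  filter_upwards [hall, hplug.eventually_norm_sub_le hϕ,
    hsample.eventually_noise_le hF₀ (by linarith) hτκ hε] with ω h1 h2 h3
  -- Here k₂, and with it k₀ and M, depends on the path; this is why `hall` covers all pairs
  -- simultaneously.
  obtain ⟨k₂, hk₂⟩ := eventually_atTop.1 (h2.and h3)
  set k₀ := max k₁ k₂ with hk₀
  obtain ⟨M, hM⟩ := exists_nat_ge (T k₀ ω ^ m)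
  filter_upwards [h1 k₀ M (le_max_left _ _)] with k hk
  have hmem : ω ∈ A k₀ M k := by
    refine ⟨⟨hM, Set.mem_iInter₂.2 fun l hl => ?_⟩, Set.mem_iInter₂.2 fun l hl =>
      Set.mem_iInter.2 fun i => ?_⟩
    · exact (hk₂ l ((le_max_right _ _).trans (Finset.mem_Icc.1 hl).1)).1
    · exact (hk₂ l ((le_max_right _ _).trans (Finset.mem_Ioc.1 hl).1.le)).2 i
  have h4 : indexRisk ρ θ₀ ψ F₀ (b k ω) - K * (k : ℝ) ^ (-γ) ≤ T k ω := le_max_left _ _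
  have h5 := hk hmem
  rw [add_mul, one_mul]
  linarith

end OnlineSieve

/-! ### From the risk to the coefficients -/

open OnlineSieve in
theorem theorem5
    {Ω : Type*} [MeasurableSpace Ω] (μ : Measure Ω) [IsProbabilityMeasure μ]
    (p B : ℕ) (hB : 1 ≤ B)
    (ρ : Measure (Obs p)) [IsProbabilityMeasure ρ]
    (F₀ : ℝ → ℝ) (θ₀ : EuclideanSpace ℝ (Fin p)) (ψ : ℕ → ℝ → ℝ)
    (obs : ℕ → Fin B → Ω → Obs p) (θc : ℕ → Ω → EuclideanSpace ℝ (Fin p))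
    (J₀ : ℕ) (η₀ αη αJ αψ αθ s s₁ κ : ℝ)
    (b₀ : EuclideanSpace ℝ (Fin (sieveDim J₀ αJ 0)))
    -- the model and the data
    (hmodel : IndexModel ρ F₀ θ₀)
    (hsample : IsSample μ ρ obs)
    -- the sieve
    (hs₁ : 0 < s₁) (hs₁s : s₁ ≤ s)
    (happrox : SieveApprox ρ θ₀ ψ F₀ s s₁)
    (hαψ : 0 < αψ)
    (hbasis : SieveBasis ρ θ₀ ψ αψ)
    -- the tuning parameters
    (hη₀ : 0 < η₀) (hJ₀ : 1 ≤ J₀) (hαη : 0 < αη) (hαJ : 0 < αJ)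
    -- the plug-in estimator
    (hαθ : 0 < αθ)
    (hplug : PlugIn μ obs θ₀ θc αθ)
    -- the basic restrictions on the exponents
    (h₁ : αη < 1) (h₂ : 2 * αJ < αη) (h₃ : αJ * (1 + αψ) < αθ) (h₄ : 1 < s)
    (h₅ : 1 < αη + (2 * s - 1) * αJ)
    (h₆ : 1 < αη + 2 * αθ - αJ * (1 + 2 * αψ))
    (h₇ : 1 + αJ < 2 * αη)
    -- smoothness and moments
    (hF₀ : Differentiable ℝ F₀) (hF₀' : supNorm (deriv F₀) < ∞)
    (hX : Integrable (fun w : Obs p => ‖w.2.1‖ ^ 2) ρ)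
    (hκ : 2 + 2 / αη < κ)
    (hε : Integrable (fun w : Obs p => |noise F₀ θ₀ w| ^ κ) ρ)
    -- the additional restrictions on the exponents
    (h₈ : max (1 / 2 + αJ) (1 + 2 * αJ * (1 + αψ) - 2 * αθ) < αη)
    (h₉ : αη < min (2 * αθ - 2 * αJ * αψ) (αJ * (2 * s + 1))) :
    ∀ᵐ ω ∂μ,
      (fun N : ℕ =>
        ‖sieveIter ψ (sieveDim J₀ αJ) (learnRate η₀ αη) b₀
            (fun k i => obs k i ω) (fun k => θc k ω) N
          - projCoef ρ θ₀ ψ (sieveDim J₀ αJ N) F₀‖)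
      =O[atTop] fun N : ℕ =>
        (N : ℝ) ^ (-((αη - αJ) / 2)) * Real.log N ^ (1 / 2 : ℝ) := by
  -- As α_η < 1, the moment condition includes the fourth moment used for the second moment of the
  -- risk increments.
  have hκ4 : 4 ≤ κ := by
    have : 2 ≤ 2 / αη := by rw [le_div_iff₀ hαη]; linarith
    linarith
  have hF₀m : Measurable F₀ := hF₀.continuous.measurable
  obtain ⟨γ, ϕ, τ, ι, hexp, hϕ, hτκ⟩ := exists_exponents hαη hαJ hαψ h₁ h₂ h₃ h₄ hκ h₉
  obtain ⟨K, hK, hrisk⟩ := ae_eventually_indexRisk_le hB hmodel hsample hbasis happrox hs₁ h₄ hF₀m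
    hF₀' hX hκ4 hε hplug hϕ hτκ hαη h₁ hexp hη₀ hJ₀ b₀
  obtain ⟨c, C, hc, hspec⟩ := hbasis.eigenvalues
  obtain ⟨A, -, hFA, -⟩ := exists_sieve_approx hbasis happrox
  filter_upwards [hrisk] with ω hω
  refine IsBigO.of_bound (√(K / c)) ?_
  filter_upwards [hω, eventually_ge_atTop 3] with N hN hN3
  have hN0 : (3 : ℝ) ≤ N := by exact_mod_cast hN3
  -- For N ≥ 3 the logarithmic factor is at least 1, so it only enlarges a bound that holds without
  -- it.
  have hlog : 1 ≤ Real.log N := by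
    rw [Real.le_log_iff_exp_le (by linarith)]
    linarith [Real.exp_one_lt_d9]
  have hdist := (mul_norm_sub_projCoef_sq_le hc hbasis.bddMeas
    (hspec _ (one_le_sieveDim hJ₀ hαJ.le N)) ⟨hF₀m, A, hFA⟩ _).trans hN
  rw [norm_norm, Real.norm_of_nonneg (by positivity)]
  have hsq : ((N : ℝ) ^ (-((αη - αJ) / 2))) ^ 2 = (N : ℝ) ^ (-γ) := by
    rw [← Real.rpow_natCast, ← Real.rpow_mul (by linarith), hexp.γ_eq]
    congr 1; push_cast; ring
  refine le_trans ?_ (mul_le_mul_of_nonneg_left (le_mul_of_one_le_right (by positivity)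
    (Real.one_le_rpow hlog (by norm_num))) (Real.sqrt_nonneg _))
  refine (pow_le_pow_iff_left₀ (norm_nonneg _) (by positivity) two_ne_zero).1 ?_
  rw [mul_pow, Real.sq_sqrt (by positivity), hsq, div_mul_eq_mul_div, le_div_iff₀ hc]
  linarith
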